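/- **Setting.** Let $\mathcal X$ be a measurable space, $\mathcal C\subseteq\{0,1\}^{\mathcal X}$ a concept class, and $\mathsf{dim}\ge 0$ a real number attached to $\mathcal C$ (any measure of its complexity, e.g. the representation dimension). A distribution $\mathcal D$ on $\mathcal X\times\{0,1\}$ is *realizable* if some $c\in\mathcal C$ has error $\Pr_{(x,y)\sim\mathcal D}[c(x)\ne y]=0$. A randomized learner on $n$ samples is an *$(\alpha,\beta)$-PAC learner for $\mathcal C$* if for every realizable $\mathcal D$, on $n$ i.i.d. samples from $\mathcal D$, its output hypothesis has error at most $\alpha$ with probability at least $1-\beta$. It is *$\varepsilon$-DP* if $\Pr[\mathcal A(S)\in E]\le e^{\varepsilon}\Pr[\mathcal A(S')\in E]$ for all samples $S,S'$ differing in at most one example and all events $E$. It is *$\rho$-replicable* if for every distribution $\mathcal D$ on $\mathcal X\times\{0,1\}$, $\Pr_{S,S'\sim\mathcal D^n,\,r}[\mathcal A(S;r)\neq\mathcal A(S';r)]\le\rho$, where $r$ is the shared internal randomness. Running times include both the (worst-case) time to output a model and the time to evaluate the output model at a point. The transformed learner is a fixed program for a random access machine with unit-cost addition, subtraction, comparison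 with zero, indirect addressing and fair coin flips. It treats points of $\mathcal X$ and models returned by the given learner $\mathcal A$ as opaque objects; it may ask for the sample size of $\mathcal A$ at given parameters, run $\mathcal A$ with fresh randomness on data sets of its choice (points being taken from its sample or equal to an arbitrary fixed point $x_0\in\mathcal X$), and evaluate the models so obtained at points, being charged the running time of $\mathcal A$ for each of these runs and evaluations. The points and labels of its sample can be read by index, and its input consists of $\lceil 1/\alpha'\rceil,\lceil 1/\rho\rceil,\lceil\log_2(1/\beta')\rceil$. Its output model is a list of numbers together with the models returned by $\mathcal A$, and is evaluated at a point by a second such program, which is deterministic and can evaluate the listed models at that point but cannot run $\mathcal A$. **Theorem.** There is such a program (with its evaluation program), not depending on $\mathcal X$, $\mathcal C$ or $\mathcal A$, with the following property. For all polynomials $p$ (in four variables) and $q$ (in one variable) with coefficients in $\mathbb N$ there are polynomials $P,Q$ with coefficients in $\mathbb N$ and a constant $K\in\mathbb N$, depending only on $p,q$, such that the following holds for all $\mathcal X$, $\mathcal C$, $\mathsf{dim}$. Let $\mathcal A$ be a learner which, for all $\alpha,\varepsilon,\beta\in(0,1)$, is an $\varepsilon$-DP $(\alpha,\beta)$-PAC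 learner for $\mathcal C$ with sample size $m(\alpha,\varepsilon,\beta)\le p(1/\alpha,1/\varepsilon,\log(1/\beta),\mathsf{dim})$ and running time at most $q(m(\alpha,\varepsilon,\beta))$. Then for all $\alpha',\rho,\beta'\in(0,1)$ and every $x_0\in\mathcal X$, the program with subroutine $\mathcal A$ is a $\rho$-replicable $(\alpha',\beta')$-PAC learner for $\mathcal C$ on some number $$n\le P\bigl(1/\alpha',1/\rho,\log(1/\beta'),\mathsf{dim}\bigr)$$ of samples, with running time at most $$Q\bigl(1/\alpha',1/\rho,\log(1/\beta')\bigr)\cdot\exp\bigl(K(1+\mathsf{dim}^k)\bigr),$$ where $k$ is the degree of $p$ in its last variable $\mathsf{dim}$ (so the last factor is $\exp(O(1+\mathsf{dim}))$ when the sample size of $\mathcal A$ is linear in $\mathsf{dim}$). -/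

import Mathlib

open MeasureTheory Set

noncomputable section

namespace ReplicablePrivacy

/-! ## Learning notions

Labelled examples are elements of `X × Bool`.  A randomized algorithm on samples of size `n` is a
function of the sample and of a random seed. -/

section Learning

/-- The misclassification error of `f` under the distribution `D` of labelled examples. -/
def err {X : Type*} [MeasurableSpace X] (D : Measure (X × Bool)) (f : X → Bool) : ENNReal :=
  D {z | f z.1 ≠ z.2}

/-- `D` is realizable by the class `C`: some concept of `C` has error zero. -/
def Realizable {X : Type*} [MeasurableSpace X] (C : Set (X → Bool)) (D : Measure (X × Bool)) :
    Prop :=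
  ∃ c ∈ C, err D c = 0

/-- `(α, β)`-PAC learning of `C` in the realizable setting: for each realizable distribution, the
probability over an i.i.d. sample of size `n` and the seed (of law `ν`) that the error exceeds `α`
is at most `β`. -/
def IsPAC {X Ω : Type*} [MeasurableSpace X] [MeasurableSpace Ω] (ν : Measure Ω)
    (C : Set (X → Bool)) {n : ℕ} (run : (Fin n → X × Bool) → Ω → X → Bool) (α β : ℝ) : Prop :=
  ∀ D : Measure (X × Bool), IsProbabilityMeasure D → Realizable C D →
    ((Measure.pi fun _ : Fin n => D).prod ν) {s | ENNReal.ofReal α < err D (run s.1 s.2)} ≤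
      ENNReal.ofReal β

/-- Pure `ε`-differential privacy: for two samples that differ in at most one example the
laws of the outputs are within a factor `exp ε` of each other on every event. -/
def IsPureDP {X Ω M : Type*} [MeasurableSpace Ω] [MeasurableSpace M] (ν : Measure Ω)
    {n : ℕ} (fit : (Fin n → X × Bool) → Ω → M) (ε : ℝ) : Prop :=
  ∀ S S' : Fin n → X × Bool, (∃ i, ∀ j, j ≠ i → S j = S' j) →
    ∀ E : Set M, MeasurableSet E →
      ν {ω | fit S ω ∈ E} ≤ ENNReal.ofReal (Real.exp ε) * ν {ω | fit S' ω ∈ E}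

/-- `ρ`-replicability, uniformly over all distributions: on two independent samples and with the
same seed, the outputs differ with probability at most `ρ`. -/
def IsReplicable {X Ω M : Type*} [MeasurableSpace X] [MeasurableSpace Ω] (ν : Measure Ω)
    {n : ℕ} (fit : (Fin n → X × Bool) → Ω → M) (ρ : ℝ) : Prop :=
  ∀ D : Measure (X × Bool), IsProbabilityMeasure D →
    (((Measure.pi fun _ : Fin n => D).prod (Measure.pi fun _ : Fin n => D)).prod ν)
      {s | fit s.1.1 s.2 ≠ fit s.1.2 s.2} ≤ ENNReal.ofReal ρ

end Learning

/-! ## The given learner -/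

/-- A randomized learning algorithm over the domain `X`, for each choice of the parameters
`α ε β` (accuracy, privacy, failure probability).  `R` is the set of its random seeds and `H` the
set of the models it outputs; `predict h` is the hypothesis `X → {0,1}` represented by `h`.
`fitTime` and `predictTime` are the numbers of steps it takes to produce a model and to evaluate
a model at a point. -/
structure Learner (X R H : Type*) [MeasurableSpace X] [MeasurableSpace R] [MeasurableSpace H] where
  size : ℝ → ℝ → ℝ → ℕ
  fit : (α ε β : ℝ) → (Fin (size α ε β) → X × Bool) → R → H
  predict : H → X → Bool
  fitTime : (α ε β : ℝ) → (Fin (size α ε β) → X × Bool) → R → ℕ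
  predictTime : H → X → ℕ
  measurable_fit : ∀ α ε β : ℝ,
    Measurable fun s : (Fin (size α ε β) → X × Bool) × R => fit α ε β s.1 s.2
  measurable_predict : Measurable fun s : H × X => predict s.1 s.2

/-- `A` is an efficient pure DP learner of `C`: for all `α ε β ∈ (0,1)` it uses at most
`p (1/α, 1/ε, log (1/β), dim)` samples, is `ε`-DP, is an `(α, β)`-PAC learner of `C`, and runs
(training, and evaluation of the trained model at a point) in time at most `q` of the number of
samples. -/
structure Learner.IsEfficientPureDP {X R H : Type*} [MeasurableSpace X] [MeasurableSpace R]
    [MeasurableSpace H] (A : Learner X R H) (ν : Measure R) (C : Set (X → Bool)) (dim : ℝ)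
    (p : MvPolynomial (Fin 4) ℕ) (q : Polynomial ℕ) : Prop where
  size_le : ∀ α ∈ Ioo (0 : ℝ) 1, ∀ ε ∈ Ioo (0 : ℝ) 1, ∀ β ∈ Ioo (0 : ℝ) 1,
    (A.size α ε β : ℝ) ≤ MvPolynomial.aeval ![1 / α, 1 / ε, Real.log (1 / β), dim] p
  dp : ∀ α ∈ Ioo (0 : ℝ) 1, ∀ ε ∈ Ioo (0 : ℝ) 1, ∀ β ∈ Ioo (0 : ℝ) 1,
    IsPureDP ν (A.fit α ε β) ε
  pac : ∀ α ∈ Ioo (0 : ℝ) 1, ∀ ε ∈ Ioo (0 : ℝ) 1, ∀ β ∈ Ioo (0 : ℝ) 1,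
    IsPAC ν C (fun S r => A.predict (A.fit α ε β S r)) α β
  fitTime_le : ∀ α ∈ Ioo (0 : ℝ) 1, ∀ ε ∈ Ioo (0 : ℝ) 1, ∀ β ∈ Ioo (0 : ℝ) 1,
    ∀ S r, A.fitTime α ε β S r ≤ q.eval (A.size α ε β)
  predictTime_le : ∀ α ∈ Ioo (0 : ℝ) 1, ∀ ε ∈ Ioo (0 : ℝ) 1, ∀ β ∈ Ioo (0 : ℝ) 1,
    ∀ S r x, A.predictTime (A.fit α ε β S r) x ≤ q.eval (A.size α ε β)

/-! ## Machine model

Structured programs for a random access machine whose cells hold natural numbers, with unit-cost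
addition and subtraction (no multiplication), indirect addressing, fair coins, and a given learner
as a subroutine.  Points of `X` are never inspected: programs refer to them by handles (natural
numbers), and likewise to the models which the learner has returned so far. -/

/-- Programs.  Arguments are addresses of cells; `[a]` is the content of cell `a`. -/
inductive Cmd : Type
  /-- do nothing -/
  | skip
  /-- `[dst] := k` -/
  | const (dst k : ℕ)
  /-- `[dst] := [a] + [b]` -/
  | add (dst a b : ℕ)
  /-- `[dst] := [a] - [b]`, truncated at zero -/
  | sub (dst a b : ℕ)
  /-- `[dst] := [[a]]` -/
  | load (dst a : ℕ)
  /-- `[[a]] := [src]` -/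
  | store (a src : ℕ)
  /-- `[dst] :=` the next coin -/
  | coin (dst : ℕ)
  /-- `[dst] :=` the label of the example with handle `[i]` -/
  | label (dst i : ℕ)
  /-- `[dst] :=` the sample size of the learner for `α = 1/[a]`, `ε = 1/[e]`, `β = 2 ^ (-[b])` -/
  | size (dst a e b : ℕ)
  /-- run the learner for `α = 1/[a]`, `ε = 1/[e]`, `β = 2 ^ (-[b])`, with a fresh seed, on the
  data set stored from cell `[ds]` on (alternately the handle of a point and its label), and append
  the resulting model to the list of models -/
  | call (a e b ds : ℕ)
  /-- `[dst] :=` the prediction of the model with handle `[h]` at the point with handle `[i]` -/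
  | eval (dst h i : ℕ)
  /-- sequential composition -/
  | seq (c₁ c₂ : Cmd)
  /-- if `[a] ≠ 0` then `c₁` else `c₂` -/
  | ite (a : ℕ) (c₁ c₂ : Cmd)
  /-- while `[a] ≠ 0` do `c` -/
  | loop (a : ℕ) (c : Cmd)

/-- Machine states: memory, models returned by the learner so far, number of coins used so far. -/
structure State (H : Type*) where
  mem : ℕ → ℕ
  hyps : List H
  pos : ℕ

/-- Write `v` into cell `a`. -/
def State.set {H : Type*} (s : State H) (a v : ℕ) : State H :=
  { s with mem := Function.update s.mem a v }

/-- What a program can read: points and labels by handle, the coins, and the seeds for the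
successive calls of the learner (`none` if coins or calls are not available). -/
structure Env (X R : Type*) where
  point : ℕ → X
  label : ℕ → Bool
  coin : ℕ → Option Bool
  seed : ℕ → Option R

section Exec

variable {X R H : Type*} [MeasurableSpace X] [MeasurableSpace R] [MeasurableSpace H]

/-- The data set of size `m` stored in memory from cell `base` on. -/
def dataset (env : Env X R) (s : State H) (base m : ℕ) : Fin m → X × Bool :=
  fun i => (env.point (s.mem (base + 2 * i)), decide (s.mem (base + 2 * i + 1) ≠ 0))

/-- `Exec A env c s t s'`: started in state `s`, the program `c` halts in state `s'` after `t` time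
steps.  Each instruction and each test costs one step; a call of the learner costs in addition the
size of its input and the running time of the learner, and evaluating one of its models costs
in addition the time of that evaluation. -/
inductive Exec (A : Learner X R H) (env : Env X R) : Cmd → State H → ℕ → State H → Prop
  | skip (s : State H) : Exec A env .skip s 1 s
  | const (s : State H) (dst k : ℕ) : Exec A env (.const dst k) s 1 (s.set dst k)
  | add (s : State H) (dst a b : ℕ) :
      Exec A env (.add dst a b) s 1 (s.set dst (s.mem a + s.mem b))
  | sub (s : State H) (dst a b : ℕ) :
      Exec A env (.sub dst a b) s 1 (s.set dst (s.mem a - s.mem b))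
  | load (s : State H) (dst a : ℕ) :
      Exec A env (.load dst a) s 1 (s.set dst (s.mem (s.mem a)))
  | store (s : State H) (a src : ℕ) :
      Exec A env (.store a src) s 1 (s.set (s.mem a) (s.mem src))
  | coin (s : State H) (dst : ℕ) (b : Bool) (hb : env.coin s.pos = some b) :
      Exec A env (.coin dst) s 1 { s.set dst b.toNat with pos := s.pos + 1 }
  | label (s : State H) (dst i : ℕ) :
      Exec A env (.label dst i) s 1 (s.set dst (env.label (s.mem i)).toNat)
  | size (s : State H) (dst a e b : ℕ) :
      Exec A env (.size dst a e b) s 1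
        (s.set dst (A.size (1 / s.mem a) (1 / s.mem e) ((1 / 2) ^ s.mem b)))
  | call (s : State H) (a e b ds : ℕ) (r : R) (hr : env.seed s.hyps.length = some r) (α ε β : ℝ)
      (hα : α = 1 / s.mem a) (hε : ε = 1 / s.mem e) (hβ : β = (1 / 2) ^ s.mem b) :
      Exec A env (.call a e b ds) s
        (1 + 2 * A.size α ε β + A.fitTime α ε β (dataset env s (s.mem ds) (A.size α ε β)) r)
        { s with hyps := s.hyps ++ [A.fit α ε β (dataset env s (s.mem ds) (A.size α ε β)) r] }
  | eval (s : State H) (dst h i : ℕ) (f : H) (hf : s.hyps[s.mem h]? = some f) :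
      Exec A env (.eval dst h i) s (1 + A.predictTime f (env.point (s.mem i)))
        (s.set dst (A.predict f (env.point (s.mem i))).toNat)
  | seq {c₁ c₂ : Cmd} {s₁ s₂ s₃ : State H} {t₁ t₂ : ℕ} :
      Exec A env c₁ s₁ t₁ s₂ → Exec A env c₂ s₂ t₂ s₃ → Exec A env (.seq c₁ c₂) s₁ (t₁ + t₂) s₃
  | ite_true {a : ℕ} {c₁ c₂ : Cmd} {s s' : State H} {t : ℕ} :
      s.mem a ≠ 0 → Exec A env c₁ s t s' → Exec A env (.ite a c₁ c₂) s (1 + t) s'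
  | ite_false {a : ℕ} {c₁ c₂ : Cmd} {s s' : State H} {t : ℕ} :
      s.mem a = 0 → Exec A env c₂ s t s' → Exec A env (.ite a c₁ c₂) s (1 + t) s'
  | loop_done {a : ℕ} {c : Cmd} {s : State H} :
      s.mem a = 0 → Exec A env (.loop a c) s 1 s
  | loop_step {a : ℕ} {c : Cmd} {s₁ s₂ s₃ : State H} {t₁ t₂ : ℕ} :
      s₁.mem a ≠ 0 → Exec A env c s₁ t₁ s₂ → Exec A env (.loop a c) s₂ t₂ s₃ →
      Exec A env (.loop a c) s₁ (1 + t₁ + t₂) s₃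

/-- The model output by a learning program: a list of numbers, together with the models that were
returned by the given learner. -/
structure Model (H : Type*) where
  words : List ℕ
  hyps : List H

/-- The output in a final state: cell `0` holds the number of words, which follow. -/
def State.output (s : State H) : Model H where
  words := List.ofFn fun i : Fin (s.mem 0) => s.mem (1 + i)
  hyps := s.hyps

/-- The random seed of a learning program: its coins, and the seeds for its calls of the learner. -/
abbrev Seed (R : Type*) : Type _ := (ℕ → Bool) × (ℕ → R)

/-- The law of the seed: independent fair coins and independent seeds of law `ν`. -/
def seedLaw (ν : Measure R) [IsProbabilityMeasure ν] : Measure (Seed R) :=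
  (Measure.infinitePi fun _ : ℕ => (PMF.uniformOfFintype Bool).toMeasure).prod
    (Measure.infinitePi fun _ : ℕ => ν)

/-- Training environment: handle `i + 1` denotes the `i`-th example of the sample; handle `0` (and
every handle out of range) denotes the fixed point `x₀`, with label `0`. -/
def trainEnv (x₀ : X) {n : ℕ} (S : Fin n → X × Bool) (ω : Seed R) : Env X R where
  point k := if h : 1 ≤ k ∧ k - 1 < n then (S ⟨k - 1, h.2⟩).1 else x₀
  label k := if h : 1 ≤ k ∧ k - 1 < n then (S ⟨k - 1, h.2⟩).2 else false
  coin k := some (ω.1 k)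
  seed k := some (ω.2 k)

/-- Initial state of training: cells `0`, `1`, `2` hold `1/α`, `1/ρ` and `log₂ (1/β)`, rounded up;
the other cells are zero. -/
def trainInit (α ρ β : ℝ) : State H where
  mem k := if k = 0 then ⌈1 / α⌉₊ else if k = 1 then ⌈1 / ρ⌉₊
    else if k = 2 then ⌈Real.logb 2 (1 / β)⌉₊ else 0
  hyps := []
  pos := 0

/-- Prediction environment: each handle denotes the query point; no coins, no calls. -/
def predictEnv (x : X) : Env X R where
  point _ := x
  label _ := false
  coin _ := none
  seed _ := none

/-- Initial state of prediction: the memory holds the words of the model. -/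
def predictInit (M : Model H) : State H where
  mem k := M.words.getD k 0
  hyps := M.hyps
  pos := 0

/-- The program `train` with subroutine `A` computes the training function `fit`, the time for
computing and writing down the model being at most `T` on every sample and every seed. -/
def Trains (A : Learner X R H) (train : Cmd) (x₀ : X) (α ρ β : ℝ) {n : ℕ}
    (fit : (Fin n → X × Bool) → Seed R → Model H) (T : ℝ) : Prop :=
  ∀ S ω, ∃ (t : ℕ) (s : State H), Exec A (trainEnv x₀ S ω) train (trainInit α ρ β) t s ∧
    s.output = fit S ω ∧ (t : ℝ) + (fit S ω).words.length ≤ T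

/-- The program `pred` evaluates the model `M`, representing the hypothesis `f`, in time at most `T`
at every point. -/
def Predicts (A : Learner X R H) (pred : Cmd) (M : Model H) (f : X → Bool) (T : ℝ) : Prop :=
  ∀ x, ∃ (t : ℕ) (s : State H), Exec A (predictEnv x) pred (predictInit M) t s ∧
    f x = decide (s.mem 0 ≠ 0) ∧ (t : ℝ) ≤ T

end Exec

end ReplicablePrivacy

end

open ReplicablePrivacy

set_option linter.unusedSectionVars false

/-! A pure private learner can be used without showing it the sample. Run it with the constant
parameters `1/16, 1/2, 1/2` on a dummy data set of size `m`. Some sample of a realizable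
distribution gives a model of error at most `1/16` with probability at least `1/2`. Group privacy
carries this over to the dummy data set at the cost of a factor `exp (m/2) ≤ 2 ^ m`. So every
realizable distribution has a fixed chance of at least `2 ^ (-(m+1))` that a dummy model is good for
it (`le_measureReal_err_dummyModel`). A list of slightly more than `2 ^ m` dummy models depends on
the shared seeds only, hence is the same in both runs of the replicability experiment; this is the
source of the factor exponential in `dim ^ k`.

It remains to combine the listed models replicably by boosting. The weight of an example is doubled
by each chosen model that is wrong on it. Reweighting keeps a distribution realizable
(`exists_reweighted`), so with high probability the list contains a good model for every possible
history of choices (`measureReal_not_allGood_le`). Each round picks the model of largest empirical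
gain plus noise. A near-optimal pick multiplies the mean weight by at most `9/8`, while an example
on which the final majority errs has weight at least `2 ^ (half the number of rounds)`; Markov's
inequality bounds the error (`integral_weight_chosen_le`, `err_majority_le`).

For replicability, the gains on two independent samples are close to common expectations, uniformly
over all histories (`measureReal_not_concentrated_le`). The noise is geometric: given the other
candidates' noise, a candidate wins if its own noise passes a threshold, and by memorylessness it
seldom passes by a small margin only. Summed over the candidates, this makes a round unstable with a
probability free of their number, apart from a tiny term for the cap (`measureReal_unstable_le`,
`measureReal_chosen_ne_le`).

All parameters are powers of one scale `L = 2 ^ κ`, which exceeds `1/α`, `1/ρ`, `log₂ (1/β)` and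
`m`: there are `4 κ` rounds, `2 ^ (m+1) L ^ 3` models, `L ^ 24` examples, deviations `L ^ 18`, noise
of success probability `L ^ (-21)` capped at `L ^ 23`. The rest verifies that an explicit program
computes this, within the stated time. -/

namespace ReplicablePrivacy

/-! ## Weakest preconditions and frames for programs -/

section Logic

variable {X R H : Type*} [MeasurableSpace X] [MeasurableSpace R] [MeasurableSpace H]

/-- Started in `s`, the program `c` halts in a state and after a time which satisfy `Q`. -/
def Wp (A : Learner X R H) (env : Env X R) (c : Cmd) (Q : State H → ℕ → Prop) (s : State H) :
    Prop :=
  ∃ t s', Exec A env c s t s' ∧ Q s' t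

@[simp] lemma State.set_mem (s : State H) (a v k : ℕ) :
    (s.set a v).mem k = if k = a then v else s.mem k := by
  simp [State.set, Function.update_apply]

@[simp] lemma State.set_hyps (s : State H) (a v : ℕ) : (s.set a v).hyps = s.hyps := rfl

@[simp] lemma State.set_pos (s : State H) (a v : ℕ) : (s.set a v).pos = s.pos := rfl

variable {A : Learner X R H} {env : Env X R} {Q Q' : State H → ℕ → Prop} {s : State H}

lemma Wp.mono {c : Cmd} (h : Wp A env c Q s) (hQ : ∀ s' t, Q s' t → Q' s' t) :
    Wp A env c Q' s := by
  obtain ⟨t, s', h, h'⟩ := h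
  exact ⟨t, s', h, hQ _ _ h'⟩

/-- This rule and most of the following ones are equivalences, so that `simp only` can execute
straight-line code symbolically. -/
lemma wp_skip : Wp A env .skip Q s ↔ Q s 1 := by
  constructor
  · rintro ⟨t, s', h, h'⟩; cases h; exact h'
  · exact fun h => ⟨_, _, .skip s, h⟩

lemma wp_const {d k : ℕ} : Wp A env (.const d k) Q s ↔ Q (s.set d k) 1 := by
  constructor
  · rintro ⟨t, s', h, h'⟩; cases h; exact h'
  · exact fun h => ⟨_, _, .const s d k, h⟩

lemma wp_add {d a b : ℕ} : Wp A env (.add d a b) Q s ↔ Q (s.set d (s.mem a + s.mem b)) 1 := by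
  constructor
  · rintro ⟨t, s', h, h'⟩; cases h; exact h'
  · exact fun h => ⟨_, _, .add s d a b, h⟩

lemma wp_sub {d a b : ℕ} : Wp A env (.sub d a b) Q s ↔ Q (s.set d (s.mem a - s.mem b)) 1 := by
  constructor
  · rintro ⟨t, s', h, h'⟩; cases h; exact h'
  · exact fun h => ⟨_, _, .sub s d a b, h⟩

lemma wp_load {d a : ℕ} : Wp A env (.load d a) Q s ↔ Q (s.set d (s.mem (s.mem a))) 1 := by
  constructor
  · rintro ⟨t, s', h, h'⟩; cases h; exact h'
  · exact fun h => ⟨_, _, .load s d a, h⟩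

lemma wp_store {a b : ℕ} : Wp A env (.store a b) Q s ↔ Q (s.set (s.mem a) (s.mem b)) 1 := by
  constructor
  · rintro ⟨t, s', h, h'⟩; cases h; exact h'
  · exact fun h => ⟨_, _, .store s a b, h⟩

lemma wp_label {d i : ℕ} :
    Wp A env (.label d i) Q s ↔ Q (s.set d (env.label (s.mem i)).toNat) 1 := by
  constructor
  · rintro ⟨t, s', h, h'⟩; cases h; exact h'
  · exact fun h => ⟨_, _, .label s d i, h⟩

lemma wp_size {d a e b : ℕ} :
    Wp A env (.size d a e b) Q s ↔
      Q (s.set d (A.size (1 / s.mem a) (1 / s.mem e) ((1 / 2) ^ s.mem b))) 1 := by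
  constructor
  · rintro ⟨t, s', h, h'⟩; cases h; exact h'
  · exact fun h => ⟨_, _, .size s d a e b, h⟩

lemma wp_coin {d : ℕ} {c : ℕ → Bool} (hc : ∀ k, env.coin k = some (c k)) :
    Wp A env (.coin d) Q s ↔ Q { s.set d (c s.pos).toNat with pos := s.pos + 1 } 1 := by
  constructor
  · rintro ⟨t, s', h, h'⟩
    cases h with
    | coin _ _ b hb => rw [hc] at hb; cases hb; exact h'
  · exact fun h => ⟨_, _, .coin s d _ (hc _), h⟩

lemma wp_eval {d h i : ℕ} {f : H} (hf : s.hyps[s.mem h]? = some f)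
    (hQ : Q (s.set d (A.predict f (env.point (s.mem i))).toNat)
      (1 + A.predictTime f (env.point (s.mem i)))) :
    Wp A env (.eval d h i) Q s :=
  ⟨_, _, .eval s d h i f hf, hQ⟩

lemma wp_seq {c₁ c₂ : Cmd} : Wp A env (.seq c₁ c₂) Q s ↔
    Wp A env c₁ (fun s₁ t₁ => Wp A env c₂ (fun s₂ t₂ => Q s₂ (t₁ + t₂)) s₁) s := by
  constructor
  · rintro ⟨t, s', h, h'⟩
    cases h with
    | seq h₁ h₂ => exact ⟨_, _, h₁, _, _, h₂, h'⟩
  · rintro ⟨t₁, s₁, h₁, t₂, s₂, h₂, h'⟩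
    exact ⟨_, _, .seq h₁ h₂, h'⟩

lemma wp_ite {a : ℕ} {c₁ c₂ : Cmd} : Wp A env (.ite a c₁ c₂) Q s ↔
    if s.mem a = 0 then Wp A env c₂ (fun s' t => Q s' (1 + t)) s
    else Wp A env c₁ (fun s' t => Q s' (1 + t)) s := by
  constructor
  · rintro ⟨t, s', h, h'⟩
    cases h with
    | ite_true ha h => rw [if_neg ha]; exact ⟨_, _, h, h'⟩
    | ite_false ha h => rw [if_pos ha]; exact ⟨_, _, h, h'⟩
  · intro h
    split_ifs at h with ha
    · obtain ⟨t, s', h, h'⟩ := h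
      exact ⟨_, _, .ite_false ha h, h'⟩
    · obtain ⟨t, s', h, h'⟩ := h
      exact ⟨_, _, .ite_true ha h, h'⟩

/-- Here `k` is the number of iterations left, which need not be the content of the tested cell.
This generality serves `wp_scale`, where the test is a difference of numbers. -/
lemma wp_loop_iff {a : ℕ} {c : Cmd} (I : ℕ → State H → Prop) (B : ℕ)
    (hI : ∀ k s', I k s' → (s'.mem a = 0 ↔ k = 0))
    (step : ∀ k s', I (k + 1) s' → Wp A env c (fun s'' t => I k s'' ∧ t ≤ B) s') (k : ℕ) :
    ∀ s, I k s → Wp A env (.loop a c) (fun s' t => I 0 s' ∧ t ≤ 1 + k * (B + 1)) s := by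
  induction k with
  | zero => exact fun s h => ⟨_, _, .loop_done ((hI _ _ h).2 rfl), h, by simp⟩
  | succ k ih =>
    intro s h
    obtain ⟨t₁, s₁, h₁, hI₁, ht₁⟩ := step k s h
    obtain ⟨t₂, s₂, h₂, hI₂, ht₂⟩ := ih s₁ hI₁
    refine ⟨_, _, .loop_step (by simp [hI _ _ h]) h₁ h₂, hI₂, ?_⟩
    linarith

lemma wp_loop {a : ℕ} {c : Cmd} (I : ℕ → State H → Prop) (B : ℕ)
    (hI : ∀ k s', I k s' → s'.mem a = k)
    (step : ∀ k s', I (k + 1) s' → Wp A env c (fun s'' t => I k s'' ∧ t ≤ B) s') (k : ℕ) :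
    ∀ s, I k s → Wp A env (.loop a c) (fun s' t => I 0 s' ∧ t ≤ 1 + k * (B + 1)) s :=
  wp_loop_iff I B (fun k s' h => by rw [hI k s' h]) step k

/-- The registers to which a program writes directly. -/
def Cmd.writes : Cmd → List ℕ
  | .skip => []
  | .const d _ => [d]
  | .add d _ _ => [d]
  | .sub d _ _ => [d]
  | .load d _ => [d]
  | .store _ _ => []
  | .coin d => [d]
  | .label d _ => [d]
  | .size d _ _ _ => [d]
  | .call _ _ _ _ => []
  | .eval d _ _ => [d]
  | .seq c₁ c₂ => c₁.writes ++ c₂.writes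
  | .ite _ c₁ c₂ => c₁.writes ++ c₂.writes
  | .loop _ c => c.writes

/-- The program contains no indirect store. -/
def Cmd.StoreFree : Cmd → Bool
  | .store _ _ => false
  | .seq c₁ c₂ => c₁.StoreFree && c₂.StoreFree
  | .ite _ c₁ c₂ => c₁.StoreFree && c₂.StoreFree
  | .loop _ c => c.StoreFree
  | _ => true

/-- The program does not call the learner. -/
def Cmd.CallFree : Cmd → Bool
  | .call _ _ _ _ => false
  | .seq c₁ c₂ => c₁.CallFree && c₂.CallFree
  | .ite _ c₁ c₂ => c₁.CallFree && c₂.CallFree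
  | .loop _ c => c.CallFree
  | _ => true

/-- The program tosses no coins. -/
def Cmd.CoinFree : Cmd → Bool
  | .coin _ => false
  | .seq c₁ c₂ => c₁.CoinFree && c₂.CoinFree
  | .ite _ c₁ c₂ => c₁.CoinFree && c₂.CoinFree
  | .loop _ c => c.CoinFree
  | _ => true

/-- Direct writes name their cells in the program text, so for a concrete program and a concrete
register the side condition is settled by `decide`. -/
lemma Exec.mem_eq {c : Cmd} {s s' : State H} {t : ℕ} (h : Exec A env c s t s')
    (hc : c.StoreFree = true) : ∀ k ∉ c.writes, s'.mem k = s.mem k := by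
  induction h <;> simp_all [Cmd.StoreFree, Cmd.writes]

lemma Exec.hyps_eq {c : Cmd} {s s' : State H} {t : ℕ} (h : Exec A env c s t s')
    (hc : c.CallFree = true) : s'.hyps = s.hyps := by
  induction h <;> simp_all [Cmd.CallFree]

lemma Exec.pos_eq {c : Cmd} {s s' : State H} {t : ℕ} (h : Exec A env c s t s')
    (hc : c.CoinFree = true) : s'.pos = s.pos := by
  induction h <;> simp_all [Cmd.CoinFree]

/-- What a run of `c` from `s` to `s'` leaves unchanged. -/
structure Cmd.Frame (c : Cmd) (s s' : State H) : Prop where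
  mem : c.StoreFree = true → ∀ k ∉ c.writes, s'.mem k = s.mem k
  hyps : c.CallFree = true → s'.hyps = s.hyps
  pos : c.CoinFree = true → s'.pos = s.pos

lemma Exec.frame {c : Cmd} {s s' : State H} {t : ℕ} (h : Exec A env c s t s') : c.Frame s s' :=
  ⟨h.mem_eq, h.hyps_eq, h.pos_eq⟩

lemma Wp.frame {c : Cmd} (h : Wp A env c Q s) :
    Wp A env c (fun s' t => Q s' t ∧ c.Frame s s') s := by
  obtain ⟨t, s', h, h'⟩ := h
  exact ⟨t, s', h, h', h.frame⟩

lemma Cmd.Frame.refl (c : Cmd) (s : State H) : c.Frame s s :=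
  ⟨fun _ _ _ => rfl, fun _ => rfl, fun _ => rfl⟩

lemma Cmd.Frame.trans {c : Cmd} {s₁ s₂ s₃ : State H} (h : c.Frame s₁ s₂) (h' : c.Frame s₂ s₃) :
    c.Frame s₁ s₃ :=
  ⟨fun hc k hk => (h'.mem hc k hk).trans (h.mem hc k hk),
    fun hc => (h'.hyps hc).trans (h.hyps hc), fun hc => (h'.pos hc).trans (h.pos hc)⟩

/-- A counting loop, whose invariant may be used together with what the body does not change. -/
lemma wp_loop_frame {a : ℕ} {c : Cmd} (I : ℕ → State H → Prop) (B : ℕ)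
    (hI : ∀ k s', I k s' → s'.mem a = k) (s : State H)
    (step : ∀ k s', c.Frame s s' → I (k + 1) s' →
      Wp A env c (fun s'' t => I k s'' ∧ t ≤ B) s') (k : ℕ) (h : I k s) :
    Wp A env (.loop a c) (fun s' t => I 0 s' ∧ c.Frame s s' ∧ t ≤ 1 + k * (B + 1)) s := by
  refine (wp_loop (fun k s' => I k s' ∧ c.Frame s s') B (fun k s' h => hI k s' h.1) ?_ k s
    ⟨h, .refl c s⟩).mono fun s' t h => ⟨h.1.1, h.1.2, h.2⟩
  rintro k s' ⟨h, hF⟩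
  exact (step k s' hF h).frame.mono fun s'' t h => ⟨⟨h.1.1, hF.trans h.2⟩, h.1.2⟩

end Logic

/-! ## The functions computed by the learning program -/

section Functions

/-- Number of trials before the first one that consists of `σ` zeros, among `cap` trials of `σ`
coins each, starting with coin number `p`. -/
def noise (cap σ : ℕ) (c : ℕ → Bool) (p : ℕ) : ℕ :=
  ((Finset.range cap).filter fun k => ∀ k' ≤ k, ∃ b < σ, c (p + k' * σ + b) = true).card

/-- The boosting weight of an example: two to the number of wrong models in the list `l`. -/
def weight {X : Type*} (f : ℕ → X → Bool) (l : List ℕ) (z : X × Bool) : ℕ :=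
  2 ^ l.countP fun j => f j z.1 != z.2

/-- The weight of an example if model `j` is right on it, and `0` otherwise. -/
def hit {X : Type*} (f : ℕ → X → Bool) (l : List ℕ) (j : ℕ) (z : X × Bool) : ℕ :=
  if f j z.1 = z.2 then weight f l z else 0

/-- The total weight of those examples of the sample on which model `j` is right. -/
def gain {X : Type*} {n : ℕ} (f : ℕ → X → Bool) (S : Fin n → X × Bool) (l : List ℕ) (j : ℕ) : ℕ :=
  ∑ i, hit f l j (S i)

/-- The first maximizer of `v` among `0, …, N - 1`. -/
def pick (v : ℕ → ℕ) : ℕ → ℕ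
  | 0 => 0
  | k + 1 => if v (pick v k) < v k then k else pick v k

/-- The models chosen in the first `t` rounds, for noise `η` and gains `g`. -/
def chosen (N : ℕ) (η : ℕ → ℕ → ℕ) (g : List ℕ → ℕ → ℕ) : ℕ → List ℕ
  | 0 => []
  | t + 1 => chosen N η g t ++ [pick (fun j => η t j + g (chosen N η g t) j) N]

@[simp] lemma length_chosen (N : ℕ) (η : ℕ → ℕ → ℕ) (g : List ℕ → ℕ → ℕ) (t : ℕ) :
    (chosen N η g t).length = t := by
  induction t with
  | zero => rfl
  | succ t ih => simp [chosen, ih]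

lemma pick_lt (v : ℕ → ℕ) {N : ℕ} (hN : 0 < N) : pick v N < N := by
  induction N with
  | zero => simp at hN
  | succ k ih =>
    rw [pick]
    split_ifs
    · simp
    · rcases Nat.eq_zero_or_pos k with rfl | hk
      · simp [pick]
      · exact (ih hk).trans (by simp)

lemma lt_of_mem_chosen {N : ℕ} (hN : 0 < N) (η : ℕ → ℕ → ℕ) (g : List ℕ → ℕ → ℕ) (t : ℕ) :
    ∀ j ∈ chosen N η g t, j < N := by
  induction t with
  | zero => simp [chosen]
  | succ t ih =>
    intro j hj
    rw [chosen, List.mem_append] at hj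
    rcases hj with hj | hj
    · exact ih j hj
    · rw [List.mem_singleton.1 hj]; exact pick_lt _ hN

end Functions

/-! ## The learning program -/

section Programs

local infixr:60 " ;; " => Cmd.seq

/-- Toss coins: cell `26` counts the ones. -/
def flips : Cmd := .loop 28 (.coin 29 ;; .add 26 26 29 ;; .sub 28 28 4)

/-- One trial. -/
def trial : Cmd :=
  .const 26 0 ;; .const 28 0 ;; .add 28 28 15 ;; flips ;; .ite 26 .skip (.const 25 0) ;;
    .add 22 22 25

/-- Add noise to cell `22`. -/
def addNoise : Cmd :=
  .const 25 1 ;; .const 27 0 ;; .add 27 27 16 ;; .loop 27 (trial ;; .sub 27 27 4)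

/-- Cell `37` becomes nonzero if cells `36` and `31` differ. -/
def diff : Cmd := .sub 37 36 31 ;; .sub 38 31 36 ;; .add 37 37 38

/-- Double the weight in cell `32` for each chosen model that is wrong. -/
def vote : Cmd :=
  .loop 33 (.sub 33 33 4 ;; .add 34 12 33 ;; .load 35 34 ;; .eval 36 35 30 ;; diff ;;
    .ite 37 (.add 32 32 32) .skip)

/-- Add the weight of one example to cell `22`, if the candidate model is right. -/
def weighExample : Cmd :=
  .label 31 30 ;; .const 32 1 ;; .const 33 0 ;; .add 33 33 19 ;; vote ;; .eval 36 20 30 ;; diff ;;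
    .ite 37 .skip (.add 22 22 32)

/-- Add the gain of the candidate model to cell `22`. -/
def addGain : Cmd :=
  .const 30 0 ;; .add 30 30 14 ;; .loop 30 (weighExample ;; .sub 30 30 4)

/-- Compute the score of a candidate and compare it with the best one so far. -/
def candidate : Cmd :=
  .const 22 0 ;; addNoise ;; addGain ;; .sub 37 22 23 ;;
    .ite 37 (.const 23 0 ;; .add 23 23 22 ;; .const 24 0 ;; .add 24 24 20) .skip

/-- Find the candidate of the best score. -/
def search : Cmd :=
  .const 20 0 ;; .const 23 0 ;; .const 24 0 ;; .const 21 0 ;; .add 21 21 13 ;;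
    .loop 21 (candidate ;; .sub 21 21 4 ;; .add 20 20 4)

/-- One round of boosting. -/
def round : Cmd := search ;; .add 34 12 19 ;; .store 34 24 ;; .add 19 19 4

/-- All rounds of boosting. -/
def boost : Cmd := .const 18 0 ;; .add 18 18 3 ;; .loop 18 (round ;; .sub 18 18 4)

/-- Replace the content `e` of cell `a` by `2 ^ e`. -/
def expo (a : ℕ) : Cmd :=
  .const 17 0 ;; .add 17 17 a ;; .const a 1 ;; .loop 17 (.add a a a ;; .sub 17 17 4)

/-- Find the least power `2 ^ κ` which is at least the content of cell `6`. -/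
def scale : Cmd := .const 7 1 ;; .sub 9 6 7 ;; .loop 9 (.add 7 7 7 ;; .add 8 8 4 ;; .sub 9 6 7)

/-- The parameters which are multiples of `κ`, and their powers. -/
def params : Cmd :=
  .add 3 8 8 ;; .add 3 3 3 ;; .add 14 3 3 ;; .add 15 14 14 ;; .add 14 14 15 ;; .add 15 15 3 ;;
    .add 15 15 8 ;; .sub 16 14 8 ;; .sub 13 3 8 ;; .add 13 13 5 ;; .add 13 13 4 ;;
    expo 14 ;; expo 16 ;; expo 13

/-- Constants, and the sum of all relevant parameters. -/
def setup : Cmd :=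
  .const 4 1 ;; .const 10 16 ;; .const 11 2 ;; .const 12 40 ;; .size 5 10 11 4 ;; .add 6 0 1 ;;
    .add 6 6 2 ;; .add 6 6 5 ;; .const 7 64 ;; .add 6 6 7

/-- Calls of the learner on a data set that does not depend on the sample. -/
def calls : Cmd :=
  .const 21 0 ;; .add 21 21 13 ;; .loop 21 (.call 10 11 4 12 ;; .sub 21 21 4)

/-- Set the registers in a list to zero. -/
def clear : List ℕ → Cmd
  | [] => .skip
  | a :: l => .const a 0 ;; clear l

/-- Write down the model. -/
def finish : Cmd :=
  clear (1 :: 2 :: List.range' 4 36) ;; .const 0 39 ;; .add 0 0 3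

/-- The learning program. -/
def learn : Cmd := setup ;; scale ;; params ;; calls ;; boost ;; finish

/-- The evaluation program: a majority vote. -/
def majority : Cmd :=
  .const 3 1 ;; .const 4 39 ;; .const 5 0 ;; .add 6 2 7 ;;
    .loop 6 (.sub 6 6 3 ;; .add 8 4 6 ;; .load 9 8 ;; .eval 10 9 0 ;; .add 5 5 10) ;;
    .add 5 5 5 ;; .sub 0 5 2

end Programs

/-! ## Correctness and running time -/

section Correctness

variable {X R H : Type*} [MeasurableSpace X] [MeasurableSpace R] [MeasurableSpace H]
  {A : Learner X R H} {env : Env X R} {s : State H}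

lemma wp_flips {c : ℕ → Bool} (hc : ∀ k, env.coin k = some (c k)) {σ : ℕ} (h4 : s.mem 4 = 1)
    (h28 : s.mem 28 = σ) :
    Wp A env flips (fun s' t => s'.mem 26 = s.mem 26 + ∑ b ∈ Finset.range σ, (c (s.pos + b)).toNat ∧
      s'.pos = s.pos + σ ∧ t ≤ 1 + σ * 4) s := by
  refine (wp_loop_frame (fun k s' => s'.mem 28 = k ∧ ∃ b, b + k = σ ∧ s'.pos = s.pos + b ∧
    s'.mem 26 = s.mem 26 + ∑ b ∈ Finset.range b, (c (s.pos + b)).toNat) 3 (fun _ _ h => h.1) s ?_ σ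
    ⟨h28, 0, by simp⟩).mono ?_
  · rintro k s' hF ⟨h28', b, hb, hpos, h26⟩
    have h4' : s'.mem 4 = 1 := (hF.mem rfl 4 (by decide)).trans h4
    simp only [wp_seq, wp_coin hc, wp_add, wp_sub]
    refine ⟨⟨by simp [h28', h4'], b + 1, by omega, by simp [hpos]; omega, ?_⟩, by norm_num⟩
    simp [h26, Finset.sum_range_succ, hpos, add_assoc]
  · rintro s' t ⟨⟨-, b, hb, hpos, h26⟩, -, ht⟩
    obtain rfl : b = σ := by omega
    exact ⟨h26, hpos, ht⟩

lemma wp_trial {c : ℕ → Bool} (hc : ∀ k, env.coin k = some (c k)) {σ : ℕ} (h4 : s.mem 4 = 1)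
    (h15 : s.mem 15 = σ) :
    Wp A env trial (fun s' t =>
      s'.mem 25 = (if ∃ b < σ, c (s.pos + b) = true then s.mem 25 else 0) ∧
      s'.mem 22 = s.mem 22 + s'.mem 25 ∧ s'.pos = s.pos + σ ∧ t ≤ 7 + σ * 4) s := by
  simp only [trial, wp_seq, wp_const, wp_add]
  refine (wp_flips hc (σ := σ) (by simp [h4]) (by simp [h15])).frame.mono ?_
  rintro s' t ⟨⟨h26, hpos, ht⟩, hF⟩
  have h25 := hF.mem rfl 25 (by decide)
  have h22 := hF.mem rfl 22 (by decide)
  simp at h26 h25 h22 hpos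
  have key : s'.mem 26 = 0 ↔ ¬ ∃ b < σ, c (s.pos + b) = true := by
    rw [h26, Finset.sum_eq_zero_iff]
    simp [Bool.toNat_eq_zero]
  simp only [wp_ite, wp_skip, wp_const]
  by_cases h : ∃ b < σ, c (s.pos + b) = true
  · rw [if_neg (by rw [key]; exact not_not.2 h), if_pos h]
    refine ⟨by simp [h25], by simp [h22], by simp [hpos], by omega⟩
  · rw [if_pos (key.2 h), if_neg h]
    refine ⟨by simp, by simp [h22], by simp [hpos], by omega⟩

/-- The second summand is the flag in cell `25`: it is `1` until the first trial of zeros only, and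
each trial adds it to the score. -/
lemma noise_prefix (σ : ℕ) (c : ℕ → Bool) (p k : ℕ) :
    noise (k + 1) σ c p = noise k σ c p +
      if ∀ k' ≤ k, ∃ b < σ, c (p + k' * σ + b) = true then 1 else 0 := by
  classical
  rw [noise, noise, Finset.range_add_one, Finset.filter_insert]
  split_ifs
  · rw [Finset.card_insert_of_notMem (by simp)]
  · rfl

/-- All `cap` trials are carried out, even after the first success. Hence the number of coins used
does not depend on their outcomes, every candidate owns a fixed block of coins, and two runs with
the same seed stay aligned. -/
lemma wp_addNoise {c : ℕ → Bool} (hc : ∀ k, env.coin k = some (c k)) {σ cap : ℕ}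
    (h4 : s.mem 4 = 1) (h15 : s.mem 15 = σ) (h16 : s.mem 16 = cap) :
    Wp A env addNoise (fun s' t => s'.mem 22 = s.mem 22 + noise cap σ c s.pos ∧
      s'.pos = s.pos + cap * σ ∧ t ≤ 4 + cap * (9 + σ * 4)) s := by
  simp only [addNoise, wp_seq, wp_const, wp_add]
  generalize hs₀ : ((s.set 25 1).set 27 0).set 27 _ = s₀
  have h4₀ : s₀.mem 4 = 1 := by simp [← hs₀, h4]
  have h15₀ : s₀.mem 15 = σ := by simp [← hs₀, h15]
  have h22₀ : s₀.mem 22 = s.mem 22 := by simp [← hs₀]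
  have hpos₀ : s₀.pos = s.pos := by simp [← hs₀]
  have h25₀ : s₀.mem 25 = 1 := by simp [← hs₀]
  have h27₀ : s₀.mem 27 = cap := by simp [← hs₀, h16]
  refine (wp_loop_frame (fun k s' => s'.mem 27 = k ∧ ∃ b, b + k = cap ∧
    s'.pos = s.pos + b * σ ∧
    s'.mem 25 = (if ∀ k' < b, ∃ i < σ, c (s.pos + k' * σ + i) = true then 1 else 0) ∧
    s'.mem 22 = s.mem 22 + noise b σ c s.pos) (8 + σ * 4) (fun _ _ h => h.1) s₀ ?_ cap
    ⟨h27₀, 0, by simp [hpos₀, h25₀, h22₀, noise]⟩).mono ?_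
  · rintro k s' hF ⟨h27', b, hb, hpos, h25, h22⟩
    have h4' : s'.mem 4 = 1 := (hF.mem rfl 4 (by decide)).trans h4₀
    have h15' : s'.mem 15 = σ := (hF.mem rfl 15 (by decide)).trans h15₀
    simp only [wp_seq]
    refine (wp_trial hc h4' h15').frame.mono ?_
    rintro s₁ t ⟨⟨h25₁, h22₁, hpos₁, ht⟩, hF₁⟩
    have h4₁ := (hF₁.mem rfl 4 (by decide)).trans h4'
    have h27₁ := (hF₁.mem rfl 27 (by decide)).trans h27'
    rw [hpos, h25] at h25₁
    have h25₂ : s₁.mem 25 =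
        if ∀ k' < b + 1, ∃ i < σ, c (s.pos + k' * σ + i) = true then 1 else 0 := by
      rw [h25₁, ← ite_and]
      congr 1
      simp only [Nat.lt_succ_iff_lt_or_eq, or_imp, forall_and, forall_eq, eq_iff_iff]
      exact and_comm
    simp only [wp_sub]
    refine ⟨⟨by simp [h27₁, h4₁], b + 1, by omega, ?_, by simpa using h25₂, ?_⟩, by omega⟩
    · simp [hpos₁, hpos]; ring
    · simp only [State.set_mem]
      simp [h22₁, h22, noise_prefix, h25₂, add_assoc]
  · rintro s' t ⟨⟨-, b, hb, hpos, -, h22⟩, -, ht⟩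
    obtain rfl : b = cap := by omega
    refine ⟨h22, hpos, ?_⟩
    have : b * (8 + σ * 4 + 1) = b * (9 + σ * 4) := by ring
    omega

lemma wp_diff {e y : Bool} (h36 : s.mem 36 = e.toNat) (h31 : s.mem 31 = y.toNat) :
    Wp A env diff (fun s' t => (s'.mem 37 = 0 ↔ e = y) ∧ t = 3) s := by
  simp only [diff, wp_seq, wp_sub, wp_add]
  refine ⟨?_, trivial⟩
  cases e <;> cases y <;> simp [h36, h31]

/-- The models of a state are `h 0, …, h (N - 1)`, with predictions `f` and evaluation time `τ`. -/
structure Models (A : Learner X R H) (s : State H) (N : ℕ) (f : ℕ → X → Bool) (τ : ℕ) : Prop where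
  exists_get : ∀ j < N, ∃ h, s.hyps[j]? = some h ∧ A.predict h = f j ∧ ∀ x, A.predictTime h x ≤ τ

lemma Models.congr {s' : State H} {N : ℕ} {f : ℕ → X → Bool} {τ : ℕ} (h : Models A s N f τ)
    (hs : s'.hyps = s.hyps) : Models A s' N f τ :=
  ⟨by simpa [hs] using h.exists_get⟩

lemma Models.wp_eval {N : ℕ} {f : ℕ → X → Bool} {τ : ℕ} (h : Models A s N f τ) {d a i : ℕ}
    (ha : s.mem a < N) {Q : State H → ℕ → Prop}
    (hQ : ∀ t ≤ 1 + τ, Q (s.set d (f (s.mem a) (env.point (s.mem i))).toNat) t) :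
    Wp A env (.eval d a i) Q s := by
  obtain ⟨g, hg, hf, ht⟩ := h.exists_get _ ha
  refine ReplicablePrivacy.wp_eval hg ?_
  rw [hf]
  exact hQ _ (by simpa using ht _)

lemma wp_vote {N : ℕ} {f : ℕ → X → Bool} {τ : ℕ} (hM : Models A s N f τ) {l : List ℕ}
    (hl : ∀ j ∈ l, j < N) (h4 : s.mem 4 = 1) (h12 : s.mem 12 = 40) (h33 : s.mem 33 = l.length)
    (hmem : ∀ k (hk : k < l.length), s.mem (40 + k) = l[k]) {y : Bool}
    (h31 : s.mem 31 = y.toNat) (h32 : s.mem 32 = 1) :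
    Wp A env vote (fun s' t => s'.mem 32 = weight f l (env.point (s.mem 30), y) ∧
      t ≤ 1 + l.length * (10 + τ)) s := by
  -- The list is traversed from its end, so the invariant speaks of the suffix `l.drop k`.
  refine (wp_loop_frame (fun k s' => s'.mem 33 = k ∧ k ≤ l.length ∧
    s'.mem 32 = weight f (l.drop k) (env.point (s.mem 30), y)) (9 + τ) (fun _ _ h => h.1) s ?_
    l.length ⟨h33, le_rfl, by simp [weight, h32]⟩).mono ?_
  · rintro k s' hF ⟨h33', hk, h32'⟩
    have h4' : s'.mem 4 = 1 := (hF.mem rfl 4 (by decide)).trans h4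
    have h12' : s'.mem 12 = 40 := (hF.mem rfl 12 (by decide)).trans h12
    have h31' : s'.mem 31 = y.toNat := (hF.mem rfl 31 (by decide)).trans h31
    have h30' : s'.mem 30 = s.mem 30 := hF.mem rfl 30 (by decide)
    have hM' := hM.congr (hF.hyps rfl)
    have hcell : s'.mem (40 + k) = l[k] := by
      refine (hF.mem rfl _ ?_).trans (hmem k hk)
      simp [diff, Cmd.writes]; omega
    have h35 : ∀ i : ℕ, i < 40 → 40 + k ≠ i := by omega
    simp only [wp_seq, wp_sub, wp_add, wp_load]
    generalize hs₁ : State.set _ 35 _ = s₁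
    have h35₁ : s₁.mem 35 = l[k] := by
      simp [← hs₁, h12', h33', h4', h35, hcell]
    have h30₁ : s₁.mem 30 = s.mem 30 := by simp [← hs₁, h30']
    refine (hM'.congr (s' := s₁) (by simp [← hs₁])).wp_eval (h35₁ ▸ hl _ (List.getElem_mem _)) ?_
    intro t ht
    rw [h35₁, h30₁]
    refine (wp_diff (e := f l[k] (env.point (s.mem 30))) (y := y) (by simp)
      (by simp [← hs₁, h31'])).frame.mono ?_
    rintro s₂ t₂ ⟨⟨h37, rfl⟩, hF₂⟩
    have h32₂ : s₂.mem 32 = s'.mem 32 := (hF₂.mem rfl 32 (by decide)).trans (by simp [← hs₁])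
    have h33₂ : s₂.mem 33 = k :=
      (hF₂.mem rfl 33 (by decide)).trans (by simp [← hs₁, h33', h4'])
    have hw : weight f (l.drop k) (env.point (s.mem 30), y) =
        weight f (l.drop (k + 1)) (env.point (s.mem 30), y) *
          if f l[k] (env.point (s.mem 30)) = y then 1 else 2 := by
      rw [List.drop_eq_getElem_cons hk, weight, List.countP_cons, pow_add]
      congr 1
      by_cases h : f l[k] (env.point (s.mem 30)) = y <;> simp [h]
    simp only [wp_ite, wp_skip, wp_add]
    by_cases h : f l[k] (env.point (s.mem 30)) = y
    · rw [if_pos (h37.2 h)]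
      exact ⟨⟨h33₂, by omega, by rw [h32₂, h32', hw, if_pos h, mul_one]⟩, by omega⟩
    · rw [if_neg (fun h' => h (h37.1 h'))]
      refine ⟨⟨by simp [h33₂], by omega, ?_⟩, by omega⟩
      simp only [State.set_mem, if_true]
      rw [h32₂, h32', hw, if_neg h, mul_two]
  · rintro s' t ⟨⟨-, -, h32'⟩, -, ht⟩
    exact ⟨by simpa using h32', ht.trans (by ring_nf; rfl)⟩

end Correctness

/-! ### Verification of the boosting loops. -/

section Correctness

variable {X R H : Type*} [MeasurableSpace X] [MeasurableSpace R] [MeasurableSpace H]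
  {A : Learner X R H} {env : Env X R} {s : State H}

lemma wp_weighExample {N : ℕ} {f : ℕ → X → Bool} {τ : ℕ} (hM : Models A s N f τ) {l : List ℕ}
    (hl : ∀ j ∈ l, j < N) (h4 : s.mem 4 = 1) (h12 : s.mem 12 = 40) (h19 : s.mem 19 = l.length)
    (hmem : ∀ k (hk : k < l.length), s.mem (40 + k) = l[k]) (h20 : s.mem 20 < N) :
    Wp A env weighExample (fun s' t => s'.mem 22 = s.mem 22 +
        hit f l (s.mem 20) (env.point (s.mem 30), env.label (s.mem 30)) ∧
      t ≤ 11 + τ + l.length * (10 + τ)) s := by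
  simp only [weighExample, wp_seq, wp_label, wp_const, wp_add]
  generalize hs₀ : State.set _ 33 (_ + _) = s₀
  have e30 : s₀.mem 30 = s.mem 30 := by simp [← hs₀]
  have e20 : s₀.mem 20 = s.mem 20 := by simp [← hs₀]
  have e22 : s₀.mem 22 = s.mem 22 := by simp [← hs₀]
  have e31 : s₀.mem 31 = (env.label (s.mem 30)).toNat := by simp [← hs₀]
  have hM₀ : Models A s₀ N f τ := hM.congr (by simp [← hs₀])
  have h35 : ∀ k i : ℕ, i < 40 → 40 + k ≠ i := by omega
  refine (wp_vote (l := l) (y := env.label (s.mem 30)) hM₀ hl (by simp [← hs₀, h4])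
    (by simp [← hs₀, h12]) (by simp [← hs₀, h19])
    (fun k hk => by simp [← hs₀, h35, hmem k hk]) e31 (by simp [← hs₀])).frame.mono ?_
  rintro s₁ t₁ ⟨⟨h32₁, ht₁⟩, hF₁⟩
  have e20₁ := (hF₁.mem rfl 20 (by decide)).trans e20
  have e30₁ := (hF₁.mem rfl 30 (by decide)).trans e30
  have e31₁ := (hF₁.mem rfl 31 (by decide)).trans e31
  have e22₁ := (hF₁.mem rfl 22 (by decide)).trans e22
  refine (hM₀.congr (hF₁.hyps rfl)).wp_eval (by rwa [e20₁]) ?_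
  intro t ht
  rw [e20₁, e30₁]
  refine (wp_diff (e := f (s.mem 20) (env.point (s.mem 30))) (y := env.label (s.mem 30)) (by simp)
    (by simp [e31₁])).frame.mono ?_
  rintro s₂ t₂ ⟨⟨h37, rfl⟩, hF₂⟩
  have e32₂ := (hF₂.mem rfl 32 (by decide))
  have e22₂ := (hF₂.mem rfl 22 (by decide))
  simp only [State.set_mem] at e32₂ e22₂
  norm_num at e32₂ e22₂
  rw [h32₁, e30] at e32₂
  rw [e22₁] at e22₂
  simp only [wp_ite, wp_skip, wp_add]
  by_cases h : f (s.mem 20) (env.point (s.mem 30)) = env.label (s.mem 30)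
  · rw [if_pos (h37.2 h)]
    exact ⟨by simp [e22₂, e32₂, hit, h], by omega⟩
  · rw [if_neg (fun h' => h (h37.1 h'))]
    exact ⟨by simp [e22₂, hit, h], by omega⟩

lemma wp_addGain {N n : ℕ} {S : Fin n → X × Bool}
    (hS : ∀ i : Fin n, (env.point (i + 1), env.label (i + 1)) = S i)
    {f : ℕ → X → Bool} {τ : ℕ} (hM : Models A s N f τ) {l : List ℕ}
    (hl : ∀ j ∈ l, j < N) (h4 : s.mem 4 = 1) (h12 : s.mem 12 = 40) (h14 : s.mem 14 = n)
    (h19 : s.mem 19 = l.length)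
    (hmem : ∀ k (hk : k < l.length), s.mem (40 + k) = l[k]) (h20 : s.mem 20 < N) :
    Wp A env addGain (fun s' t => s'.mem 22 = s.mem 22 + gain f S l (s.mem 20) ∧
      t ≤ 3 + n * (13 + τ + l.length * (10 + τ))) s := by
  have hsum : gain f S l (s.mem 20) = ∑ i ∈ Finset.Ico 0 n,
      hit f l (s.mem 20) (env.point (i + 1), env.label (i + 1)) := by
    rw [gain, Nat.Ico_zero_eq_range, ← Fin.sum_univ_eq_sum_range
      (fun i => hit f l (s.mem 20) (env.point (i + 1), env.label (i + 1)))]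
    simp [hS]
  simp only [addGain, wp_seq, wp_const, wp_add]
  generalize hs₀ : State.set _ 30 (_ + _) = s₀
  have e (i : ℕ) (hi : i ≠ 30) : s₀.mem i = s.mem i := by simp [← hs₀, hi]
  -- Cell `30` is both the counter and the handle of the current example. It runs from `n` down to
  -- `1`, so handle `0`, the fixed point, is never weighed.
  refine (wp_loop_frame (fun k s' => s'.mem 30 = k ∧ k ≤ n ∧
    s'.mem 22 = s.mem 22 + ∑ i ∈ Finset.Ico k n,
      hit f l (s.mem 20) (env.point (i + 1), env.label (i + 1)))
    (12 + τ + l.length * (10 + τ)) (fun _ _ h => h.1) s₀ ?_ n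
    ⟨by simp [← hs₀, h14], le_rfl, by simp [← hs₀]⟩).mono ?_
  · rintro k s' hF ⟨h30', hk, h22'⟩
    have e' (i : ℕ) (hi : i ≠ 30 ∧ i ∉ (Cmd.seq weighExample (.sub 30 30 4)).writes) :
        s'.mem i = s.mem i := (hF.mem rfl i hi.2).trans (e i hi.1)
    have h4' := (e' 4 (by decide)).trans h4
    simp only [wp_seq]
    refine (wp_weighExample (N := N) (f := f) (τ := τ) (l := l)
      (hM.congr ((hF.hyps rfl).trans (by simp [← hs₀]))) hl h4'
      ((e' 12 (by decide)).trans h12) ((e' 19 (by decide)).trans h19)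
      (fun k hk => (e' _ ?_).trans (hmem k hk)) (by rwa [e' 20 (by decide)])).frame.mono ?_
    · simp [weighExample, vote, diff, Cmd.writes]; omega
    · rintro s₁ t₁ ⟨⟨h22₁, ht₁⟩, hF₁⟩
      have h4₁ := (hF₁.mem rfl 4 (by decide)).trans h4'
      have h30₁ := (hF₁.mem rfl 30 (by decide)).trans h30'
      simp only [wp_sub]
      refine ⟨⟨by simp [h30₁, h4₁], by omega, ?_⟩, by omega⟩
      rw [Finset.sum_eq_sum_Ico_succ_bot hk]
      simp only [State.set_mem]
      rw [if_neg (by decide), h22₁, h22', h30', e' 20 (by decide)]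
      ring
  · rintro s' t ⟨⟨-, -, h22'⟩, -, ht⟩
    refine ⟨by rw [h22', hsum], ?_⟩
    have : n * (12 + τ + l.length * (10 + τ) + 1) = n * (13 + τ + l.length * (10 + τ)) := by ring
    omega

lemma wp_candidate {c : ℕ → Bool} (hc : ∀ k, env.coin k = some (c k)) {N n cap σ : ℕ}
    {S : Fin n → X × Bool} (hS : ∀ i : Fin n, (env.point (i + 1), env.label (i + 1)) = S i)
    {f : ℕ → X → Bool} {τ : ℕ} (hM : Models A s N f τ) {l : List ℕ}
    (hl : ∀ j ∈ l, j < N) (h4 : s.mem 4 = 1) (h12 : s.mem 12 = 40) (h14 : s.mem 14 = n)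
    (h15 : s.mem 15 = σ) (h16 : s.mem 16 = cap) (h19 : s.mem 19 = l.length)
    (hmem : ∀ k (hk : k < l.length), s.mem (40 + k) = l[k]) (h20 : s.mem 20 < N) :
    Wp A env candidate (fun s' t =>
      s'.mem 23 = max (s.mem 23) (noise cap σ c s.pos + gain f S l (s.mem 20)) ∧
      s'.mem 24 = (if s.mem 23 < noise cap σ c s.pos + gain f S l (s.mem 20) then s.mem 20
        else s.mem 24) ∧ s'.pos = s.pos + cap * σ ∧
      t ≤ 14 + cap * (9 + σ * 4) + n * (13 + τ + l.length * (10 + τ))) s := by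
  simp only [candidate, wp_seq, wp_const]
  refine (wp_addNoise hc (σ := σ) (cap := cap) (by simp [h4]) (by simp [h15])
    (by simp [h16])).frame.mono ?_
  rintro s₁ t₁ ⟨⟨h22₁, hpos₁, ht₁⟩, hF₁⟩
  have e₁ (i : ℕ) (hi : i ≠ 22 ∧ i ∉ addNoise.writes) : s₁.mem i = s.mem i :=
    (hF₁.mem rfl i hi.2).trans (by simp [hi.1])
  refine (wp_addGain hS (hM.congr (hF₁.hyps rfl)) hl ((e₁ 4 (by decide)).trans h4)
    ((e₁ 12 (by decide)).trans h12) ((e₁ 14 (by decide)).trans h14)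
    ((e₁ 19 (by decide)).trans h19) (fun k hk => (e₁ _ ?_).trans (hmem k hk))
    (by rwa [e₁ 20 (by decide)])).frame.mono ?_
  · simp [addNoise, trial, flips, Cmd.writes]; omega
  rintro s₂ t₂ ⟨⟨h22₂, ht₂⟩, hF₂⟩
  have e₂ (i : ℕ) (hi : (i ≠ 22 ∧ i ∉ addNoise.writes) ∧ i ∉ addGain.writes) :
      s₂.mem i = s.mem i := (hF₂.mem rfl i hi.2).trans (e₁ i hi.1)
  have e23 := e₂ 23 (by decide)
  have e24 := e₂ 24 (by decide)
  have e20 := e₂ 20 (by decide)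
  have epos := (hF₂.pos rfl).trans hpos₁
  rw [h22₁, e₁ 20 (by decide)] at h22₂
  simp only [State.set_mem, if_true, State.set_pos, zero_add] at h22₂ epos
  simp only [wp_sub, wp_ite, wp_seq, wp_const, wp_add, wp_skip, State.set_mem]
  rw [← h22₂]
  -- The truncated difference is nonzero only for a strictly better score, so ties go to the earlier
  -- candidate, as in `pick`.
  by_cases h : s.mem 23 < s₂.mem 22
  · rw [if_neg (by simp [e23]; omega), if_pos h]
    refine ⟨by simp; omega, by simp [e20], by simpa using epos, by omega⟩
  · rw [if_pos (by simp [e23]; omega), if_neg h]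
    refine ⟨by simp [e23]; omega, by simp [e24], by simpa using epos, by omega⟩

lemma wp_search {c : ℕ → Bool} (hc : ∀ k, env.coin k = some (c k)) {N n cap σ : ℕ}
    {S : Fin n → X × Bool} (hS : ∀ i : Fin n, (env.point (i + 1), env.label (i + 1)) = S i)
    {f : ℕ → X → Bool} {τ : ℕ} (hM : Models A s N f τ) {l : List ℕ}
    (hl : ∀ j ∈ l, j < N) (h4 : s.mem 4 = 1) (h12 : s.mem 12 = 40) (h13 : s.mem 13 = N)
    (h14 : s.mem 14 = n) (h15 : s.mem 15 = σ) (h16 : s.mem 16 = cap) (h19 : s.mem 19 = l.length)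
    (hmem : ∀ k (hk : k < l.length), s.mem (40 + k) = l[k]) :
    Wp A env search (fun s' t =>
      s'.mem 24 = pick (fun j => noise cap σ c (s.pos + j * (cap * σ)) + gain f S l j) N ∧
      s'.pos = s.pos + N * (cap * σ) ∧
      t ≤ 6 + N * (17 + cap * (9 + σ * 4) + n * (13 + τ + l.length * (10 + τ)))) s := by
  set v : ℕ → ℕ := fun j => noise cap σ c (s.pos + j * (cap * σ)) + gain f S l j with hv
  simp only [search, wp_seq, wp_const, wp_add]
  generalize hs₀ : State.set _ 21 (_ + _) = s₀
  have e (i : ℕ) (hi : i ∉ [20, 21, 23, 24]) : s₀.mem i = s.mem i := by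
    simp at hi; simp [← hs₀, hi]
  refine (wp_loop_frame (fun k s' => s'.mem 21 = k ∧ ∃ b, b + k = N ∧ s'.mem 20 = b ∧
    s'.mem 24 = pick v b ∧ s'.mem 23 = (if b = 0 then 0 else v (pick v b)) ∧
    s'.pos = s.pos + b * (cap * σ))
    (16 + cap * (9 + σ * 4) + n * (13 + τ + l.length * (10 + τ))) (fun _ _ h => h.1) s₀ ?_ N
    ⟨by simp [← hs₀, h13], 0, by simp, by simp [← hs₀], by simp [← hs₀, pick],
      by simp [← hs₀], by simp [← hs₀]⟩).mono ?_
  · rintro k s' hF ⟨h21', b, hb, h20', h24', h23', hpos'⟩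
    have e' (i : ℕ) (hi : i ∉ [20, 21, 23, 24] ∧
        i ∉ (Cmd.seq candidate (.seq (.sub 21 21 4) (.add 20 20 4))).writes) :
        s'.mem i = s.mem i := (hF.mem rfl i hi.2).trans (e i hi.1)
    have h4' := (e' 4 (by decide)).trans h4
    simp only [wp_seq]
    refine (wp_candidate hc (N := N) (cap := cap) (σ := σ) (l := l) hS
      (hM.congr ((hF.hyps rfl).trans (by simp [← hs₀]))) hl h4' ((e' 12 (by decide)).trans h12)
      ((e' 14 (by decide)).trans h14) ((e' 15 (by decide)).trans h15)
      ((e' 16 (by decide)).trans h16) ((e' 19 (by decide)).trans h19)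
      (fun k hk => (e' _ ?_).trans (hmem k hk)) (by omega)).frame.mono ?_
    · simp [candidate, addNoise, trial, flips, addGain, weighExample, vote, diff, Cmd.writes]
      omega
    rintro s₁ t₁ ⟨⟨h23₁, h24₁, hpos₁, ht₁⟩, hF₁⟩
    have h4₁ := (hF₁.mem rfl 4 (by decide)).trans h4'
    have h21₁ := (hF₁.mem rfl 21 (by decide)).trans h21'
    have h20₁ := (hF₁.mem rfl 20 (by decide)).trans h20'
    have hvb : noise cap σ c s'.pos + gain f S l (s'.mem 20) = v b := by
      rw [hv, h20', hpos']
    rw [hvb, h23'] at h23₁ h24₁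
    rw [h20', h24'] at h24₁
    have hp : pick v (b + 1) = if v (pick v b) < v b then b else pick v b := rfl
    -- The search starts with best score `0` and best candidate `0`. A first candidate of score `0`
    -- is therefore not stored, but the registers are right all the same.
    have h24₂ : s₁.mem 24 = pick v (b + 1) := by
      rw [h24₁, hp]
      rcases Nat.eq_zero_or_pos b with rfl | hb
      · simp [pick]
      · simp [hb.ne']
    have h23₂ : s₁.mem 23 = v (pick v (b + 1)) := by
      rw [h23₁, hp]
      rcases Nat.eq_zero_or_pos b with rfl | hb
      · simp [pick]
      · simp only [hb.ne', if_false]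
        split_ifs <;> omega
    simp only [wp_sub, wp_add]
    refine ⟨⟨by simp [h21₁, h4₁], b + 1, by omega, by simp [h20₁, h4₁], by simp [h24₂],
      by simp [h23₂], ?_⟩, by omega⟩
    simp [hpos₁, hpos']; ring
  · rintro s' t ⟨⟨-, b, hb, -, h24, -, hpos⟩, -, ht⟩
    obtain rfl : b = N := by omega
    refine ⟨h24, hpos, ?_⟩
    have : b * (16 + cap * (9 + σ * 4) + n * (13 + τ + l.length * (10 + τ)) + 1) =
      b * (17 + cap * (9 + σ * 4) + n * (13 + τ + l.length * (10 + τ))) := by ring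
    omega

lemma wp_boost {c : ℕ → Bool} (hc : ∀ k, env.coin k = some (c k)) {N n cap σ T : ℕ}
    (hN : 0 < N)
    {S : Fin n → X × Bool} (hS : ∀ i : Fin n, (env.point (i + 1), env.label (i + 1)) = S i)
    {f : ℕ → X → Bool} {τ : ℕ} (hM : Models A s N f τ)
    (h3 : s.mem 3 = T) (h4 : s.mem 4 = 1) (h12 : s.mem 12 = 40) (h13 : s.mem 13 = N)
    (h14 : s.mem 14 = n) (h15 : s.mem 15 = σ) (h16 : s.mem 16 = cap) (h19 : s.mem 19 = 0)
    (hpos : s.pos = 0) {l : List ℕ}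
    (hl : l = chosen N (fun t j => noise cap σ c ((t * N + j) * (cap * σ))) (gain f S) T) :
    Wp A env boost (fun s' t => s'.hyps = s.hyps ∧ s'.mem 3 = T ∧
      (∀ k (hk : k < l.length), s'.mem (40 + k) = l[k]) ∧
      t ≤ 3 + T * (11 + N * (17 + cap * (9 + σ * 4) + n * (13 + τ + T * (10 + τ))))) s := by
  set η : ℕ → ℕ → ℕ := fun t j => noise cap σ c ((t * N + j) * (cap * σ)) with hη
  simp only [boost, wp_seq, wp_const, wp_add]
  generalize hs₀ : State.set _ 18 (_ + _) = s₀
  have e (i : ℕ) (hi : i ≠ 18) : s₀.mem i = s.mem i := by simp [← hs₀, hi]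
  have ehyps : s₀.hyps = s.hyps := by simp [← hs₀]
  -- The body contains an indirect store, so no frame is available and the invariant has to carry
  -- every register in use.
  refine (wp_loop (fun k s' => s'.mem 18 = k ∧ ∃ b, b + k = T ∧ s'.hyps = s.hyps ∧
    s'.mem 3 = T ∧ s'.mem 4 = 1 ∧ s'.mem 12 = 40 ∧ s'.mem 13 = N ∧ s'.mem 14 = n ∧
    s'.mem 15 = σ ∧ s'.mem 16 = cap ∧ s'.mem 19 = b ∧ s'.pos = b * N * (cap * σ) ∧
    ∀ k (hk : k < (chosen N η (gain f S) b).length),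
      s'.mem (40 + k) = (chosen N η (gain f S) b)[k])
    (10 + N * (17 + cap * (9 + σ * 4) + n * (13 + τ + T * (10 + τ))))
    (fun _ _ h => h.1) ?_ T s₀ ⟨by simp [← hs₀, h3], 0, by simp, ehyps,
      (e _ (by decide)).trans h3, (e _ (by decide)).trans h4, (e _ (by decide)).trans h12,
      (e _ (by decide)).trans h13, (e _ (by decide)).trans h14, (e _ (by decide)).trans h15,
      (e _ (by decide)).trans h16, (e _ (by decide)).trans h19, by simp [← hs₀, hpos],
      by simp [chosen]⟩).mono ?_
  · rintro k s' ⟨h18', b, hb, hh, h3', h4', h12', h13', h14', h15', h16', h19', hpos', hmem'⟩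
    simp only [round, wp_seq]
    refine (wp_search hc (N := N) (cap := cap) (σ := σ) hS (hM.congr hh)
      (lt_of_mem_chosen hN η (gain f S) b) h4' h12' h13' h14' h15' h16' (by simp [h19'])
      hmem').frame.mono ?_
    rintro s₁ t₁ ⟨⟨h24₁, hpos₁, ht₁⟩, hF₁⟩
    have e₁ (i : ℕ) (hi : i ∉ search.writes) : s₁.mem i = s'.mem i := hF₁.mem rfl i hi
    have h4₁ := (e₁ 4 (by decide)).trans h4'
    have h12₁ := (e₁ 12 (by decide)).trans h12'
    have h19₁ := (e₁ 19 (by decide)).trans h19'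
    have h18₁ := (e₁ 18 (by decide)).trans h18'
    have hpick : s₁.mem 24 = pick (fun j => η b j + gain f S (chosen N η (gain f S) b) j) N := by
      rw [h24₁]
      congr 1
      funext j
      rw [hη, hpos', ← add_mul]
    have h40 : ∀ i : ℕ, i < 40 → i ≠ 40 + b := by omega
    simp only [wp_add, wp_store, wp_sub]
    simp only [State.set_mem, if_true, h12₁, h19₁, h4₁, h40, if_false,
      Nat.reduceEqDiff, Nat.reduceLT, h18₁]
    refine ⟨⟨?_, b + 1, by omega, ?_, ?_, ?_, ?_, ?_, ?_, ?_, ?_, ?_, ?_, ?_⟩, ?_⟩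
    any_goals simp; done
    · simpa using (hF₁.hyps rfl).trans hh
    · simpa [h40] using (e₁ 3 (by decide)).trans h3'
    · simpa [h40] using (e₁ 13 (by decide)).trans h13'
    · simpa [h40] using (e₁ 14 (by decide)).trans h14'
    · simpa [h40] using (e₁ 15 (by decide)).trans h15'
    · simpa [h40] using (e₁ 16 (by decide)).trans h16'
    · simp [hpos₁, hpos']; ring
    · intro i hi
      have h41 : ∀ k : ℕ, k < 40 → 40 + i ≠ k := by omega
      simp only [length_chosen] at hi
      simp only [chosen, h41, if_false, Nat.reduceLT]
      rcases Nat.lt_succ_iff_lt_or_eq.1 hi with hib | rfl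
      · rw [if_neg (by omega), List.getElem_append_left (by simpa using hib),
          ← hmem' i (by simpa using hib)]
        apply e₁
        simp [search, candidate, addNoise, trial, flips, addGain, weighExample, vote, diff,
          Cmd.writes]
        omega
      · rw [if_pos rfl, List.getElem_append_right (by simp)]
        simpa using hpick
    · rw [length_chosen] at ht₁
      have : N * (17 + cap * (9 + σ * 4) + n * (13 + τ + b * (10 + τ))) ≤
          N * (17 + cap * (9 + σ * 4) + n * (13 + τ + T * (10 + τ))) := by
        gcongr; omega
      omega
  · rintro s' t ⟨⟨-, b, hb, hh, h3', -, -, -, -, -, -, -, -, hmem'⟩, ht⟩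
    obtain rfl : b = T := by omega
    subst hl
    refine ⟨hh, h3', hmem', ?_⟩
    have : b * (10 + N * (17 + cap * (9 + σ * 4) + n * (13 + τ + b * (10 + τ))) + 1) =
      b * (11 + N * (17 + cap * (9 + σ * 4) + n * (13 + τ + b * (10 + τ)))) := by ring
    omega

end Correctness

/-! ### Verification of the set-up, the calls of the learner, the output, and the evaluation
program. -/

section Correctness

variable {X R H : Type*} [MeasurableSpace X] [MeasurableSpace R] [MeasurableSpace H]
  {A : Learner X R H} {env : Env X R} {s : State H}

lemma wp_expo {a e : ℕ} (ha : a ≠ 17) (ha' : a ≠ 4) (h4 : s.mem 4 = 1) (h : s.mem a = e) :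
    Wp A env (expo a) (fun s' t => s'.mem a = 2 ^ e ∧ t ≤ 4 + e * 3) s := by
  simp only [expo, wp_seq, wp_const, wp_add]
  generalize hs₀ : State.set _ a 1 = s₀
  refine (wp_loop_frame (fun k s' => s'.mem 17 = k ∧ ∃ b, b + k = e ∧ s'.mem a = 2 ^ b) 2
    (fun _ _ h => h.1) s₀ ?_ e ⟨by simp [← hs₀, ha, ha.symm, h], 0, by simp, by simp [← hs₀]⟩).mono
    ?_
  · rintro k s' hF ⟨h17, b, hb, hab⟩
    have h4' : s'.mem 4 = 1 :=
      (hF.mem rfl 4 (by simp [Cmd.writes, ha'.symm])).trans (by simp [← hs₀, ha'.symm, h4])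
    simp only [wp_seq, wp_add, wp_sub]
    refine ⟨⟨by simp [ha.symm, ha'.symm, h17, h4'], b + 1, by omega, ?_⟩, by norm_num⟩
    simp [ha, hab]; ring
  · rintro s' t ⟨⟨-, b, hb, hab⟩, -, ht⟩
    obtain rfl : b = e := by omega
    exact ⟨hab, by omega⟩

lemma wp_scale {w : ℕ} (h4 : s.mem 4 = 1) (h6 : s.mem 6 = w) (h8 : s.mem 8 = 0) :
    Wp A env scale (fun s' t => s'.mem 8 = Nat.clog 2 w ∧ t ≤ 3 + Nat.clog 2 w * 4) s := by
  simp only [scale, wp_seq, wp_const, wp_sub]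
  generalize hs₀ : State.set _ 9 _ = s₀
  refine (wp_loop_iff (fun k s' => ∃ b, b + k = Nat.clog 2 w ∧ s'.mem 4 = 1 ∧ s'.mem 6 = w ∧
    s'.mem 7 = 2 ^ b ∧ s'.mem 8 = b ∧ s'.mem 9 = w - 2 ^ b) 3 ?_ ?_ (Nat.clog 2 w) s₀
    ⟨0, by simp, by simp [← hs₀, h4], by simp [← hs₀, h6], by simp [← hs₀], by simp [← hs₀, h8],
      by simp [← hs₀, h6]⟩).mono ?_
  · rintro k s' ⟨b, hb, -, -, -, -, h9⟩
    rw [h9, Nat.sub_eq_zero_iff_le, ← Nat.clog_le_iff_le_pow (by norm_num)]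
    omega
  · rintro k s' ⟨b, hb, h4, h6, h7, h8, h9⟩
    simp only [wp_seq, wp_add, wp_sub]
    refine ⟨⟨b + 1, by omega, by simp [h4], by simp [h6], ?_, by simp [h8, h4], ?_⟩, by norm_num⟩
    · simp [h7]; ring
    · simp [h6, h7]; ring_nf
  · rintro s' t ⟨⟨b, hb, -, -, -, h8, -⟩, ht⟩
    exact ⟨by omega, by omega⟩

/-- The machine cannot multiply: the multiples of `κ` come from a few additions, the powers from
repeated doubling. -/
lemma wp_params {κ m : ℕ} (h4 : s.mem 4 = 1) (h5 : s.mem 5 = m) (h8 : s.mem 8 = κ) :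
    Wp A env params (fun s' t => s'.mem 3 = 4 * κ ∧ s'.mem 13 = 2 ^ (m + 1 + 3 * κ) ∧
      s'.mem 14 = 2 ^ (24 * κ) ∧ s'.mem 15 = 21 * κ ∧ s'.mem 16 = 2 ^ (23 * κ) ∧
      t ≤ 26 + 150 * κ + 3 * m) s := by
  simp only [params, wp_seq, wp_sub, wp_add]
  generalize hs₀ : State.set _ 13 (_ + _) = s₀
  have e3 : s₀.mem 3 = 4 * κ := by simp [← hs₀, h8]; ring
  have e4 : s₀.mem 4 = 1 := by simp [← hs₀, h4]
  have e13 : s₀.mem 13 = m + 1 + 3 * κ := by simp [← hs₀, h8, h5, h4]; omega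
  have e14 : s₀.mem 14 = 24 * κ := by simp [← hs₀, h8]; ring
  have e15 : s₀.mem 15 = 21 * κ := by simp [← hs₀, h8]; ring
  have e16 : s₀.mem 16 = 23 * κ := by simp [← hs₀, h8]; omega
  refine (wp_expo (by decide) (by decide) e4 e14).frame.mono ?_
  rintro s₁ t₁ ⟨⟨h14₁, ht₁⟩, hF₁⟩
  have e4₁ := (hF₁.mem rfl 4 (by decide)).trans e4
  refine (wp_expo (by decide) (by decide) e4₁
    ((hF₁.mem rfl 16 (by decide)).trans e16)).frame.mono ?_
  rintro s₂ t₂ ⟨⟨h16₂, ht₂⟩, hF₂⟩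
  refine (wp_expo (by decide) (by decide) ((hF₂.mem rfl 4 (by decide)).trans e4₁)
    ((hF₂.mem rfl 13 (by decide)).trans ((hF₁.mem rfl 13 (by decide)).trans e13))).frame.mono ?_
  rintro s₃ t₃ ⟨⟨h13₃, ht₃⟩, hF₃⟩
  refine ⟨?_, h13₃, (hF₃.mem rfl 14 (by decide)).trans ((hF₂.mem rfl 14 (by decide)).trans h14₁),
    ?_, (hF₃.mem rfl 16 (by decide)).trans h16₂, by omega⟩
  · rw [hF₃.mem rfl 3 (by decide), hF₂.mem rfl 3 (by decide), hF₁.mem rfl 3 (by decide), e3]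
  · rw [hF₃.mem rfl 15 (by decide), hF₂.mem rfl 15 (by decide), hF₁.mem rfl 15 (by decide), e15]

variable (A) in
/-- The size of the data set for the parameters `1/16`, `1/2`, `1/2`. -/
noncomputable def dummySize : ℕ := A.size (1 / 16) (1 / 2) (1 / 2)

variable (A) in
/-- The model which the learner returns on a data set that does not depend on the sample. -/
noncomputable def dummyModel (x₀ : X) (r : R) : H :=
  A.fit (1 / 16) (1 / 2) (1 / 2) (fun _ => (x₀, false)) r

lemma wp_calls {x₀ : X} {w : ℕ → R} (hw : ∀ k, env.seed k = some (w k)) (hx : env.point 0 = x₀)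
    {N θ : ℕ} (hθ : ∀ S r, A.fitTime (1 / 16) (1 / 2) (1 / 2) S r ≤ θ) (h4 : s.mem 4 = 1)
    (h10 : s.mem 10 = 16) (h11 : s.mem 11 = 2) (h12 : s.mem 12 = 40) (h13 : s.mem 13 = N)
    (hz : ∀ k, s.mem (40 + k) = 0) (hh : s.hyps = []) :
    Wp A env calls (fun s' t => s'.hyps = (List.range N).map (fun i => dummyModel A x₀ (w i)) ∧
      t ≤ 3 + N * (3 + 2 * dummySize A + θ)) s := by
  simp only [calls, wp_seq, wp_const, wp_add]
  generalize hs₀ : State.set _ 21 (_ + _) = s₀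
  have e (i : ℕ) (hi : i ≠ 21) : s₀.mem i = s.mem i := by simp [← hs₀, hi]
  refine (wp_loop_frame (fun k s' => s'.mem 21 = k ∧ ∃ b, b + k = N ∧
    s'.hyps = (List.range b).map (fun i => dummyModel A x₀ (w i))) (2 + 2 * dummySize A + θ)
    (fun _ _ h => h.1) s₀ ?_ N ⟨by simp [← hs₀, h13], 0, by simp, by simp [← hs₀, hh]⟩).mono ?_
  · rintro k s' hF ⟨h21, b, hb, hyp⟩
    have e' (i : ℕ) (hi : i ≠ 21) : s'.mem i = s.mem i :=
      (hF.mem rfl i (by simpa [Cmd.writes] using hi)).trans (e i hi)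
    -- The cells from `40` on, which hold the chosen list later, are still zero; they are read as
    -- handle `0` with label `0`. So the call does not see the sample.
    have hd : dataset env s' (s'.mem 12) (A.size (1 / 16) (1 / 2) (1 / 2)) =
        fun _ => (x₀, false) := by
      funext i
      have h1 : s'.mem (40 + 2 * i) = 0 := by rw [e' _ (by omega), hz]
      have h2 : s'.mem (40 + 2 * i + 1) = 0 := by rw [e' _ (by omega), add_assoc, hz]
      simp [dataset, e' 12 (by decide), h12, h1, h2, hx]
    rw [wp_seq]
    refine ⟨_, _, .call s' 10 11 4 12 (w b) (by simp [hyp, hw]) (1 / 16) (1 / 2) (1 / 2) ?_ ?_ ?_,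
      wp_sub.2 ?_⟩
    · rw [e' 10 (by decide), h10]; norm_num
    · rw [e' 11 (by decide), h11]; norm_num
    · rw [e' 4 (by decide), h4]; norm_num
    · rw [hd]
      refine ⟨⟨by simp [h21, e' 4 (by decide), h4], b + 1, by omega, ?_⟩, ?_⟩
      · simp [hyp, List.range_succ, dummyModel]
      · have := hθ (fun _ => (x₀, false)) (w b)
        rw [dummySize]
        omega
  · rintro s' t ⟨⟨-, b, hb, hyp⟩, -, ht⟩
    obtain rfl : b = N := by omega
    refine ⟨hyp, ?_⟩
    have : b * (2 + 2 * dummySize A + θ + 1) = b * (3 + 2 * dummySize A + θ) := by ring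
    omega

lemma wp_clear (l : List ℕ) : ∀ s : State H, Wp A env (clear l) (fun s' t =>
    (∀ k, s'.mem k = if k ∈ l then 0 else s.mem k) ∧ s'.hyps = s.hyps ∧ t = l.length + 1) s := by
  induction l with
  | nil => intro s; simp [clear, wp_skip]
  | cons a l ih =>
    intro s
    rw [clear, wp_seq, wp_const]
    refine (ih _).mono ?_
    rintro s' t ⟨h, hh, ht⟩
    refine ⟨fun k => ?_, by simpa using hh, by simp [ht]; ring⟩
    rw [h, State.set_mem]
    by_cases hk : k ∈ l <;> by_cases hk' : k = a <;> simp [hk, hk']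

/-- The numbers in the output model: `T`, surrounded by zeros, and the list of chosen models. -/
def outWords (T : ℕ) (l : List ℕ) : List ℕ :=
  (List.range 39).map (fun i => if i = 2 then T else 0) ++ l

lemma outWords_getD (T : ℕ) (l : List ℕ) {k : ℕ} (hk : k < 39) :
    (outWords T l).getD k 0 = if k = 2 then T else 0 := by
  rw [outWords, List.getD_append _ _ _ _ (by simpa using hk)]
  simp [List.getD_eq_getElem?_getD, hk]

/-- Other registers still hold sample-dependent numbers such as scores. They are cleared so that
equal choices and equal models give literally equal outputs, as replicability requires. -/
lemma wp_finish {l : List ℕ} (h3 : s.mem 3 = l.length)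
    (hl : ∀ k (hk : k < l.length), s.mem (40 + k) = l[k]) :
    Wp A env finish (fun s' t => s'.output = ⟨outWords l.length l, s.hyps⟩ ∧ t ≤ 50) s := by
  simp only [finish, wp_seq, wp_const, wp_add]
  refine (wp_clear _ s).mono ?_
  rintro s₁ t ⟨h, hh, rfl⟩
  have h3₁ : s₁.mem 3 = l.length := by rw [h, if_neg (by decide), h3]
  refine ⟨?_, by simp⟩
  simp only [State.output, Model.mk.injEq]
  refine ⟨?_, by simpa using hh⟩
  apply List.ext_getElem
  · simp [outWords, h3₁]
  intro i hi _
  have hi₂ : i < 39 + l.length := by simpa [h3₁] using hi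
  rw [List.getElem_ofFn]
  change ((s₁.set 0 39).set 0 ((s₁.set 0 39).mem 0 + (s₁.set 0 39).mem 3)).mem (1 + i) = _
  simp only [State.set_mem, outWords]
  rw [if_neg (by omega), if_neg (by omega), h]
  by_cases hi' : i < 39
  · rw [List.getElem_append_left (by simpa using hi')]
    simp only [List.getElem_map, List.getElem_range]
    by_cases h2 : i = 2
    · subst h2; simp [h3]
    · rw [if_pos, if_neg h2]
      simp only [List.mem_cons, List.mem_range'_1]
      omega
  · rw [List.getElem_append_right (by simpa using hi'), if_neg]
    · obtain ⟨k, rfl⟩ := Nat.exists_eq_add_of_le (not_lt.1 hi')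
      have hk : k < l.length := by omega
      have := hl k hk
      simp only [List.length_map, List.length_range, Nat.add_sub_cancel_left]
      rw [← this]; congr 1; omega
    · simp only [List.mem_cons, List.mem_range'_1]
      omega

variable (A) in
/-- The predictions of the models obtained with the seeds `w 0, w 1, …`. -/
noncomputable def rule (x₀ : X) (w : ℕ → R) (j : ℕ) : X → Bool := A.predict (dummyModel A x₀ (w j))

variable (A) in
/-- The number of models which the learning program collects, if its scale is `κ`. -/
noncomputable def numModels (κ : ℕ) : ℕ := 2 ^ (dummySize A + 1 + 3 * κ)

variable (A) in
/-- The noise for candidate `j` in round `t`. -/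
noncomputable def roundNoise (κ : ℕ) (c : ℕ → Bool) (t j : ℕ) : ℕ :=
  noise (2 ^ (23 * κ)) (21 * κ) c ((t * numModels A κ + j) * (2 ^ (23 * κ) * (21 * κ)))

variable (A) in
/-- The list of models that the learning program chooses. -/
noncomputable def learned (x₀ : X) (κ : ℕ) (S : Fin (2 ^ (24 * κ)) → X × Bool) (ω : Seed R) : List ℕ :=
  chosen (numModels A κ) (roundNoise A κ ω.1) (gain (rule A x₀ ω.2) S) (4 * κ)

variable (A) in
/-- The output of the learning program. -/
noncomputable def learnedModel (x₀ : X) (κ : ℕ) (S : Fin (2 ^ (24 * κ)) → X × Bool) (ω : Seed R) : Model H :=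
  ⟨outWords (4 * κ) (learned A x₀ κ S ω),
    (List.range (numModels A κ)).map fun i => dummyModel A x₀ (ω.2 i)⟩

variable (A) in
/-- The hypothesis represented by a model: a majority vote. -/
noncomputable def majorityHyp (M : Model H) (x : X) : Bool :=
  decide ((M.words.drop 39).length <
    2 * (M.words.drop 39).countP fun j => (M.hyps[j]?).elim false fun h => A.predict h x)

lemma numModels_pos (κ : ℕ) : 0 < numModels A κ := by simp [numModels]

lemma majorityHyp_learnedModel (x₀ : X) (κ : ℕ) (S : Fin (2 ^ (24 * κ)) → X × Bool) (ω : Seed R)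
    (x : X) : majorityHyp A (learnedModel A x₀ κ S ω) x =
      decide (4 * κ < 2 * (learned A x₀ κ S ω).countP fun j => rule A x₀ ω.2 j x) := by
  have h1 : (learnedModel A x₀ κ S ω).words.drop 39 = learned A x₀ κ S ω := by
    simp [learnedModel, outWords]
  have h2 : (learned A x₀ κ S ω).length = 4 * κ := by simp [learned]
  rw [majorityHyp, h1, h2]
  congr 3
  apply List.countP_congr
  intro j hj
  have hj' : j < numModels A κ := lt_of_mem_chosen (numModels_pos κ) _ _ _ j hj
  simp [learnedModel, hj', rule]

/-- The running time of the learning program. -/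
def learnTime (m κ θ τ : ℕ) : ℕ :=
  100 + 200 * κ + 3 * m + 2 ^ (m + 1 + 3 * κ) * (3 + 2 * m + θ) +
    4 * κ * (11 + 2 ^ (m + 1 + 3 * κ) * (17 + 2 ^ (23 * κ) * (9 + 21 * κ * 4) +
      2 ^ (24 * κ) * (13 + τ + 4 * κ * (10 + τ))))

theorem exec_learn {θ τ : ℕ} (hθ : ∀ S r, A.fitTime (1 / 16) (1 / 2) (1 / 2) S r ≤ θ)
    (hτ : ∀ S r x, A.predictTime (A.fit (1 / 16) (1 / 2) (1 / 2) S r) x ≤ τ) (x₀ : X)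
    (α ρ β : ℝ) {κ : ℕ}
    (hκ : κ = Nat.clog 2 (⌈1 / α⌉₊ + ⌈1 / ρ⌉₊ + ⌈Real.logb 2 (1 / β)⌉₊ + dummySize A + 64))
    (S : Fin (2 ^ (24 * κ)) → X × Bool) (ω : Seed R) :
    ∃ t s, Exec A (trainEnv x₀ S ω) learn (trainInit α ρ β) t s ∧
      s.output = learnedModel A x₀ κ S ω ∧ t ≤ learnTime (dummySize A) κ θ τ := by
  change Wp A (trainEnv x₀ S ω) learn
    (fun s t => s.output = learnedModel A x₀ κ S ω ∧ t ≤ learnTime (dummySize A) κ θ τ) _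
  simp only [learn, setup, wp_seq, wp_const, wp_add, wp_size]
  generalize hs₀ : State.set _ 6 (_ + State.mem _ 7) = s₀
  have esize : A.size (1 / (16 : ℕ)) (1 / (2 : ℕ)) ((1 / 2) ^ 1) = dummySize A := by
    rw [dummySize]; norm_num
  have i4 : s₀.mem 4 = 1 := by simp [← hs₀]
  have i5 : s₀.mem 5 = dummySize A := by
    rw [← esize, ← hs₀]; simp
  have i6 : s₀.mem 6 =
      ⌈1 / α⌉₊ + ⌈1 / ρ⌉₊ + ⌈Real.logb 2 (1 / β)⌉₊ + dummySize A + 64 := by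
    rw [← esize, ← hs₀]; simp [trainInit]
  have i10 : s₀.mem 10 = 16 := by simp [← hs₀]
  have i11 : s₀.mem 11 = 2 := by simp [← hs₀]
  have i12 : s₀.mem 12 = 40 := by simp [← hs₀]
  have i8 : s₀.mem 8 = 0 := by simp [← hs₀, trainInit]
  have i19 : s₀.mem 19 = 0 := by simp [← hs₀, trainInit]
  have ihyps : s₀.hyps = [] := by simp [← hs₀, trainInit]
  have ipos : s₀.pos = 0 := by simp [← hs₀, trainInit]
  have iz : ∀ k, s₀.mem (40 + k) = 0 := by
    intro k
    have h35 : ∀ i : ℕ, i < 40 → 40 + k ≠ i := by omega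
    simp [← hs₀, trainInit, h35]
  clear hs₀ esize
  refine (wp_scale i4 i6 i8).frame.mono ?_
  rintro s₁ t₁ ⟨⟨h8, ht₁⟩, hF₁⟩
  rw [← hκ] at h8 ht₁
  have e₁ (i : ℕ) (hi : i ∉ scale.writes) : s₁.mem i = s₀.mem i := hF₁.mem rfl i hi
  refine (wp_params ((e₁ 4 (by decide)).trans i4) ((e₁ 5 (by decide)).trans i5) h8).frame.mono ?_
  rintro s₂ t₂ ⟨⟨h3, h13, h14, h15, h16, ht₂⟩, hF₂⟩
  have e₂ (i : ℕ) (hi : i ∉ scale.writes ∧ i ∉ params.writes) : s₂.mem i = s₀.mem i :=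
    (hF₂.mem rfl i hi.2).trans (e₁ i hi.1)
  refine (wp_calls (x₀ := x₀) (w := ω.2) (fun k => rfl) (by simp [trainEnv]) hθ
    ((e₂ 4 (by decide)).trans i4) ((e₂ 10 (by decide)).trans i10) ((e₂ 11 (by decide)).trans i11)
    ((e₂ 12 (by decide)).trans i12) h13 (fun k => (e₂ _ ?_).trans (iz k))
    ((hF₂.hyps rfl).trans ((hF₁.hyps rfl).trans ihyps))).frame.mono ?_
  · simp [scale, params, expo, Cmd.writes]; omega
  rintro s₃ t₃ ⟨⟨hyp, ht₃⟩, hF₃⟩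
  have e₃ (i : ℕ) (hi : i ∉ calls.writes) : s₃.mem i = s₂.mem i := hF₃.mem rfl i hi
  have hM : Models A s₃ (numModels A κ) (rule A x₀ ω.2) τ := by
    refine ⟨fun j hj => ⟨dummyModel A x₀ (ω.2 j), ?_, rfl, fun x => hτ _ _ x⟩⟩
    rw [numModels] at hj
    simp [hyp, hj]
  refine (wp_boost (c := ω.1) (fun k => rfl) (numModels_pos κ) (S := S) ?_ hM
    ((e₃ 3 (by decide)).trans h3)
    ((e₃ 4 (by decide)).trans ((e₂ 4 (by decide)).trans i4))
    ((e₃ 12 (by decide)).trans ((e₂ 12 (by decide)).trans i12)) ((e₃ 13 (by decide)).trans h13)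
    ((e₃ 14 (by decide)).trans h14) ((e₃ 15 (by decide)).trans h15)
    ((e₃ 16 (by decide)).trans h16) ((e₃ 19 (by decide)).trans ((e₂ 19 (by decide)).trans i19))
    ((hF₃.pos rfl).trans ((hF₂.pos rfl).trans ((hF₁.pos rfl).trans ipos)))
    (l := learned A x₀ κ S ω) rfl).mono ?_
  · intro i
    simp [trainEnv]
  rintro s₄ t₄ ⟨hyp₄, h3₄, hmem₄, ht₄⟩
  have hlen : (learned A x₀ κ S ω).length = 4 * κ := by simp [learned]
  refine (wp_finish (h3₄.trans hlen.symm) hmem₄).mono ?_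
  rintro s₅ t₅ ⟨hout, ht₅⟩
  refine ⟨by rw [hout, hyp₄, hyp, hlen]; rfl, ?_⟩
  rw [learnTime]
  rw [numModels] at ht₄
  omega

theorem predicts_majority {τ : ℕ}
    (hτ : ∀ S r x, A.predictTime (A.fit (1 / 16) (1 / 2) (1 / 2) S r) x ≤ τ) (x₀ : X)
    {κ : ℕ} (S : Fin (2 ^ (24 * κ)) → X × Bool) (ω : Seed R) {B : ℝ}
    (hB : ((7 + 4 * κ * (6 + τ) : ℕ) : ℝ) ≤ B) :
    Predicts A majority (learnedModel A x₀ κ S ω)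
      (majorityHyp A (learnedModel A x₀ κ S ω)) B := by
  intro x
  set l := learned A x₀ κ S ω with hl
  have hlen : l.length = 4 * κ := by simp [hl, learned]
  suffices Wp A (predictEnv x) majority (fun s t => majorityHyp A (learnedModel A x₀ κ S ω) x =
      decide (s.mem 0 ≠ 0) ∧ t ≤ 7 + 4 * κ * (6 + τ)) (predictInit (learnedModel A x₀ κ S ω)) by
    obtain ⟨t, s, h, h', ht⟩ := this
    exact ⟨t, s, h, h', le_trans (by exact_mod_cast ht) hB⟩
  generalize hsi : predictInit (learnedModel A x₀ κ S ω) = si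
  -- The output starts at cell `1`, whereas evaluation finds its first word in cell `0`: every
  -- address is lower by one than in training.
  have i2 : si.mem 2 = 4 * κ := by
    rw [← hsi]; exact outWords_getD (4 * κ) l (k := 2) (by norm_num)
  have i7 : si.mem 7 = 0 := by
    rw [← hsi]; exact outWords_getD (4 * κ) l (k := 7) (by norm_num)
  have il (k : ℕ) (hk : k < l.length) : si.mem (39 + k) = l[k] := by
    have : si.mem (39 + k) = ((List.range 39).map (fun i => if i = 2 then 4 * κ else 0) ++
      l).getD (39 + k) 0 := by rw [← hsi]; rfl
    rw [this, List.getD_append_right _ _ _ _ (by simp)]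
    simp [hk]
  have hM : Models A si (numModels A κ) (rule A x₀ ω.2) τ := by
    refine ⟨fun j hj => ⟨dummyModel A x₀ (ω.2 j), ?_, rfl, fun x => hτ _ _ x⟩⟩
    simp [← hsi, predictInit, learnedModel, hj]
  rw [majorityHyp_learnedModel, ← hl]
  simp only [majority, wp_seq, wp_const, wp_add, wp_sub]
  generalize hs₀ : State.set si 3 _ = s₀'
  generalize hs₀ : State.set _ 6 (_ + _) = s₀
  subst s₀'
  refine (wp_loop_frame (fun k s' => s'.mem 6 = k ∧ k ≤ l.length ∧
    s'.mem 5 = (l.drop k).countP fun j => rule A x₀ ω.2 j x) (5 + τ) (fun _ _ h => h.1) s₀ ?_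
    (4 * κ) ⟨by simp [← hs₀, i2, i7], hlen.ge, by simp [← hs₀, ← hlen]⟩).mono ?_
  · rintro k s' hF ⟨h6, hk, h5⟩
    have h3' := hF.mem rfl 3 (by decide)
    have h4' := hF.mem rfl 4 (by decide)
    have h39 : ∀ i : ℕ, i < 39 → 39 + k ≠ i := by omega
    have hcell : s'.mem (39 + k) = l[k] := by
      rw [hF.mem rfl _ (by simp [Cmd.writes]; omega), ← il k hk]
      simp [← hs₀, h39]
    simp [← hs₀] at h3' h4'
    simp only [wp_seq, wp_add, wp_sub, wp_load]
    generalize hs₁ : State.set _ 9 _ = s₁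
    have h9₁ : s₁.mem 9 = l[k] := by simp [← hs₁, h4', h6, h3', h39, hcell]
    have h5₁ : s₁.mem 5 = s'.mem 5 := by simp [← hs₁]
    have h6₁ : s₁.mem 6 = k := by simp [← hs₁, h6, h3']
    refine (hM.congr (s' := s₁) ?_).wp_eval
      (h9₁ ▸ lt_of_mem_chosen (numModels_pos κ) _ _ _ _ (List.getElem_mem _)) ?_
    · rw [← hs₁]; simp [hF.hyps rfl, ← hs₀]
    intro t ht
    refine ⟨⟨by simp [h6₁], by omega, ?_⟩, by omega⟩
    rw [List.drop_eq_getElem_cons hk, List.countP_cons]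
    simp only [State.set_mem]
    simp only [Nat.reduceEqDiff, if_false, if_true, h5₁, h5, h9₁, predictEnv]
    cases rule A x₀ ω.2 l[k] x <;> rfl
  · rintro s' t ⟨⟨-, -, h5⟩, hF, ht⟩
    have h2' := hF.mem rfl 2 (by decide)
    simp [← hs₀, i2] at h2'
    refine ⟨?_, ?_⟩
    -- The final truncated subtraction leaves a nonzero number exactly if twice the number of
    -- positive votes exceeds the number of voters.
    · simp only [State.set_mem]
      simp only [Nat.reduceEqDiff, if_false, if_true, h5, h2', List.drop_zero]
      congr 1
      simp only [eq_iff_iff]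
      omega
    · have : 4 * κ * (5 + τ + 1) = 4 * κ * (6 + τ) := by ring
      omega

end Correctness

/-! ## Histories and selection -/

section Selection

/-- The lists of length `t` of numbers below `N`. -/
def histories (N : ℕ) : ℕ → Finset (List ℕ)
  | 0 => {[]}
  | t + 1 => (histories N t ×ˢ Finset.range N).image fun x => x.1 ++ [x.2]

lemma mem_histories {N t : ℕ} {l : List ℕ} :
    l ∈ histories N t ↔ l.length = t ∧ ∀ j ∈ l, j < N := by
  induction t generalizing l with
  | zero =>
    rw [histories, Finset.mem_singleton, List.length_eq_zero_iff]
    constructor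
    · rintro rfl; simp
    · exact fun h => h.1
  | succ t ih =>
    simp only [histories, Finset.mem_image, Finset.mem_product, ih, Finset.mem_range, Prod.exists]
    constructor
    · rintro ⟨l, j, ⟨⟨rfl, h⟩, hj⟩, rfl⟩
      refine ⟨by simp, fun i hi => ?_⟩
      rcases List.mem_append.1 hi with hi | hi
      · exact h i hi
      · rwa [List.mem_singleton.1 hi]
    · rintro ⟨hl, h⟩
      have hne : l ≠ [] := by rintro rfl; simp at hl
      refine ⟨l.dropLast, l.getLast hne, ⟨⟨by simp [hl], fun i hi =>
        h i (List.dropLast_subset l hi)⟩, h _ (List.getLast_mem hne)⟩,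
        List.dropLast_append_getLast hne⟩

lemma card_histories_le (N t : ℕ) : (histories N t).card ≤ N ^ t := by
  induction t with
  | zero => simp [histories]
  | succ t ih =>
    rw [histories]
    refine Finset.card_image_le.trans ?_
    rw [Finset.card_product, Finset.card_range, pow_succ]
    gcongr

lemma chosen_mem_histories {N : ℕ} (hN : 0 < N) (η : ℕ → ℕ → ℕ) (g : List ℕ → ℕ → ℕ) (t : ℕ) :
    chosen N η g t ∈ histories N t :=
  mem_histories.2 ⟨length_chosen .., lt_of_mem_chosen hN η g t⟩

/-- The extra `1` records that the first maximizer strictly beats all earlier candidates. -/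
lemma pick_spec (v : ℕ → ℕ) {N j : ℕ} (hj : j < N) :
    v j + (if j < pick v N then 1 else 0) ≤ v (pick v N) := by
  induction N with
  | zero => simp at hj
  | succ k ih =>
    rw [pick]
    rcases Nat.lt_succ_iff_lt_or_eq.1 hj with hj | rfl
    · have := ih hj
      split_ifs at this ⊢ <;> omega
    · by_cases h : v (pick v j) < v j
      · simp [h]
      · simp only [if_neg h]
        rcases Nat.eq_zero_or_pos j with rfl | hj
        · simp [pick]
        · have := pick_lt v hj
          rw [if_neg (by omega)]
          omega

/-- How large the noise of candidate `j` has to be for it to be picked. -/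
def lag (v g : ℕ → ℕ) (N j : ℕ) : ℕ :=
  ((Finset.range N).erase j).sup fun i => v i + g i + (if i < j then 1 else 0) - g j

/-- With the noise of the others fixed, winning is a threshold event for the noise of `j` alone. The
truncated subtraction in `lag` is harmless because noise is nonnegative. -/
lemma pick_eq_iff (v g : ℕ → ℕ) {N j : ℕ} (hj : j < N) :
    pick (fun i => v i + g i) N = j ↔ lag v g N j ≤ v j := by
  rw [lag, Finset.sup_le_iff]
  constructor
  · intro h i hi
    have := pick_spec (fun i => v i + g i) (Finset.mem_range.1 (Finset.mem_of_mem_erase hi))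
    rw [h] at this
    omega
  · intro h
    by_contra hne
    have h1 := pick_spec (fun i => v i + g i) hj
    have h2 := h (pick (fun i => v i + g i) N)
      (Finset.mem_erase.2 ⟨hne, Finset.mem_range.2 (pick_lt _ (by omega))⟩)
    split_ifs at h1 h2 <;> omega

/-- A winner that passes its threshold by `2 * e` still wins after its own gain has dropped by `e`
and those of its rivals have risen by `e`. -/
lemma pick_eq_of_close {v g g' : ℕ → ℕ} {N e : ℕ} (hg : ∀ i < N, g i ≤ g' i + e)
    (hg' : ∀ i < N, g' i ≤ g i + e)
    (h : ¬ ∃ j < N, lag v g N j ≤ v j ∧ v j < lag v g N j + 2 * e) :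
    pick (fun i => v i + g i) N = pick (fun i => v i + g' i) N := by
  rcases Nat.eq_zero_or_pos N with rfl | hN
  · rfl
  set j := pick (fun i => v i + g i) N with hj
  have hjN : j < N := pick_lt _ hN
  have h1 : lag v g N j ≤ v j := (pick_eq_iff v g hjN).1 hj.symm
  have h2 : lag v g N j + 2 * e ≤ v j := by
    by_contra h2
    exact h ⟨j, hjN, h1, by omega⟩
  symm
  rw [pick_eq_iff v g' hjN, lag, Finset.sup_le_iff]
  intro i hi
  have hiN := Finset.mem_range.1 (Finset.mem_of_mem_erase hi)
  have h3 := Finset.le_sup (f := fun i => v i + g i + (if i < j then 1 else 0) - g j) hi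
  rw [← lag] at h3
  have := hg j hjN
  have := hg' i hiN
  omega

end Selection

/-! ## Stability of the selection under geometric noise -/

section Geometric

open ProbabilityTheory

variable {Ω : Type*} [MeasurableSpace Ω] {μ : Measure Ω} [IsProbabilityMeasure μ]

/-- The law of `ξ` is geometric with success probability `p`, truncated at `cap`. -/
structure IsCappedGeometric (μ : Measure Ω) (ξ : Ω → ℕ) (p : ℝ) (cap : ℕ) : Prop where
  measurable : Measurable ξ
  le_cap : ∀ ω, ξ ω ≤ cap
  tail : ∀ k ≤ cap, μ.real {ω | k ≤ ξ ω} = (1 - p) ^ k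

/-- Below the cap this is memorylessness with Bernoulli's inequality `1 - (1 - p) ^ d ≤ d * p`. If
the window reaches beyond the cap, then `k > cap - d` and the whole tail is at most the second term.
-/
lemma IsCappedGeometric.window {ξ : Ω → ℕ} {p : ℝ} {cap : ℕ}
    (h : IsCappedGeometric μ ξ p cap) (hp : 0 ≤ p) (hp' : p ≤ 1) {k d : ℕ} (hk : k ≤ cap) :
    μ.real {ω | k ≤ ξ ω ∧ ξ ω < k + d} ≤
      d * p * μ.real {ω | k ≤ ξ ω} + (1 - p) ^ (cap - d) := by
  have h0 : 0 ≤ 1 - p := by linarith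
  by_cases hkd : k + d ≤ cap
  · have : {ω | k ≤ ξ ω ∧ ξ ω < k + d} = {ω | k ≤ ξ ω} \ {ω | k + d ≤ ξ ω} := by
      ext ω; simp
    have hsub : {ω | k + d ≤ ξ ω} ⊆ {ω | k ≤ ξ ω} :=
      fun ω (hω : k + d ≤ ξ ω) => le_trans (Nat.le_add_right k d) hω
    rw [this, measureReal_sdiff hsub (measurableSet_le measurable_const h.measurable), h.tail _ hk, h.tail _ hkd, pow_add]
    have hb := one_add_mul_le_pow (a := -p) (by linarith) d
    have : (1 - p) ^ k * (1 - (1 - p) ^ d) ≤ (1 - p) ^ k * (d * p) := by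
      gcongr
      rw [sub_eq_add_neg 1 p]
      linarith
    nlinarith [pow_nonneg h0 (cap - d)]
  · have h1 : μ.real {ω | k ≤ ξ ω ∧ ξ ω < k + d} ≤ μ.real {ω | k ≤ ξ ω} :=
      measureReal_mono (fun ω hω => hω.1)
    rw [h.tail k hk] at h1 ⊢
    have h2 : (1 - p) ^ k ≤ (1 - p) ^ (cap - d) :=
      pow_le_pow_of_le_one h0 (by linarith) (by omega)
    have : 0 ≤ d * p * (1 - p) ^ k := by positivity
    linarith

/-- Condition on the value of the independent threshold `K`; only values up to `cap` matter, since
`ξ` does not exceed `cap`. -/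
lemma IsCappedGeometric.random_window {ξ K : Ω → ℕ} {p : ℝ} {cap : ℕ}
    (h : IsCappedGeometric μ ξ p cap) (hp : 0 ≤ p) (hp' : p ≤ 1) (hK : Measurable K)
    (hind : IndepFun ξ K μ) (d : ℕ) :
    μ.real {ω | K ω ≤ ξ ω ∧ ξ ω < K ω + d} ≤
      d * p * μ.real {ω | K ω ≤ ξ ω} + (1 - p) ^ (cap - d) := by
  have h0 : 0 ≤ 1 - p := by linarith
  have hprod (s : Set ℕ) (k : ℕ) : μ.real ({ω | ξ ω ∈ s} ∩ {ω | K ω = k}) =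
      μ.real {ω | ξ ω ∈ s} * μ.real {ω | K ω = k} := by
    simp only [Measure.real]
    rw [← ENNReal.toReal_mul]
    congr 1
    exact hind.measure_inter_preimage_eq_mul s {k} trivial trivial
  have hms (s : Set ℕ) (k : ℕ) : MeasurableSet ({ω | ξ ω ∈ s} ∩ {ω | K ω = k}) :=
    (h.measurable trivial).inter (measurableSet_eq_fun hK measurable_const)
  have hdis (s : ℕ → Set ℕ) : Set.PairwiseDisjoint (↑(Finset.range (cap + 1)))
      fun k => {ω | ξ ω ∈ s k} ∩ {ω | K ω = k} := by
    intro i _ j _ hij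
    refine Set.disjoint_left.2 fun ω h1 h2 => hij ?_
    exact h1.2.symm.trans h2.2
  have hsum (s : ℕ → Set ℕ) : μ.real (⋃ k ∈ Finset.range (cap + 1),
      ({ω | ξ ω ∈ s k} ∩ {ω | K ω = k})) =
      ∑ k ∈ Finset.range (cap + 1), μ.real {ω | ξ ω ∈ s k} * μ.real {ω | K ω = k} := by
    rw [measureReal_biUnion_finset (hdis s) (fun k _ => hms _ k)]
    exact Finset.sum_congr rfl fun k _ => hprod _ k
  have h1 : μ.real {ω | K ω ≤ ξ ω ∧ ξ ω < K ω + d} ≤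
      ∑ k ∈ Finset.range (cap + 1), μ.real {ω | k ≤ ξ ω ∧ ξ ω < k + d} * μ.real {ω | K ω = k} := by
    refine le_trans (measureReal_mono ?_ (measure_ne_top _ _)) (hsum fun k => {x | k ≤ x ∧ x < k + d}).le
    intro ω hω
    simp only [mem_iUnion]
    exact ⟨K ω, by have := h.le_cap ω; have := hω.1; simp; omega, hω, rfl⟩
  have h2 : ∑ k ∈ Finset.range (cap + 1), μ.real {ω | k ≤ ξ ω} * μ.real {ω | K ω = k} ≤
      μ.real {ω | K ω ≤ ξ ω} := by
    refine le_trans (hsum fun k => {x | k ≤ x}).ge (measureReal_mono ?_)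
    intro ω hω
    simp only [mem_iUnion] at hω
    obtain ⟨k, _, hk, hk'⟩ := hω
    change K ω = k at hk'
    change k ≤ ξ ω at hk
    change K ω ≤ ξ ω
    omega
  have h3 : ∑ k ∈ Finset.range (cap + 1), μ.real {ω | K ω = k} ≤ 1 := by
    have := hsum fun _ => univ
    simp only [mem_univ, ofPred_true, probReal_univ, one_mul] at this
    rw [← this]
    exact measureReal_le_one
  calc _ ≤ _ := h1
    _ ≤ ∑ k ∈ Finset.range (cap + 1),
        (d * p * (μ.real {ω | k ≤ ξ ω} * μ.real {ω | K ω = k}) +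
          (1 - p) ^ (cap - d) * μ.real {ω | K ω = k}) := by
      refine Finset.sum_le_sum fun k hk => ?_
      rw [← mul_assoc, ← add_mul]
      refine mul_le_mul_of_nonneg_right (h.window hp hp' ?_) measureReal_nonneg
      simpa [Nat.lt_succ_iff] using hk
    _ ≤ _ := by
      rw [Finset.sum_add_distrib, ← Finset.mul_sum, ← Finset.mul_sum]
      have h4 := mul_le_mul_of_nonneg_left h2 (by positivity : 0 ≤ d * p)
      have h5 := mul_le_mul_of_nonneg_left h3 (pow_nonneg h0 (cap - d))
      linarith

/-- The events that `j` passes its threshold are the events that `j` is picked, hence disjoint, and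
their probabilities sum to at most `1`. So the main term `d * p` carries no factor `N`; only the cap
term does. -/
lemma measureReal_unstable_le {v : Ω → ℕ → ℕ} {p : ℝ} {cap N : ℕ}
    (hv : ∀ j < N, IsCappedGeometric μ (fun ω => v ω j) p cap) (hp : 0 ≤ p) (hp' : p ≤ 1)
    (g : ℕ → ℕ) (hm : ∀ j < N, Measurable fun ω => lag (v ω) g N j)
    (hind : ∀ j < N, IndepFun (fun ω => v ω j) (fun ω => lag (v ω) g N j) μ) (d : ℕ) :
    μ.real {ω | ∃ j < N, lag (v ω) g N j ≤ v ω j ∧ v ω j < lag (v ω) g N j + d} ≤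
      d * p + N * (1 - p) ^ (cap - d) := by
  have h1 : ∑ j ∈ Finset.range N, μ.real {ω | lag (v ω) g N j ≤ v ω j} ≤ 1 := by
    rw [← measureReal_biUnion_finset]
    · exact measureReal_le_one
    · intro i hi j hj hij
      simp only [Finset.coe_range, mem_Iio] at hi hj
      refine Set.disjoint_left.2 fun ω h1 h2 => hij ?_
      rw [← (pick_eq_iff (v ω) g hi).2 h1, ← (pick_eq_iff (v ω) g hj).2 h2]
    · intro j hj
      rw [Finset.mem_range] at hj
      exact measurableSet_le (hm j hj) (hv j hj).measurable
  calc _ ≤ μ.real (⋃ j ∈ Finset.range N,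
        {ω | lag (v ω) g N j ≤ v ω j ∧ v ω j < lag (v ω) g N j + d}) := by
        refine measureReal_mono ?_ (measure_ne_top _ _)
        rintro ω ⟨j, hj, h⟩
        simp only [mem_iUnion]
        exact ⟨j, Finset.mem_range.2 hj, h⟩
    _ ≤ ∑ j ∈ Finset.range N,
        μ.real {ω | lag (v ω) g N j ≤ v ω j ∧ v ω j < lag (v ω) g N j + d} :=
        measureReal_biUnion_finset_le _ _
    _ ≤ ∑ j ∈ Finset.range N,
        (d * p * μ.real {ω | lag (v ω) g N j ≤ v ω j} + (1 - p) ^ (cap - d)) := by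
        refine Finset.sum_le_sum fun j hj => ?_
        rw [Finset.mem_range] at hj
        exact (hv j hj).random_window hp hp' (hm j hj) (hind j hj) d
    _ ≤ _ := by
        rw [Finset.sum_add_distrib, ← Finset.mul_sum, Finset.sum_const, Finset.card_range,
          nsmul_eq_mul]
        have h4 := mul_le_mul_of_nonneg_left h1 (by positivity : 0 ≤ d * p)
        linarith

end Geometric

/-! ## Noise made of coin tosses -/

section Coins

open ProbabilityTheory

/-- The law of a sequence of independent fair coins. -/
noncomputable def coinLaw : Measure (ℕ → Bool) :=
  Measure.infinitePi fun _ : ℕ => (PMF.uniformOfFintype Bool).toMeasure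

instance : IsProbabilityMeasure coinLaw := by unfold coinLaw; infer_instance

/-- A function of finitely many coins factors through a finite space. Measurability is then
automatic, and independence amounts to disjointness of the sets of coins. -/
lemma exists_comp_restrict {β : Type*} {f : (ℕ → Bool) → β} {S : Finset ℕ}
    (hf : DependsOn f (S : Set ℕ)) :
    ∃ g : ((i : S) → Bool) → β, f = g ∘ fun (c : ℕ → Bool) (i : S) => c i := by
  have : Nonempty β := ⟨f fun _ => false⟩
  obtain ⟨g, hg⟩ := dependsOn_iff_exists_comp.1 hf
  exact ⟨g, hg⟩

lemma measurable_of_dependsOn {β : Type*} [MeasurableSpace β] {f : (ℕ → Bool) → β} {S : Finset ℕ}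
    (hf : DependsOn f (S : Set ℕ)) : Measurable f := by
  obtain ⟨g, rfl⟩ := exists_comp_restrict hf
  exact (measurable_of_countable g).comp (by fun_prop)

lemma indepFun_of_dependsOn {β γ : Type*} [MeasurableSpace β] [MeasurableSpace γ]
    {f : (ℕ → Bool) → β} {g : (ℕ → Bool) → γ} {S T : Finset ℕ} (hf : DependsOn f (S : Set ℕ))
    (hg : DependsOn g (T : Set ℕ)) (hST : Disjoint S T) : IndepFun f g coinLaw := by
  obtain ⟨f, rfl⟩ := exists_comp_restrict hf
  obtain ⟨g, rfl⟩ := exists_comp_restrict hg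
  have h : iIndepFun (fun (i : ℕ) (c : ℕ → Bool) => c i) coinLaw :=
    iIndepFun_infinitePi (X := fun _ x => x) fun _ => measurable_id
  exact (h.indepFun_finset S T hST fun i => measurable_pi_apply i).comp
    (measurable_of_countable f) (measurable_of_countable g)

lemma measureReal_and_of_dependsOn {P Q : (ℕ → Bool) → Prop} {S T : Finset ℕ}
    (hP : DependsOn P (S : Set ℕ)) (hQ : DependsOn Q (T : Set ℕ)) (hST : Disjoint S T) :
    coinLaw.real {c | P c ∧ Q c} = coinLaw.real {c | P c} * coinLaw.real {c | Q c} := by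
  have := (indepFun_of_dependsOn hP hQ hST).measure_inter_preimage_eq_mul {True} {True}
    (measurableSet_singleton _) (measurableSet_singleton _)
  have e₁ : {c | P c ∧ Q c} = P ⁻¹' {True} ∩ Q ⁻¹' {True} := by ext c; simp
  have e₂ : {c | P c} = P ⁻¹' {True} := by ext c; simp
  have e₃ : {c | Q c} = Q ⁻¹' {True} := by ext c; simp
  rw [e₁, e₂, e₃, Measure.real, this, ENNReal.toReal_mul, Measure.real, Measure.real]

lemma measureReal_zeros (p σ : ℕ) :
    coinLaw.real {c | ∀ b < σ, c (p + b) = false} = (1 / 2) ^ σ := by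
  have h := Measure.infinitePi_pi (fun _ : ℕ => (PMF.uniformOfFintype Bool).toMeasure)
    (s := Finset.Ico p (p + σ)) (t := fun _ => {false}) (fun _ _ => measurableSet_singleton _)
  have h2 : {c : ℕ → Bool | ∀ b < σ, c (p + b) = false} =
      Set.pi (Finset.Ico p (p + σ)) fun _ => {false} := by
    ext c
    simp only [mem_ofPred_eq, Set.mem_pi, Finset.coe_Ico, mem_Ico, mem_singleton_iff]
    constructor
    · rintro h i ⟨hi, hi'⟩
      obtain ⟨b, rfl⟩ := Nat.exists_eq_add_of_le hi
      exact h b (by omega)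
    · exact fun h b hb => h _ ⟨by omega, by omega⟩
  rw [Measure.real, coinLaw, h2, h]
  simp

/-- The counted trials form an initial segment, so their number is at least `k` exactly if the first
`k` trials all fail to be zero. -/
lemma le_noise_iff {cap σ k : ℕ} (c : ℕ → Bool) (p : ℕ) (hk : k ≤ cap) :
    k ≤ noise cap σ c p ↔ ∀ k' < k, ∃ b < σ, c (p + k' * σ + b) = true := by
  rw [noise]
  constructor
  · intro h k' hk'
    by_contra hc
    refine absurd (h.trans (Finset.card_le_card (t := Finset.range k') ?_)) (by simpa using hk')
    intro i hi
    rw [Finset.mem_filter] at hi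
    rw [Finset.mem_range]
    by_contra hik
    exact hc (hi.2 k' (by omega))
  · intro h
    refine le_trans (by simp) (Finset.card_le_card (s := Finset.range k) ?_)
    intro i hi
    simp only [Finset.mem_filter, Finset.mem_range] at hi ⊢
    exact ⟨by omega, fun k' hk' => h k' (by omega)⟩

lemma noise_le (cap σ : ℕ) (c : ℕ → Bool) (p : ℕ) : noise cap σ c p ≤ cap :=
  (Finset.card_filter_le _ _).trans (by simp)

lemma dependsOn_noise (cap σ p : ℕ) : DependsOn (fun c : ℕ → Bool => noise cap σ c p)
    (Finset.Ico p (p + cap * σ) : Set ℕ) := by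
  intro c c' h
  simp only [noise]
  congr 1
  refine Finset.filter_congr fun k hk => ?_
  rw [Finset.mem_range] at hk
  refine forall₂_congr fun k' hk' => exists_congr fun b => and_congr_right fun hb => ?_
  rw [h]
  simp only [Finset.coe_Ico, mem_Ico]
  have : (k' + 1) * σ ≤ cap * σ := by gcongr; omega
  rw [add_mul] at this
  constructor <;> omega

/-- Trial `k` uses coins which the trials before it do not, and consists of zeros with probability
`(1/2) ^ σ`; each step of the induction multiplies by the complementary probability. -/
lemma isCappedGeometric_noise (cap σ p : ℕ) :
    IsCappedGeometric coinLaw (fun c => noise cap σ c p) ((1 / 2) ^ σ) cap := by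
  refine ⟨measurable_of_dependsOn (dependsOn_noise cap σ p), fun c => noise_le _ _ _ _, ?_⟩
  intro k hk
  have hset : {c : ℕ → Bool | k ≤ noise cap σ c p} =
      {c | ∀ k' < k, ∃ b < σ, c (p + k' * σ + b) = true} := by
    ext c; exact le_noise_iff c p hk
  rw [hset]
  clear hset hk
  induction k with
  | zero => simp
  | succ k ih =>
    have h1 : {c : ℕ → Bool | ∀ k' < k + 1, ∃ b < σ, c (p + k' * σ + b) = true} =
        {c | (∀ k' < k, ∃ b < σ, c (p + k' * σ + b) = true) ∧
          ∃ b < σ, c (p + k * σ + b) = true} := by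
      ext c
      simp only [mem_ofPred_eq, Nat.lt_succ_iff_lt_or_eq, or_imp, forall_and, forall_eq]
    rw [h1, measureReal_and_of_dependsOn (S := Finset.Ico p (p + k * σ))
      (T := Finset.Ico (p + k * σ) (p + k * σ + σ)), ih, pow_succ]
    · congr 1
      have h2 : {c : ℕ → Bool | ∃ b < σ, c (p + k * σ + b) = true} =
          {c | ∀ b < σ, c (p + k * σ + b) = false}ᶜ := by
        ext c; simp
      rw [h2, probReal_compl_eq_one_sub, measureReal_zeros]
      have : DependsOn (fun c : ℕ → Bool => ∀ b < σ, c (p + k * σ + b) = false)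
          (Finset.Ico (p + k * σ) (p + k * σ + σ) : Set ℕ) := by
        intro c c' h
        refine propext (forall₂_congr fun b hb => ?_)
        rw [h]
        simpa using hb
      exact (measurable_of_dependsOn this).setOf
    · intro c c' h
      refine propext (forall₂_congr fun k' hk' => exists_congr fun b => and_congr_right fun hb => ?_)
      rw [h]
      simp only [Finset.coe_Ico, mem_Ico]
      have : (k' + 1) * σ ≤ k * σ := by gcongr; omega
      rw [add_mul] at this
      constructor <;> omega
    · intro c c' h
      refine propext (exists_congr fun b => and_congr_right fun hb => ?_)
      rw [h]
      simpa using hb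
    · rw [Finset.disjoint_left]
      intro i hi hi'
      simp only [Finset.mem_Ico] at hi hi'
      omega

end Coins

/-! ### Coupling of two boosting runs that share their coins. -/

section Rounds

open ProbabilityTheory

/-- The noise for candidate `j` in round `t`, when there are `N` candidates. -/
def gridNoise (N cap σ : ℕ) (c : ℕ → Bool) (t j : ℕ) : ℕ :=
  noise cap σ c ((t * N + j) * (cap * σ))

/-- The coins which determine the noise in round `t`. -/
def roundCoins (N cap σ t : ℕ) : Finset ℕ :=
  Finset.Ico (t * N * (cap * σ)) ((t + 1) * N * (cap * σ))

/-- The coins which determine the noise for candidate `j` in round `t`. -/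
def cellCoins (N cap σ t j : ℕ) : Finset ℕ :=
  Finset.Ico ((t * N + j) * (cap * σ)) ((t * N + j + 1) * (cap * σ))

variable {N cap σ : ℕ}

lemma dependsOn_gridNoise (t j : ℕ) : DependsOn (fun c => gridNoise N cap σ c t j)
    (cellCoins N cap σ t j : Set ℕ) := by
  have := dependsOn_noise cap σ ((t * N + j) * (cap * σ))
  rw [cellCoins, add_mul (t * N + j) 1, one_mul]
  exact this

lemma cellCoins_subset {t j : ℕ} (hj : j < N) : cellCoins N cap σ t j ⊆ roundCoins N cap σ t := by
  apply Finset.Ico_subset_Ico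
  · gcongr; omega
  · gcongr
    rw [add_mul, one_mul]
    omega

lemma disjoint_cellCoins {t i j : ℕ} (hij : i ≠ j) :
    Disjoint (cellCoins N cap σ t i) (cellCoins N cap σ t j) := by
  have key : ∀ i j : ℕ, i < j → Disjoint (cellCoins N cap σ t i) (cellCoins N cap σ t j) := by
    intro i j hij
    rw [Finset.disjoint_left]
    intro k hk hk'
    simp only [cellCoins, Finset.mem_Ico] at hk hk'
    have : (t * N + i + 1) * (cap * σ) ≤ (t * N + j) * (cap * σ) :=
      Nat.mul_le_mul_right _ (by omega)
    omega
  rcases lt_or_gt_of_ne hij with h | h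
  · exact key i j h
  · exact (key j i h).symm

lemma dependsOn_gridNoise_round {t j : ℕ} (hj : j < N) :
    DependsOn (fun c => gridNoise N cap σ c t j) (roundCoins N cap σ t : Set ℕ) :=
  (dependsOn_gridNoise t j).mono (by exact_mod_cast cellCoins_subset hj)

/-- The threshold of a candidate does not involve its own coins; this gives the independence needed
for `measureReal_unstable_le`. -/
lemma dependsOn_lag (t : ℕ) (g : ℕ → ℕ) (j : ℕ) :
    DependsOn (fun c => lag (gridNoise N cap σ c t) g N j)
      ((roundCoins N cap σ t \ cellCoins N cap σ t j : Finset ℕ) : Set ℕ) := by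
  intro c c' h
  simp only [lag]
  refine Finset.sup_congr rfl fun i hi => ?_
  have hi' := Finset.mem_erase.1 hi
  have : gridNoise N cap σ c t i = gridNoise N cap σ c' t i := by
    refine dependsOn_gridNoise t i fun k hk => h k ?_
    simp only [Finset.coe_sdiff, mem_sdiff, Finset.mem_coe] at hk ⊢
    exact ⟨cellCoins_subset (Finset.mem_range.1 hi'.2) hk,
      Finset.disjoint_left.1 (disjoint_cellCoins hi'.1) hk⟩
  rw [this]

lemma pick_congr {v w : ℕ → ℕ} {N : ℕ} (h : ∀ j < N, v j = w j) : pick v N = pick w N := by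
  induction N with
  | zero => rfl
  | succ k ih =>
    have ih' := ih fun j hj => h j (by omega)
    rw [pick, pick, ih', h k (by omega)]
    rcases Nat.eq_zero_or_pos k with rfl | hk
    · simp [pick, h 0]
    · rw [h (pick w k) ((pick_lt w hk).trans (by omega))]

lemma dependsOn_chosen (g : List ℕ → ℕ → ℕ) (t : ℕ) :
    DependsOn (fun c => chosen N (gridNoise N cap σ c) g t)
      (Finset.range (t * N * (cap * σ)) : Set ℕ) := by
  induction t with
  | zero => intro c c' _; rfl
  | succ t ih =>
    intro c c' h
    have h1 : chosen N (gridNoise N cap σ c) g t = chosen N (gridNoise N cap σ c') g t := by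
      refine ih fun i hi => h i ?_
      simp only [Finset.coe_range, mem_Iio] at hi ⊢
      refine hi.trans_le ?_
      gcongr
      omega
    simp only [chosen]
    rw [h1]
    congr 2
    refine pick_congr fun j hj => ?_
    congr 1
    refine dependsOn_gridNoise_round hj fun i hi => h i ?_
    simp only [roundCoins, Finset.coe_Ico, mem_Ico, Finset.coe_range, mem_Iio] at hi ⊢
    exact hi.2

/-- The noise in round `t` is such that small changes of the gains may matter. -/
def Unstable (N cap σ : ℕ) (c : ℕ → Bool) (t : ℕ) (g : ℕ → ℕ) (d : ℕ) : Prop :=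
  ∃ j < N, lag (gridNoise N cap σ c t) g N j ≤ gridNoise N cap σ c t j ∧
    gridNoise N cap σ c t j < lag (gridNoise N cap σ c t) g N j + d

lemma dependsOn_unstable (t : ℕ) (g : ℕ → ℕ) (d : ℕ) :
    DependsOn (fun c => Unstable N cap σ c t g d) (roundCoins N cap σ t : Set ℕ) := by
  intro c c' h
  refine propext (exists_congr fun j => and_congr_right fun hj => ?_)
  have h1 : gridNoise N cap σ c t j = gridNoise N cap σ c' t j :=
    dependsOn_gridNoise_round hj h
  have h2 : lag (gridNoise N cap σ c t) g N j = lag (gridNoise N cap σ c' t) g N j :=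
    dependsOn_lag t g j fun i hi => h i (by
      simp only [Finset.coe_sdiff, mem_sdiff] at hi
      exact hi.1)
  rw [h1, h2]

lemma measureReal_unstable_round_le (t : ℕ) (g : ℕ → ℕ) (d : ℕ) :
    coinLaw.real {c | Unstable N cap σ c t g d} ≤
      d * (1 / 2) ^ σ + N * (1 - (1 / 2) ^ σ) ^ (cap - d) := by
  refine measureReal_unstable_le (μ := coinLaw) (v := fun c => gridNoise N cap σ c t)
    (fun j _ => isCappedGeometric_noise cap σ _) (by positivity)
    (pow_le_one₀ (by norm_num) (by norm_num)) g
    (fun j _ => measurable_of_dependsOn (dependsOn_lag t g j)) (fun j _ => ?_) d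
  exact indepFun_of_dependsOn (dependsOn_gridNoise t j) (dependsOn_lag t g j)
    Finset.disjoint_sdiff

/-- At the first round where the two runs part, they share a history `l`, and the noise of that
round is unstable for `g l`. The history depends on earlier coins only, so instability is
independent of it. The probabilities of the histories sum to at most `1`, so their number does not
enter the bound. -/
theorem measureReal_chosen_ne_le (hN : 0 < N) {T e : ℕ} {g g' : List ℕ → ℕ → ℕ}
    (hg : ∀ t < T, ∀ l ∈ histories N t, ∀ j < N, g l j ≤ g' l j + e)
    (hg' : ∀ t < T, ∀ l ∈ histories N t, ∀ j < N, g' l j ≤ g l j + e) :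
    coinLaw.real {c | chosen N (gridNoise N cap σ c) g T ≠ chosen N (gridNoise N cap σ c) g' T} ≤
      T * ((2 * e : ℕ) * (1 / 2) ^ σ + N * (1 - (1 / 2) ^ σ) ^ (cap - 2 * e)) := by
  set δ : ℝ := (2 * e : ℕ) * (1 / 2) ^ σ + N * (1 - (1 / 2) ^ σ) ^ (cap - 2 * e) with hδ
  set U : ℕ → List ℕ → Set (ℕ → Bool) := fun t l => {c | chosen N (gridNoise N cap σ c) g t = l ∧
    Unstable N cap σ c t (g l) (2 * e)} with hU
  have hsub : {c | chosen N (gridNoise N cap σ c) g T ≠ chosen N (gridNoise N cap σ c) g' T} ⊆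
      ⋃ t ∈ Finset.range T, ⋃ l ∈ histories N t, U t l := by
    intro c hc
    by_contra hcon
    simp only [mem_iUnion, not_exists] at hcon
    have : ∀ t ≤ T, chosen N (gridNoise N cap σ c) g t = chosen N (gridNoise N cap σ c) g' t := by
      intro t
      induction t with
      | zero => intro _; rfl
      | succ t ih =>
        intro ht
        have h1 := ih (by omega)
        have hl := chosen_mem_histories hN (gridNoise N cap σ c) g t
        have h2 := hcon t (Finset.mem_range.2 (by omega)) _ hl
        rw [chosen, chosen, ← h1]
        congr 2
        refine pick_eq_of_close (e := e) (hg t (by omega) _ hl) (hg' t (by omega) _ hl) fun h => ?_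
        exact h2 ⟨rfl, h⟩
    exact hc (this T le_rfl)
  have hround (t : ℕ) : coinLaw.real (⋃ l ∈ histories N t, U t l) ≤ δ := by
    have hP (l : List ℕ) : DependsOn (fun c => chosen N (gridNoise N cap σ c) g t = l)
        (Finset.range (t * N * (cap * σ)) : Set ℕ) := by
      intro c c' h
      have := dependsOn_chosen g t h
      simp only at this
      simp only [this]
    have hdis : Disjoint (Finset.range (t * N * (cap * σ))) (roundCoins N cap σ t) := by
      rw [Finset.disjoint_left]
      intro i hi hi'
      simp only [roundCoins, Finset.mem_range, Finset.mem_Ico] at hi hi'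
      omega
    calc _ ≤ ∑ l ∈ histories N t, coinLaw.real (U t l) := measureReal_biUnion_finset_le _ _
      _ ≤ ∑ l ∈ histories N t,
          coinLaw.real {c | chosen N (gridNoise N cap σ c) g t = l} * δ := by
        refine Finset.sum_le_sum fun l _ => ?_
        rw [hU]
        simp only
        rw [measureReal_and_of_dependsOn (hP l) (dependsOn_unstable t (g l) (2 * e)) hdis]
        exact mul_le_mul_of_nonneg_left (measureReal_unstable_round_le t (g l) (2 * e))
          measureReal_nonneg
      _ = coinLaw.real (⋃ l ∈ histories N t,
          {c | chosen N (gridNoise N cap σ c) g t = l}) * δ := by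
        rw [← Finset.sum_mul, ← measureReal_biUnion_finset]
        · intro l _ l' _ hll
          refine Set.disjoint_left.2 fun c h1 h2 => hll ?_
          exact (show chosen N (gridNoise N cap σ c) g t = l from h1).symm.trans h2
        · exact fun l _ => (measurable_of_dependsOn (hP l)).setOf
      _ ≤ 1 * δ := by
        refine mul_le_mul_of_nonneg_right measureReal_le_one ?_
        have : (0 : ℝ) ≤ 1 - (1 / 2) ^ σ := by
          have : ((1 : ℝ) / 2) ^ σ ≤ 1 := pow_le_one₀ (by norm_num) (by norm_num)
          linarith
        positivity
      _ = δ := one_mul _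
  calc _ ≤ coinLaw.real (⋃ t ∈ Finset.range T, ⋃ l ∈ histories N t, U t l) :=
        measureReal_mono hsub (measure_ne_top _ _)
    _ ≤ ∑ t ∈ Finset.range T, coinLaw.real (⋃ l ∈ histories N t, U t l) :=
        measureReal_biUnion_finset_le _ _
    _ ≤ ∑ t ∈ Finset.range T, δ := Finset.sum_le_sum fun t _ => hround t
    _ = T * δ := by simp

end Rounds

/-! ## Concentration of the gains -/

section Concentration

open ProbabilityTheory

lemma hoeffding_pi {Z : Type*} [MeasurableSpace Z] (D : Measure Z) [IsProbabilityMeasure D]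
    {φ : Z → ℝ} (hφ : Measurable φ) {B : ℝ} (hB : ∀ z, φ z ∈ Icc 0 B) (n : ℕ) {Δ : ℝ}
    (hΔ : 0 ≤ Δ) :
    (Measure.pi fun _ : Fin n => D).real {S | Δ < |∑ i, φ (S i) - n * ∫ z, φ z ∂D|} ≤
      2 * Real.exp (-(2 * Δ ^ 2) / (n * B ^ 2)) := by
  set μ := Measure.pi fun _ : Fin n => D
  have one_side (ψ : Z → ℝ) (hψ : Measurable ψ) (a : ℝ) (h : ∀ z, ψ z ∈ Icc a (a + B)) :
      μ.real {S | Δ ≤ ∑ i, (ψ (S i) - ∫ z, ψ z ∂D)} ≤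
        Real.exp (-(2 * Δ ^ 2) / (n * B ^ 2)) := by
    have hind : iIndepFun (fun (i : Fin n) (S : Fin n → Z) => ψ (S i) - ∫ z, ψ z ∂D) μ :=
      iIndepFun_pi (X := fun _ z => ψ z - ∫ z, ψ z ∂D) fun _ => by fun_prop
    have hsub (i : Fin n) : HasSubgaussianMGF (fun S : Fin n → Z => ψ (S i) - ∫ z, ψ z ∂D)
        ((‖(a + B) - a‖₊ / 2) ^ 2) μ := by
      have hmp : MeasurePreserving (fun S : Fin n → Z => S i) μ D := measurePreserving_eval _ i
      have h1 := hasSubgaussianMGF_of_mem_Icc (μ := D) hψ.aemeasurable (ae_of_all _ h)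
      rw [← hmp.map_eq] at h1
      have h2 := h1.of_map hmp.measurable.aemeasurable
      rwa [hmp.map_eq] at h2
    refine (HasSubgaussianMGF.measure_sum_ge_le_of_iIndepFun hind (fun i _ => hsub i) hΔ).trans (le_of_eq ?_)
    congr 1
    simp only [Finset.sum_const, Finset.card_univ, Fintype.card_fin, nsmul_eq_mul]
    push_cast
    rw [add_sub_cancel_left, Real.norm_eq_abs, div_pow, sq_abs]
    -- In the degenerate case both exponents are quotients by zero, hence equal to `0`.
    rcases eq_or_ne ((n : ℝ) * B ^ 2) 0 with h0 | h0
    · have : 2 * ((n : ℝ) * (B ^ 2 / 2 ^ 2)) = 0 := by linear_combination (1 / 2) * h0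
      rw [this, h0]; simp
    · have : 2 * ((n : ℝ) * (B ^ 2 / 2 ^ 2)) ≠ 0 := fun h => h0 (by linear_combination 2 * h)
      rw [div_eq_div_iff this h0]
      ring
  have e1 : ∀ S : Fin n → Z, ∑ i, (φ (S i) - ∫ z, φ z ∂D) =
      ∑ i, φ (S i) - n * ∫ z, φ z ∂D := fun S => by simp
  have e2 : ∀ S : Fin n → Z, ∑ i, (-φ (S i) - ∫ z, -φ z ∂D) =
      -(∑ i, φ (S i) - n * ∫ z, φ z ∂D) := fun S => by simp [integral_neg, Finset.sum_add_distrib]; ring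
  have h1 := one_side φ hφ 0 (by simpa using hB)
  have h2 := one_side (fun z => -φ z) hφ.neg (-B) fun z => by
    have := hB z
    exact ⟨by linarith [this.2], by linarith [this.1]⟩
  simp only [e1, e2] at h1 h2
  calc _ ≤ μ.real ({S | Δ ≤ ∑ i, φ (S i) - n * ∫ z, φ z ∂D} ∪
        {S | Δ ≤ -(∑ i, φ (S i) - n * ∫ z, φ z ∂D)}) := by
        refine measureReal_mono ?_ (measure_ne_top _ _)
        intro S hS
        rcases lt_abs.1 (show Δ < |∑ i, φ (S i) - n * ∫ z, φ z ∂D| from hS) with h | h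
        · exact Or.inl h.le
        · exact Or.inr h.le
    _ ≤ _ := measureReal_union_le _ _
    _ ≤ _ := by linarith

variable {X : Type*}

lemma hit_le_weight (f : ℕ → X → Bool) (l : List ℕ) (j : ℕ) (z : X × Bool) :
    hit f l j z ≤ weight f l z := by
  rw [hit]; split_ifs <;> simp

lemma weight_le (f : ℕ → X → Bool) (l : List ℕ) (z : X × Bool) : weight f l z ≤ 2 ^ l.length :=
  Nat.pow_le_pow_right (by norm_num) List.countP_le_length

lemma one_le_weight (f : ℕ → X → Bool) (l : List ℕ) (z : X × Bool) : 1 ≤ weight f l z :=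
  Nat.one_le_two_pow

/-- A right model leaves the weight as it is and scores it as a hit; a wrong one doubles the weight
and scores nothing. Integrated, this says that a large gain means slow growth of the mean weight. -/
lemma weight_append (f : ℕ → X → Bool) (l : List ℕ) (j : ℕ) (z : X × Bool) :
    weight f (l ++ [j]) z + hit f l j z = 2 * weight f l z := by
  rw [weight, List.countP_append, pow_add, ← weight, hit]
  by_cases h : f j z.1 = z.2
  · simp [h]; ring
  · simp [h]; ring

variable [MeasurableSpace X]

/-- All empirical gains that the learning program may meet are within `Δ` of their expectations. -/
def Concentrated (D : Measure (X × Bool)) (f : ℕ → X → Bool) (N T : ℕ) (Δ : ℝ) {n : ℕ}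
    (S : Fin n → X × Bool) : Prop :=
  ∀ t < T, ∀ l ∈ histories N t, ∀ j < N,
    |(gain f S l j : ℝ) - n * ∫ z, (hit f l j z : ℝ) ∂D| ≤ Δ

/-! ### Joint measurability in the seeds and the examples. -/

section Measurability

variable {W : Type*} [MeasurableSpace W] {f : W → ℕ → X → Bool}

lemma measurable_weight (hf : ∀ j, Measurable fun s : W × X => f s.1 j s.2) (l : List ℕ) :
    Measurable fun s : W × (X × Bool) => weight (f s.1) l s.2 := by
  induction l with
  | nil => simp [weight]
  | cons j l ih =>
    have h : Measurable fun s : W × (X × Bool) => (f s.1 j s.2.1 != s.2.2) :=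
      (measurable_of_countable fun b : Bool × Bool => (b.1 != b.2)).comp
        (((hf j).comp (by fun_prop : Measurable fun s : W × (X × Bool) => (s.1, s.2.1))).prodMk
          (by fun_prop : Measurable fun s : W × (X × Bool) => s.2.2))
    have : (fun s : W × (X × Bool) => weight (f s.1) (j :: l) s.2) = fun s =>
        weight (f s.1) l s.2 * (fun b : Bool => if b = true then 2 else 1)
          (f s.1 j s.2.1 != s.2.2) := by
      funext s
      simp only [weight, List.countP_cons, pow_add]
      cases (f s.1 j s.2.1 != s.2.2) <;> simp
    rw [this]
    exact ih.mul (Measurable.comp (g := fun b : Bool => if b = true then 2 else 1)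
      (measurable_of_countable _) h)

lemma measurable_hit (hf : ∀ j, Measurable fun s : W × X => f s.1 j s.2) (l : List ℕ) (j : ℕ) :
    Measurable fun s : W × (X × Bool) => hit (f s.1) l j s.2 := by
  refine Measurable.ite ?_ (measurable_weight hf l) measurable_const
  exact measurableSet_eq_fun
    ((hf j).comp (by fun_prop : Measurable fun s : W × (X × Bool) => (s.1, s.2.1)))
    (by fun_prop : Measurable fun s : W × (X × Bool) => s.2.2)

lemma measurable_gain (hf : ∀ j, Measurable fun s : W × X => f s.1 j s.2) {n : ℕ} (l : List ℕ)
    (j : ℕ) : Measurable fun s : (Fin n → X × Bool) × W => gain (f s.2) s.1 l j := by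
  refine Finset.measurable_sum _ fun i _ => ?_
  exact (measurable_hit hf l j).comp
    (by fun_prop : Measurable fun s : (Fin n → X × Bool) × W => (s.2, s.1 i))

lemma measurableSet_concentrated (hf : ∀ j, Measurable fun s : W × X => f s.1 j s.2)
    (D : Measure (X × Bool)) [IsProbabilityMeasure D] (N T : ℕ) (Δ : ℝ) (n : ℕ) :
    MeasurableSet {s : (Fin n → X × Bool) × W | Concentrated D (f s.2) N T Δ s.1} := by
  have key (l : List ℕ) (j : ℕ) : MeasurableSet {s : (Fin n → X × Bool) × W |
      |(gain (f s.2) s.1 l j : ℝ) - n * ∫ z, (hit (f s.2) l j z : ℝ) ∂D| ≤ Δ} := by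
    have h1 : Measurable fun w : W => ∫ z, (hit (f w) l j z : ℝ) ∂D := by
      refine StronglyMeasurable.measurable ?_
      refine StronglyMeasurable.integral_prod_right
        (f := fun w z => (hit (f w) l j z : ℝ)) ?_
      exact ((measurable_of_countable (fun k : ℕ => (k : ℝ))).comp
        (measurable_hit hf l j)).stronglyMeasurable
    have h2 : Measurable fun s : (Fin n → X × Bool) × W => (gain (f s.2) s.1 l j : ℝ) :=
      (measurable_of_countable (fun k : ℕ => (k : ℝ))).comp (measurable_gain hf l j)
    refine measurableSet_le (f := fun s : (Fin n → X × Bool) × W =>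
      |(gain (f s.2) s.1 l j : ℝ) - n * ∫ z, (hit (f s.2) l j z : ℝ) ∂D|) ?_ measurable_const
    exact (h2.sub (measurable_const.mul (h1.comp measurable_snd))).abs
  have : {s : (Fin n → X × Bool) × W | Concentrated D (f s.2) N T Δ s.1} =
      ⋂ t ∈ Finset.range T, ⋂ l ∈ histories N t, ⋂ j ∈ Finset.range N,
        {s : (Fin n → X × Bool) × W |
          |(gain (f s.2) s.1 l j : ℝ) - n * ∫ z, (hit (f s.2) l j z : ℝ) ∂D| ≤ Δ} := by
    ext s; simp [Concentrated]
  rw [this]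
  exact Finset.measurableSet_biInter _ fun t _ => Finset.measurableSet_biInter _ fun l _ =>
    Finset.measurableSet_biInter _ fun j _ => key l j

end Measurability

lemma measurable_weight' {f : ℕ → X → Bool} (hf : ∀ j, Measurable (f j)) (l : List ℕ) :
    Measurable (weight f l) :=
  (measurable_weight (W := Unit) (f := fun _ => f) (fun j => (hf j).comp measurable_snd) l).comp
    (by fun_prop : Measurable fun z : X × Bool => ((), z))

lemma measurable_hit' {f : ℕ → X → Bool} (hf : ∀ j, Measurable (f j)) (l : List ℕ) (j : ℕ) :
    Measurable (hit f l j) :=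
  (measurable_hit (W := Unit) (f := fun _ => f) (fun j => (hf j).comp measurable_snd) l j).comp
    (by fun_prop : Measurable fun z : X × Bool => ((), z))

lemma measurable_natCast_comp {Z : Type*} [MeasurableSpace Z] {u : Z → ℕ} (hu : Measurable u) :
    Measurable fun z => (u z : ℝ) :=
  (measurable_of_countable fun k : ℕ => (k : ℝ)).comp hu

/-- The models do not depend on the sample, so Hoeffding's inequality applies to each fixed history
and candidate. The history met in the run does depend on the sample, which the union bound over all
histories takes care of. -/
theorem measureReal_not_concentrated_le (D : Measure (X × Bool)) [IsProbabilityMeasure D]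
    {f : ℕ → X → Bool} (hf : ∀ j, Measurable (f j)) (N T n : ℕ) {Δ : ℝ} (hΔ : 0 ≤ Δ) :
    (Measure.pi fun _ : Fin n => D).real {S | ¬ Concentrated D f N T Δ S} ≤
      T * N ^ T * (2 * Real.exp (-(2 * Δ ^ 2) / (n * (2 ^ T) ^ 2))) := by
  set μ := Measure.pi fun _ : Fin n => D
  set ε := 2 * Real.exp (-(2 * Δ ^ 2) / (n * (2 ^ T) ^ 2)) with hε
  have key (t : ℕ) (ht : t < T) (l : List ℕ) (hl : l ∈ histories N t) (j : ℕ) :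
      μ.real {S | Δ < |(gain f S l j : ℝ) - n * ∫ z, (hit f l j z : ℝ) ∂D|} ≤ ε := by
    have := hoeffding_pi D (measurable_natCast_comp (measurable_hit' hf l j)) (B := 2 ^ T)
      (fun z => ⟨by positivity, ?_⟩) n hΔ
    · simpa [gain] using this
    · have h1 := (hit_le_weight f l j z).trans (weight_le f l z)
      rw [(mem_histories.1 hl).1] at h1
      have h2 : hit f l j z ≤ 2 ^ T := h1.trans (Nat.pow_le_pow_right (by norm_num) ht.le)
      exact_mod_cast h2
  have hsub : {S : Fin n → X × Bool | ¬ Concentrated D f N T Δ S} ⊆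
      ⋃ t ∈ Finset.range T, ⋃ l ∈ histories N t, ⋃ j ∈ Finset.range N,
        {S | Δ < |(gain f S l j : ℝ) - n * ∫ z, (hit f l j z : ℝ) ∂D|} := by
    intro S hS
    change ¬ Concentrated D f N T Δ S at hS
    rw [Concentrated] at hS
    push Not at hS
    obtain ⟨t, ht, l, hl, j, hj, h⟩ := hS
    simp only [mem_iUnion]
    exact ⟨t, Finset.mem_range.2 ht, l, hl, j, Finset.mem_range.2 hj, h⟩
  have hε0 : 0 ≤ ε := by positivity
  calc _ ≤ _ := measureReal_mono hsub (measure_ne_top _ _)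
    _ ≤ ∑ t ∈ Finset.range T, ∑ l ∈ histories N t, ∑ j ∈ Finset.range N, ε := by
      refine (measureReal_biUnion_finset_le _ _).trans (Finset.sum_le_sum fun t ht => ?_)
      refine (measureReal_biUnion_finset_le _ _).trans (Finset.sum_le_sum fun l hl => ?_)
      refine (measureReal_biUnion_finset_le _ _).trans (Finset.sum_le_sum fun j hj => ?_)
      exact key t (Finset.mem_range.1 ht) l hl j
    _ ≤ ∑ t ∈ Finset.range T, (N : ℝ) ^ T * ε := by
      refine Finset.sum_le_sum fun t ht => ?_
      rw [Finset.sum_const, Finset.sum_const, Finset.card_range, smul_smul, nsmul_eq_mul]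
      refine mul_le_mul_of_nonneg_right ?_ hε0
      have h1 : (histories N t).card * N ≤ N ^ (t + 1) := by
        rw [pow_succ]; exact Nat.mul_le_mul_right _ (card_histories_le N t)
      rcases Nat.eq_zero_or_pos N with rfl | hN
      · simp
      · have h2 : (histories N t).card * N ≤ N ^ T :=
          h1.trans (Nat.pow_le_pow_right hN (Finset.mem_range.1 ht))
        exact_mod_cast h2
    _ = _ := by simp [mul_assoc]

end Concentration

/-! ## Boosting -/

section Boosting

variable {X : Type*} [MeasurableSpace X] {D : Measure (X × Bool)} [IsProbabilityMeasure D]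
  {f : ℕ → X → Bool}

lemma integrable_weight (hf : ∀ j, Measurable (f j)) (l : List ℕ) :
    Integrable (fun z => (weight f l z : ℝ)) D := by
  refine Integrable.of_bound (measurable_natCast_comp (measurable_weight' hf l)).aestronglyMeasurable
    (2 ^ l.length) (ae_of_all _ fun z => ?_)
  rw [Real.norm_natCast]
  exact_mod_cast weight_le f l z

lemma integrable_hit (hf : ∀ j, Measurable (f j)) (l : List ℕ) (j : ℕ) :
    Integrable (fun z => (hit f l j z : ℝ)) D := by
  refine Integrable.of_bound (measurable_natCast_comp (measurable_hit' hf l j)).aestronglyMeasurable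
    (2 ^ l.length) (ae_of_all _ fun z => ?_)
  rw [Real.norm_natCast]
  exact_mod_cast (hit_le_weight f l j z).trans (weight_le f l z)

/-- One of the first `N` models has error at most `1/16` with respect to the weights of `l`. -/
def HasGoodModel (D : Measure (X × Bool)) (f : ℕ → X → Bool) (N : ℕ) (l : List ℕ) : Prop :=
  ∃ j < N, 15 / 16 * ∫ z, (weight f l z : ℝ) ∂D ≤ ∫ z, (hit f l j z : ℝ) ∂D

lemma one_le_integral_weight (hf : ∀ j, Measurable (f j)) (l : List ℕ) :
    1 ≤ ∫ z, (weight f l z : ℝ) ∂D := by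
  have := integral_mono (integrable_const (μ := D) (1 : ℝ)) (integrable_weight hf l)
    fun z => Nat.one_le_cast.2 (one_le_weight f l z)
  simpa using this

/-- Let `w` be the mean weight. A good model hits `15/16 * w`; noise and sampling error cost the
picked one at most `1/16`, which is at most `w/16` as `w ≥ 1`. So it hits at least `7/8 * w`, and
the new mean weight is at most `(2 - 7/8) * w`. -/
theorem integral_weight_chosen_le (hf : ∀ j, Measurable (f j)) {N T cap n : ℕ} {Δ : ℝ}
    {S : Fin n → X × Bool} (hN : 0 < N) (hS : Concentrated D f N T Δ S)
    (hgood : ∀ t < T, ∀ l ∈ histories N t, HasGoodModel D f N l) {η : ℕ → ℕ → ℕ}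
    (hη : ∀ t j, η t j ≤ cap) (hn : 0 < n) (hslack : 2 * Δ + cap ≤ n / 16) :
    ∀ t ≤ T, ∫ z, (weight f (chosen N η (gain f S) t) z : ℝ) ∂D ≤ (9 / 8) ^ t := by
  intro t
  induction t with
  | zero => intro _; simp [chosen, weight]
  | succ t ih =>
    intro ht
    have ih := ih (by omega)
    have hl := chosen_mem_histories hN η (gain f S) t
    rw [chosen]
    set l := chosen N η (gain f S) t
    set i := pick (fun j => η t j + gain f S l j) N with hi
    obtain ⟨j, hj, hgj⟩ := hgood t (by omega) l hl
    have hspec := pick_spec (fun j => η t j + gain f S l j) hj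
    rw [← hi] at hspec
    have hiN : i < N := pick_lt _ hN
    have h1 : gain f S l j ≤ cap + gain f S l i := by
      have := hη t i
      omega
    have h1' : (gain f S l j : ℝ) ≤ cap + gain f S l i := by exact_mod_cast h1
    have h2 := abs_le.1 (hS t (by omega) l hl j hj)
    have h3 := abs_le.1 (hS t (by omega) l hl i hiN)
    have hint : ∫ z, (weight f (l ++ [i]) z : ℝ) ∂D =
        2 * ∫ z, (weight f l z : ℝ) ∂D - ∫ z, (hit f l i z : ℝ) ∂D := by
      rw [← integral_const_mul, ← integral_sub ((integrable_weight hf l).const_mul 2)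
        (integrable_hit hf l i)]
      refine integral_congr_ae (ae_of_all _ fun z => ?_)
      have h : (weight f (l ++ [i]) z : ℝ) + hit f l i z = 2 * weight f l z := by
        exact_mod_cast weight_append f l i z
      simp only
      linarith
    have hn' : (0 : ℝ) < n := by exact_mod_cast hn
    have h4 : (n : ℝ) * (15 / 16 * ∫ z, (weight f l z : ℝ) ∂D) ≤
        n * ∫ z, (hit f l j z : ℝ) ∂D := by gcongr
    have h5 : (n : ℝ) * (15 / 16 * ∫ z, (weight f l z : ℝ) ∂D - 1 / 16) ≤
        n * ∫ z, (hit f l i z : ℝ) ∂D := by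
      rw [mul_sub]
      linarith [h2.1, h2.2, h3.1, h3.2]
    have h6 := le_of_mul_le_mul_left h5 hn'
    have h7 := one_le_integral_weight (D := D) hf l
    rw [hint, pow_succ]
    linarith

/-- If the majority is wrong, at least half of the `4 * κ` models are wrong, and each has doubled
the weight. -/
lemma two_pow_le_weight {l : List ℕ} {κ : ℕ} (hl : l.length = 4 * κ) {z : X × Bool}
    (h : decide (4 * κ < 2 * l.countP fun j => f j z.1) ≠ z.2) : 2 ^ (2 * κ) ≤ weight f l z := by
  refine Nat.pow_le_pow_right (by norm_num) ?_
  obtain ⟨x, y⟩ := z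
  have h1 := List.length_eq_countP_add_countP (fun j => f j x) (l := l)
  rw [hl] at h1
  cases y
  · have h2 : (l.countP fun j => f j x != false) = l.countP fun j => f j x := by
      congr 1; funext j; simp
    simp only [ne_eq, decide_eq_false_iff_not, not_not] at h
    rw [h2]; omega
  · have h2 : (l.countP fun j => f j x != true) = l.countP fun j => decide ¬ (f j x = true) := by
      congr 1; funext j; cases f j x <;> rfl
    simp only [ne_eq, decide_eq_true_eq] at h
    rw [h2]; omega

theorem err_majority_le (hf : ∀ j, Measurable (f j)) {l : List ℕ} {κ : ℕ} (hl : l.length = 4 * κ)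
    (hw : ∫ z, (weight f l z : ℝ) ∂D ≤ (9 / 8) ^ (4 * κ)) :
    err D (fun x => decide (4 * κ < 2 * l.countP fun j => f j x)) ≤
      ENNReal.ofReal ((1 / 2) ^ κ) := by
  have hmarkov := mul_meas_ge_le_integral_of_nonneg (μ := D)
    (ae_of_all _ fun z => (Nat.cast_nonneg (weight f l z) : (0 : ℝ) ≤ _)) (integrable_weight hf l)
    (2 ^ (2 * κ))
  have hsub : {z : X × Bool | decide (4 * κ < 2 * l.countP fun j => f j z.1) ≠ z.2} ⊆
      {z | (2 : ℝ) ^ (2 * κ) ≤ weight f l z} := fun z hz => by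
    exact_mod_cast two_pow_le_weight hl hz
  have h1 : D.real {z | (2 : ℝ) ^ (2 * κ) ≤ weight f l z} ≤ (1 / 2) ^ κ := by
    -- Numerically, `(9/8) ^ 4 < 2`.
    have h2 : (9 / 8 : ℝ) ^ (4 * κ) ≤ 2 ^ κ := by
      rw [pow_mul]; gcongr; norm_num
    have h3 : (2 : ℝ) ^ (2 * κ) * (1 / 2) ^ κ = 2 ^ κ := by
      rw [two_mul, pow_add, mul_assoc, ← mul_pow]; norm_num
    refine le_of_mul_le_mul_left ?_ (by positivity : (0 : ℝ) < 2 ^ (2 * κ))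
    rw [h3]
    exact hmarkov.trans (hw.trans h2)
  calc _ ≤ D {z | (2 : ℝ) ^ (2 * κ) ≤ weight f l z} := measure_mono hsub
    _ = ENNReal.ofReal (D.real {z | (2 : ℝ) ^ (2 * κ) ≤ weight f l z}) := by
      rw [ofReal_measureReal]
    _ ≤ _ := ENNReal.ofReal_le_ofReal h1

end Boosting

/-! ## A private learner finds good models without seeing the sample -/

section Privacy

variable {X R H : Type*} [MeasurableSpace X] [MeasurableSpace R] [MeasurableSpace H]
  {ν : Measure R} [IsProbabilityMeasure ν]

lemma IsPureDP.group {M : Type*} [MeasurableSpace M] {n : ℕ} {fit : (Fin n → X × Bool) → R → M}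
    {ε : ℝ} (h : IsPureDP ν fit ε) (S S' : Fin n → X × Bool) {E : Set M} (hE : MeasurableSet E) :
    ν {r | fit S r ∈ E} ≤ ENNReal.ofReal (Real.exp ε) ^ n * ν {r | fit S' r ∈ E} := by
  set c := ENNReal.ofReal (Real.exp ε)
  -- Hybrid argument: the first `k` examples have been replaced, and each replacement costs one
  -- factor `c`.
  have key : ∀ k ≤ n, ν {r | fit S r ∈ E} ≤
      c ^ k * ν {r | fit (fun i => if (i : ℕ) < k then S' i else S i) r ∈ E} := by
    intro k
    induction k with
    | zero => simp
    | succ k ih =>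
      intro hk
      refine (ih (by omega)).trans ?_
      rw [pow_succ, mul_assoc]
      refine mul_le_mul_right (h _ _ ⟨⟨k, hk⟩, fun j hj => ?_⟩ E hE) _
      have hj' : (j : ℕ) ≠ k := fun h => hj (Fin.ext h)
      have : (j : ℕ) < k + 1 ↔ (j : ℕ) < k := by omega
      simp only [this]
  have h1 := key n le_rfl
  have h2 : (fun i : Fin n => if (i : ℕ) < n then S' i else S i) = S' := by
    funext i; simp
  rwa [h2] at h1

variable {A : Learner X R H}

lemma measurableSet_err_le (D : Measure (X × Bool)) [IsProbabilityMeasure D] (a : ENNReal) :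
    MeasurableSet {h : H | err D (A.predict h) ≤ a} := by
  have hs : MeasurableSet {s : H × (X × Bool) | A.predict s.1 s.2.1 ≠ s.2.2} := by
    refine (measurableSet_eq_fun (f := fun s : H × (X × Bool) => A.predict s.1 s.2.1) ?_
      (by fun_prop)).compl
    exact A.measurable_predict.comp (by fun_prop : Measurable fun s : H × (X × Bool) => (s.1, s.2.1))
  exact measurableSet_le (measurable_measure_prodMk_left (ν := D) hs) measurable_const

/-- The learner succeeds with probability `1/2` on average over samples, hence on some sample `S`;
group privacy passes from `S` to the dummy data set. The learned distribution enters only through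
`S`, so the bound holds for every realizable `D`. -/
lemma le_measureReal_err_dummyModel {C : Set (X → Bool)}
    (hdp : IsPureDP ν (A.fit (1 / 16) (1 / 2) (1 / 2)) (1 / 2))
    (hpac : IsPAC ν C (fun S r => A.predict (A.fit (1 / 16) (1 / 2) (1 / 2) S r)) (1 / 16) (1 / 2))
    (x₀ : X) (D : Measure (X × Bool)) [IsProbabilityMeasure D] (hD : Realizable C D) :
    (1 / 2 : ℝ) ^ (dummySize A + 1) ≤
      ν.real {r | err D (A.predict (dummyModel A x₀ r)) ≤ ENNReal.ofReal (1 / 16)} := by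
  set m := dummySize A with hm
  set G : Set H := {h | err D (A.predict h) ≤ ENNReal.ofReal (1 / 16)} with hG
  have hGm : MeasurableSet G := measurableSet_err_le D _
  have h1 := hpac D inferInstance hD
  have hbad : MeasurableSet {s : (Fin (A.size (1 / 16) (1 / 2) (1 / 2)) → X × Bool) × R |
      A.fit (1 / 16) (1 / 2) (1 / 2) s.1 s.2 ∈ Gᶜ} := A.measurable_fit _ _ _ hGm.compl
  have h2 : {s : (Fin (A.size (1 / 16) (1 / 2) (1 / 2)) → X × Bool) × R | ENNReal.ofReal (1 / 16) <
      err D (A.predict (A.fit (1 / 16) (1 / 2) (1 / 2) s.1 s.2))} =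
      {s | A.fit (1 / 16) (1 / 2) (1 / 2) s.1 s.2 ∈ Gᶜ} := by
    ext s; simp only [hG, mem_compl_iff, mem_ofPred_eq, not_le]
  rw [h2, Measure.prod_apply hbad] at h1
  obtain ⟨S, hS⟩ := exists_le_lintegral
    (measurable_measure_prodMk_left (ν := ν) hbad).aemeasurable
    (μ := Measure.pi fun _ : Fin (A.size (1 / 16) (1 / 2) (1 / 2)) => D)
  have h3 : ν {r | A.fit (1 / 16) (1 / 2) (1 / 2) S r ∈ Gᶜ} ≤ ENNReal.ofReal (1 / 2) := hS.trans h1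
  have h4 : ν.real {r | A.fit (1 / 16) (1 / 2) (1 / 2) S r ∈ Gᶜ} ≤ 1 / 2 :=
    ENNReal.toReal_le_of_le_ofReal (by norm_num) h3
  have hfit : Measurable fun r => A.fit (1 / 16) (1 / 2) (1 / 2) S r :=
    (A.measurable_fit _ _ _).comp measurable_prodMk_left
  have h5 : 1 / 2 ≤ ν.real {r | A.fit (1 / 16) (1 / 2) (1 / 2) S r ∈ G} := by
    have : {r | A.fit (1 / 16) (1 / 2) (1 / 2) S r ∈ Gᶜ} =
        {r | A.fit (1 / 16) (1 / 2) (1 / 2) S r ∈ G}ᶜ := by ext r; simp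
    have hm' : MeasurableSet {r | A.fit (1 / 16) (1 / 2) (1 / 2) S r ∈ G} := hfit hGm
    rw [this, probReal_compl_eq_one_sub hm'] at h4
    linarith
  have h6 := hdp.group S (fun _ => (x₀, false)) hGm
  have h7 : ν.real {r | A.fit (1 / 16) (1 / 2) (1 / 2) S r ∈ G} ≤
      Real.exp (1 / 2) ^ m * ν.real {r | dummyModel A x₀ r ∈ G} := by
    have := ENNReal.toReal_mono (ENNReal.mul_ne_top (by finiteness) (measure_ne_top _ _)) h6
    rwa [ENNReal.toReal_mul, ENNReal.toReal_pow, ENNReal.toReal_ofReal (Real.exp_pos _).le] at this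
  have h8 : Real.exp (1 / 2) ≤ 2 := by
    have h : Real.exp (1 / 2) ^ 2 = Real.exp 1 := by rw [← Real.exp_nat_mul]; norm_num
    nlinarith [Real.exp_one_lt_d9, Real.exp_pos (1 / 2)]
  have h9 : 1 / 2 ≤ 2 ^ m * ν.real {r | dummyModel A x₀ r ∈ G} :=
    h5.trans (h7.trans (by gcongr))
  have h10 : (1 / 2 : ℝ) ^ m * 2 ^ m = 1 := by rw [← mul_pow]; norm_num
  calc (1 / 2 : ℝ) ^ (m + 1) = (1 / 2) ^ m * (1 / 2) := pow_succ _ _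
    _ ≤ (1 / 2) ^ m * (2 ^ m * ν.real {r | dummyModel A x₀ r ∈ G}) := by gcongr
    _ = _ := by rw [← mul_assoc, h10, one_mul]; rfl

end Privacy

/-! ## Reweighted distributions -/

section Reweight

variable {X R H : Type*} [MeasurableSpace X] [MeasurableSpace R] [MeasurableSpace H]

lemma measureReal_withDensity_natCast {Z : Type*} [MeasurableSpace Z] (D : Measure Z)
    {W : Z → ℕ} (hW : Measurable W) {s : Set Z} (hs : MeasurableSet s) :
    (D.withDensity fun z => (W z : ENNReal)).real s = ∫ z in s, (W z : ℝ) ∂D := by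
  rw [Measure.real, withDensity_apply _ hs, integral_eq_lintegral_of_nonneg_ae
    (ae_of_all _ fun z => Nat.cast_nonneg (W z))
    (measurable_natCast_comp hW).aestronglyMeasurable]
  simp

/-- `f` is right on at least `15/16` of the total weight. -/
def GoodFor (D : Measure (X × Bool)) (W : X × Bool → ℕ) (f : X → Bool) : Prop :=
  15 / 16 * ∫ z, (W z : ℝ) ∂D ≤ ∫ z, ((if f z.1 = z.2 then W z else 0 : ℕ) : ℝ) ∂D

/-- Take the normalized measure of density `W`. It is absolutely continuous with respect to `D`, so
a concept without error for `D` has none for it. -/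
lemma exists_reweighted {C : Set (X → Bool)} (D : Measure (X × Bool)) [IsProbabilityMeasure D]
    (hD : Realizable C D) {W : X × Bool → ℕ} (hW : Measurable W) (h1 : ∀ z, 1 ≤ W z) {B : ℕ}
    (hB : ∀ z, W z ≤ B) :
    ∃ D' : Measure (X × Bool), IsProbabilityMeasure D' ∧ Realizable C D' ∧
      ∀ f : X → Bool, Measurable f → err D' f ≤ ENNReal.ofReal (1 / 16) → GoodFor D W f := by
  set μ := D.withDensity fun z => (W z : ENNReal) with hμ
  have hint : Integrable (fun z => (W z : ℝ)) D := by
    refine Integrable.of_bound (measurable_natCast_comp hW).aestronglyMeasurable B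
      (ae_of_all _ fun z => ?_)
    rw [Real.norm_natCast]
    exact_mod_cast hB z
  have hfin : IsFiniteMeasure μ := by
    refine ⟨?_⟩
    rw [hμ, withDensity_apply _ MeasurableSet.univ]
    calc _ ≤ ∫⁻ _ in univ, (B : ENNReal) ∂D := lintegral_mono fun z => Nat.cast_le.2 (hB z)
      _ < ⊤ := by simp
  have htot : 1 ≤ μ.real univ := by
    rw [hμ, measureReal_withDensity_natCast D hW MeasurableSet.univ, setIntegral_univ]
    have := integral_mono (integrable_const (μ := D) (1 : ℝ)) hint
      fun z => Nat.one_le_cast.2 (h1 z)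
    simpa using this
  have hne : μ univ ≠ 0 := fun h => by
    rw [Measure.real, h] at htot
    norm_num at htot
  refine ⟨(μ univ)⁻¹ • μ, ⟨?_⟩, ?_, ?_⟩
  · simp [ENNReal.inv_mul_cancel hne (measure_ne_top μ univ)]
  · obtain ⟨c, hc, hc'⟩ := hD
    refine ⟨c, hc, ?_⟩
    have : μ {z | c z.1 ≠ z.2} = 0 := withDensity_absolutelyContinuous _ _ hc'
    simp [err, this]
  · intro f hf herr
    have hset : MeasurableSet {z : X × Bool | f z.1 = z.2} :=
      measurableSet_eq_fun (hf.comp measurable_fst) measurable_snd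
    have e1 : ∫ z, ((if f z.1 = z.2 then W z else 0 : ℕ) : ℝ) ∂D =
        μ.real {z | f z.1 = z.2} := by
      rw [hμ, measureReal_withDensity_natCast D hW hset, ← integral_indicator hset]
      congr 1
      funext z
      by_cases h : f z.1 = z.2 <;> simp [h]
    have e2 : ∫ z, (W z : ℝ) ∂D = μ.real univ := by
      rw [hμ, measureReal_withDensity_natCast D hW MeasurableSet.univ, setIntegral_univ]
    have e3 : μ.real {z | f z.1 ≠ z.2} ≤ 1 / 16 * μ.real univ := by
      have h2 : (μ univ)⁻¹ * μ {z | f z.1 ≠ z.2} ≤ ENNReal.ofReal (1 / 16) := herr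
      have h3 := ENNReal.toReal_le_of_le_ofReal (by norm_num) h2
      rw [ENNReal.toReal_mul, ENNReal.toReal_inv] at h3
      change (μ.real univ)⁻¹ * μ.real {z | f z.1 ≠ z.2} ≤ 1 / 16 at h3
      rwa [inv_mul_le_iff₀ (by linarith), mul_comm] at h3
    have e4 : μ.real {z | f z.1 = z.2} + μ.real {z | f z.1 ≠ z.2} = μ.real univ :=
      measureReal_add_measureReal_compl hset
    rw [GoodFor, e1, e2]
    linarith

end Reweight

/-! ## Good models for all histories -/

section GoodLists

/-- Use the first sequence on `U` and the second one elsewhere. -/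
def mix {R : Type*} (U : Finset ℕ) (s : (ℕ → R) × (ℕ → R)) : ℕ → R :=
  fun i => if i ∈ U then s.1 i else s.2 i

variable {X R H : Type*} [MeasurableSpace X] [MeasurableSpace R] [MeasurableSpace H]
  {ν : Measure R} [IsProbabilityMeasure ν]

lemma measurable_mix (U : Finset ℕ) : Measurable (mix (R := R) U) := by
  refine measurable_pi_lambda _ fun i => ?_
  by_cases hi : i ∈ U
  · simp only [mix, hi, if_true]; fun_prop
  · simp only [mix, hi, if_false]; fun_prop

/-- Resampling the seeds outside `U` does not change their joint law, as one checks on rectangles.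
-/
lemma map_mix (U : Finset ℕ) :
    ((Measure.infinitePi fun _ : ℕ => ν).prod (Measure.infinitePi fun _ : ℕ => ν)).map (mix U) =
      Measure.infinitePi fun _ : ℕ => ν := by
  refine Measure.eq_infinitePi (fun _ : ℕ => ν) fun s t ht => ?_
  rw [Measure.map_apply (measurable_mix U)
    (MeasurableSet.pi s.countable_toSet fun i _ => ht i)]
  have : mix U ⁻¹' (Set.pi s t) = (Set.pi (s.filter (· ∈ U) : Finset ℕ) t) ×ˢ
      (Set.pi (s.filter (· ∉ U) : Finset ℕ) t) := by
    ext w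
    simp only [mem_preimage, Set.mem_pi, mem_prod, mix, Finset.coe_filter, mem_ofPred_eq,
      Finset.mem_coe]
    constructor
    · exact fun h => ⟨fun i hi => by simpa [hi.2] using h i hi.1,
        fun i hi => by simpa [hi.2] using h i hi.1⟩
    · rintro ⟨h, h'⟩ i hi
      by_cases hiU : i ∈ U
      · simpa [hiU] using h i ⟨hi, hiU⟩
      · simpa [hiU] using h' i ⟨hi, hiU⟩
  rw [this, Measure.prod_prod, Measure.infinitePi_pi _ fun i _ => ht i,
    Measure.infinitePi_pi _ fun i _ => ht i]
  exact Finset.prod_filter_mul_prod_filter_not s (· ∈ U) fun i => ν (t i)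

variable {A : Learner X R H}

lemma measurable_rule (x₀ : X) (j : ℕ) :
    Measurable fun s : (ℕ → R) × X => rule A x₀ s.1 j s.2 := by
  refine A.measurable_predict.comp (Measurable.prodMk ?_ measurable_snd)
  exact (A.measurable_fit (1 / 16) (1 / 2) (1 / 2)).comp
    (by fun_prop : Measurable fun s : (ℕ → R) × X =>
      ((fun _ => (x₀, false) : Fin (A.size (1 / 16) (1 / 2) (1 / 2)) → X × Bool), s.1 j))

lemma measurable_rule' (x₀ : X) (w : ℕ → R) (j : ℕ) : Measurable (rule A x₀ w j) :=
  (measurable_rule x₀ j).comp measurable_prodMk_left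

lemma measurableSet_goodFor (x₀ : X) (D : Measure (X × Bool)) [IsProbabilityMeasure D]
    {W : X × Bool → ℕ} (hW : Measurable W) :
    MeasurableSet {r | GoodFor D W (A.predict (dummyModel A x₀ r))} := by
  refine measurableSet_le measurable_const ?_
  refine StronglyMeasurable.measurable (StronglyMeasurable.integral_prod_right
    (f := fun r z => ((if A.predict (dummyModel A x₀ r) z.1 = z.2 then W z else 0 : ℕ) : ℝ)) ?_)
  refine (measurable_natCast_comp (Measurable.ite ?_ (hW.comp measurable_snd)
    measurable_const)).stronglyMeasurable
  refine measurableSet_eq_fun (f := fun s : R × (X × Bool) =>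
    A.predict (dummyModel A x₀ s.1) s.2.1) ?_ (by fun_prop)
  refine A.measurable_predict.comp (Measurable.prodMk ?_ (by fun_prop))
  exact (A.measurable_fit (1 / 16) (1 / 2) (1 / 2)).comp
    (by fun_prop : Measurable fun s : R × (X × Bool) =>
      ((fun _ => (x₀, false) : Fin (A.size (1 / 16) (1 / 2) (1 / 2)) → X × Bool), s.1))

lemma measurableSet_hasGoodModel (x₀ : X) (D : Measure (X × Bool)) [IsProbabilityMeasure D]
    (N : ℕ) (l : List ℕ) : MeasurableSet {w : ℕ → R | HasGoodModel D (rule A x₀ w) N l} := by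
  have : {w : ℕ → R | HasGoodModel D (rule A x₀ w) N l} = ⋃ j ∈ Finset.range N,
      {w : ℕ → R | 15 / 16 * ∫ z, (weight (rule A x₀ w) l z : ℝ) ∂D ≤
        ∫ z, (hit (rule A x₀ w) l j z : ℝ) ∂D} := by
    ext w; simp [HasGoodModel]
  rw [this]
  refine Finset.measurableSet_biUnion _ fun j _ => measurableSet_le (measurable_const.mul ?_) ?_
  · exact StronglyMeasurable.measurable (StronglyMeasurable.integral_prod_right
      (f := fun w z => (weight (rule A x₀ w) l z : ℝ))
      (measurable_natCast_comp (measurable_weight (measurable_rule x₀) l)).stronglyMeasurable)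
  · exact StronglyMeasurable.measurable (StronglyMeasurable.integral_prod_right
      (f := fun w z => (hit (rule A x₀ w) l j z : ℝ))
      (measurable_natCast_comp (measurable_hit (measurable_rule x₀) l j)).stronglyMeasurable)

/-- The weights of a history depend on the models listed in it. Freeze the seeds of those models and
resample the rest: the weights become fixed, and each of the at least `N - l.length` other models is
good for them independently, with probability at least `(1/2) ^ (dummySize A + 1)`. -/
lemma measureReal_not_hasGoodModel_le {C : Set (X → Bool)}
    (hdp : IsPureDP ν (A.fit (1 / 16) (1 / 2) (1 / 2)) (1 / 2))
    (hpac : IsPAC ν C (fun S r => A.predict (A.fit (1 / 16) (1 / 2) (1 / 2) S r)) (1 / 16) (1 / 2))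
    (x₀ : X) (D : Measure (X × Bool)) [IsProbabilityMeasure D] (hD : Realizable C D) (N : ℕ)
    (l : List ℕ) :
    (Measure.infinitePi fun _ : ℕ => ν).real {w | ¬ HasGoodModel D (rule A x₀ w) N l} ≤
      (1 - (1 / 2) ^ (dummySize A + 1)) ^ (N - l.length) := by
  set μ := Measure.infinitePi fun _ : ℕ => ν with hμ
  set q : ℝ := (1 / 2) ^ (dummySize A + 1) with hq
  have hq1 : q ≤ 1 := pow_le_one₀ (by norm_num) (by norm_num)
  set E := {w | ¬ HasGoodModel D (rule A x₀ w) N l} with hE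
  have hEm : MeasurableSet E := (measurableSet_hasGoodModel x₀ D N l).compl
  set U := l.toFinset with hU
  set V := (Finset.range N).filter (· ∉ U) with hV
  have hcard : N - l.length ≤ V.card := by
    have h1 : ((Finset.range N).filter (· ∈ U)).card + V.card = (Finset.range N).card :=
      Finset.card_filter_add_card_filter_not _
    have h2 : ((Finset.range N).filter (· ∈ U)).card ≤ l.length :=
      (Finset.card_le_card (fun i hi => (Finset.mem_filter.1 hi).2)).trans (List.toFinset_card_le l)
    rw [Finset.card_range] at h1
    omega
  have hslice (w : ℕ → R) : μ (Prod.mk w ⁻¹' (mix U ⁻¹' E)) ≤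
      ENNReal.ofReal ((1 - q) ^ (N - l.length)) := by
    set W := weight (rule A x₀ w) l with hW
    have hWm : Measurable W := measurable_weight' (measurable_rule' x₀ w) l
    set G := {r | GoodFor D W (A.predict (dummyModel A x₀ r))} with hG
    have hGm : MeasurableSet G := measurableSet_goodFor x₀ D hWm
    have hνG : q ≤ ν.real G := by
      obtain ⟨D', hD', hreal, h⟩ := exists_reweighted D hD hWm
        (one_le_weight (rule A x₀ w) l) (weight_le (rule A x₀ w) l)
      refine (le_measureReal_err_dummyModel hdp hpac x₀ D' hreal).trans
        (measureReal_mono (fun r hr => h _ ?_ hr))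
      exact A.measurable_predict.comp measurable_prodMk_left
    have hsub : Prod.mk w ⁻¹' (mix U ⁻¹' E) ⊆ Set.pi V fun _ => Gᶜ := by
      intro w' hw' j hj hgood
      have hj' := Finset.mem_filter.1 (Finset.mem_coe.1 hj)
      refine hw' ⟨j, Finset.mem_range.1 hj'.1, ?_⟩
      have e1 : ∀ z, weight (rule A x₀ (mix U (w, w'))) l z = W z := by
        intro z
        rw [hW, weight, weight]
        congr 1
        refine List.countP_congr fun i hi => ?_
        have : i ∈ U := List.mem_toFinset.2 hi
        simp [rule, mix, this]
      have e2 : ∀ z, hit (rule A x₀ (mix U (w, w'))) l j z =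
          if A.predict (dummyModel A x₀ (w' j)) z.1 = z.2 then W z else 0 := by
        intro z
        rw [hit, e1]
        simp [rule, mix, hj'.2]
      simp only [e1, e2]
      exact hgood
    calc _ ≤ μ (Set.pi V fun _ => Gᶜ) := measure_mono hsub
      _ = ν Gᶜ ^ V.card := by
        rw [hμ, Measure.infinitePi_pi _ fun _ _ => hGm.compl]; simp
      _ = ENNReal.ofReal (ν.real Gᶜ ^ V.card) := by
        rw [ENNReal.ofReal_pow measureReal_nonneg, ofReal_measureReal]
      _ ≤ _ := by
        refine ENNReal.ofReal_le_ofReal ?_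
        rw [probReal_compl_eq_one_sub hGm]
        have h0 : ν.real G ≤ 1 := measureReal_le_one
        calc (1 - ν.real G) ^ V.card ≤ (1 - q) ^ V.card := by
              gcongr
          _ ≤ (1 - q) ^ (N - l.length) :=
              pow_le_pow_of_le_one (by linarith) (by linarith [hq, (by positivity : 0 ≤ q)]) hcard
  have h1 : μ E ≤ ENNReal.ofReal ((1 - q) ^ (N - l.length)) := by
    have h2 : μ E = (μ.prod μ) (mix U ⁻¹' E) := by
      rw [← Measure.map_apply (measurable_mix U) hEm, hμ, map_mix]
    rw [h2, Measure.prod_apply (measurable_mix U hEm)]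
    calc _ ≤ ∫⁻ _, ENNReal.ofReal ((1 - q) ^ (N - l.length)) ∂μ := lintegral_mono hslice
      _ = _ := by simp
  exact ENNReal.toReal_le_of_le_ofReal (pow_nonneg (by linarith) _) h1

/-- There are good models for all histories of length less than `T`. -/
def AllGood (D : Measure (X × Bool)) (f : ℕ → X → Bool) (N T : ℕ) : Prop :=
  ∀ t < T, ∀ l ∈ histories N t, HasGoodModel D f N l

lemma measurableSet_allGood (x₀ : X) (D : Measure (X × Bool)) [IsProbabilityMeasure D]
    (N T : ℕ) : MeasurableSet {w : ℕ → R | AllGood D (rule A x₀ w) N T} := by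
  have : {w : ℕ → R | AllGood D (rule A x₀ w) N T} = ⋂ t ∈ Finset.range T,
      ⋂ l ∈ histories N t, {w : ℕ → R | HasGoodModel D (rule A x₀ w) N l} := by
    ext w; simp [AllGood]
  rw [this]
  exact Finset.measurableSet_biInter _ fun t _ => Finset.measurableSet_biInter _ fun l _ =>
    measurableSet_hasGoodModel x₀ D N l

/-- The union bound over all histories is needed because the history that occurs depends on the
models themselves. -/
theorem measureReal_not_allGood_le {C : Set (X → Bool)}
    (hdp : IsPureDP ν (A.fit (1 / 16) (1 / 2) (1 / 2)) (1 / 2))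
    (hpac : IsPAC ν C (fun S r => A.predict (A.fit (1 / 16) (1 / 2) (1 / 2) S r)) (1 / 16) (1 / 2))
    (x₀ : X) (D : Measure (X × Bool)) [IsProbabilityMeasure D] (hD : Realizable C D) {N : ℕ}
    (hN : 0 < N) (T : ℕ) :
    (Measure.infinitePi fun _ : ℕ => ν).real {w | ¬ AllGood D (rule A x₀ w) N T} ≤
      T * N ^ T * (1 - (1 / 2) ^ (dummySize A + 1)) ^ (N - T) := by
  set μ := Measure.infinitePi fun _ : ℕ => ν with hμ
  set ε : ℝ := (1 - (1 / 2) ^ (dummySize A + 1)) ^ (N - T) with hε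
  have hq1 : ((1 : ℝ) / 2) ^ (dummySize A + 1) ≤ 1 := pow_le_one₀ (by norm_num) (by norm_num)
  have hq0 : (0 : ℝ) ≤ (1 / 2) ^ (dummySize A + 1) := by positivity
  have hε0 : 0 ≤ ε := pow_nonneg (by linarith) _
  have hsub : {w : ℕ → R | ¬ AllGood D (rule A x₀ w) N T} ⊆
      ⋃ t ∈ Finset.range T, ⋃ l ∈ histories N t, {w | ¬ HasGoodModel D (rule A x₀ w) N l} := by
    intro w hw
    change ¬ AllGood D (rule A x₀ w) N T at hw
    rw [AllGood] at hw
    push Not at hw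
    obtain ⟨t, ht, l, hl, h⟩ := hw
    simp only [mem_iUnion]
    exact ⟨t, Finset.mem_range.2 ht, l, hl, h⟩
  calc _ ≤ _ := measureReal_mono hsub (measure_ne_top _ _)
    _ ≤ ∑ t ∈ Finset.range T, ∑ l ∈ histories N t, ε := by
      refine (measureReal_biUnion_finset_le _ _).trans (Finset.sum_le_sum fun t ht => ?_)
      refine (measureReal_biUnion_finset_le _ _).trans (Finset.sum_le_sum fun l hl => ?_)
      refine (measureReal_not_hasGoodModel_le hdp hpac x₀ D hD N l).trans ?_
      refine pow_le_pow_of_le_one (by linarith) (by linarith) ?_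
      rw [(mem_histories.1 hl).1]
      have := Finset.mem_range.1 ht
      omega
    _ ≤ ∑ t ∈ Finset.range T, (N : ℝ) ^ T * ε := by
      refine Finset.sum_le_sum fun t ht => ?_
      rw [Finset.sum_const, nsmul_eq_mul]
      refine mul_le_mul_of_nonneg_right ?_ hε0
      have h2 : (histories N t).card ≤ N ^ T := (card_histories_le N t).trans
        (Nat.pow_le_pow_right hN (Finset.mem_range.1 ht).le)
      exact_mod_cast h2
    _ = _ := by simp [mul_assoc]

end GoodLists

/-! ## Numerical estimates

Throughout, `L = 2 ^ κ` is the scale, and there are `2 ^ (m + 1 + 3 κ)` models. -/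

section Numerics

variable {m κ : ℕ}

lemma scale_bounds (hL : m + 64 ≤ 2 ^ κ) : (64 : ℝ) ≤ 2 ^ κ ∧ (m : ℝ) ≤ 2 ^ κ ∧ (κ : ℝ) ≤ 2 ^ κ := by
  refine ⟨?_, ?_, ?_⟩
  · have : 64 ≤ 2 ^ κ := by omega
    exact_mod_cast this
  · have : m ≤ 2 ^ κ := by omega
    exact_mod_cast this
  · exact_mod_cast Nat.lt_two_pow_self.le

lemma two_pow_le_exp (k : ℕ) : (2 : ℝ) ^ k ≤ Real.exp k := by
  have h := Real.add_one_le_exp (1 : ℝ)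
  have h2 : (2 : ℝ) ≤ Real.exp 1 := by linarith
  calc (2 : ℝ) ^ k ≤ Real.exp 1 ^ k := by gcongr
    _ = _ := by rw [← Real.exp_nat_mul, mul_one]

lemma numModels_le_exp (hL : m + 64 ≤ 2 ^ κ) :
    ((2 ^ (m + 1 + 3 * κ) : ℕ) : ℝ) ≤ Real.exp (5 * 2 ^ κ) := by
  obtain ⟨h64, hm, hκ⟩ := scale_bounds hL
  push_cast
  refine (two_pow_le_exp _).trans (Real.exp_le_exp.2 ?_)
  push_cast
  linarith

lemma rounds_le_exp (hL : m + 64 ≤ 2 ^ κ) :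
    2 * ((4 * κ : ℕ) : ℝ) * ((2 ^ (m + 1 + 3 * κ) : ℕ) : ℝ) ^ (4 * κ) ≤
      Real.exp (21 * (2 ^ κ) ^ 2) := by
  obtain ⟨h64, hm, hκ⟩ := scale_bounds hL
  set L : ℝ := 2 ^ κ
  have h1 : ((2 ^ (m + 1 + 3 * κ) : ℕ) : ℝ) ^ (4 * κ) ≤ Real.exp (20 * L ^ 2) := by
    calc _ ≤ Real.exp (5 * L) ^ (4 * κ) := by gcongr; exact numModels_le_exp hL
      _ = Real.exp ((4 * κ : ℕ) * (5 * L)) := by rw [← Real.exp_nat_mul]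
      _ ≤ _ := by
        refine Real.exp_le_exp.2 ?_
        push_cast
        nlinarith
  have h2 : 2 * ((4 * κ : ℕ) : ℝ) ≤ Real.exp (L ^ 2) := by
    have := Real.add_one_le_exp (L ^ 2)
    push_cast
    nlinarith
  calc _ ≤ Real.exp (L ^ 2) * Real.exp (20 * L ^ 2) := by gcongr
    _ = _ := by rw [← Real.exp_add]; congr 1; ring

/-- With `L = 2 ^ κ`, Hoeffding's exponent is `2 * L ^ (36 - 24 - 8) = 2 * L ^ 4`, which beats the
`21 * L ^ 2` of the union bound. -/
lemma concentration_failure_le (hL : m + 64 ≤ 2 ^ κ) :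
    ((4 * κ : ℕ) : ℝ) * ((2 ^ (m + 1 + 3 * κ) : ℕ) : ℝ) ^ (4 * κ) *
      (2 * Real.exp (-(2 * ((2 ^ (18 * κ) : ℕ) : ℝ) ^ 2) /
        (((2 ^ (24 * κ) : ℕ) : ℝ) * (2 ^ (4 * κ)) ^ 2))) ≤ Real.exp (-2 ^ κ) := by
  obtain ⟨h64, hm, hκ⟩ := scale_bounds hL
  have h1 := rounds_le_exp hL
  have hexp : -(2 * ((2 ^ (18 * κ) : ℕ) : ℝ) ^ 2) /
      (((2 ^ (24 * κ) : ℕ) : ℝ) * (2 ^ (4 * κ)) ^ 2) = -(2 * (2 ^ κ) ^ 4) := by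
    push_cast
    simp only [mul_comm _ κ, pow_mul]
    have : (2 : ℝ) ^ κ ≠ 0 := by positivity
    field_simp
  rw [hexp]
  set L : ℝ := 2 ^ κ
  calc _ = (2 * ((4 * κ : ℕ) : ℝ) * ((2 ^ (m + 1 + 3 * κ) : ℕ) : ℝ) ^ (4 * κ)) *
        Real.exp (-(2 * L ^ 4)) := by ring
    _ ≤ Real.exp (21 * L ^ 2) * Real.exp (-(2 * L ^ 4)) := by gcongr
    _ = Real.exp (21 * L ^ 2 + -(2 * L ^ 4)) := by rw [Real.exp_add]
    _ ≤ _ := by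
      refine Real.exp_le_exp.2 ?_
      have h2 : 64 * 64 ≤ L ^ 2 := by nlinarith
      nlinarith [mul_nonneg (sq_nonneg L) (sub_nonneg.2 h2)]

lemma one_sub_pow_le_exp {x : ℝ} (hx : x ≤ 1) (k : ℕ) : (1 - x) ^ k ≤ Real.exp (-(k * x)) := by
  calc (1 - x) ^ k ≤ Real.exp (-x) ^ k := by
        gcongr
        linarith [Real.add_one_le_exp (-x)]
    _ = _ := by rw [← Real.exp_nat_mul]; congr 1; ring

/-- The expected number of good models is about `L ^ 3`, the factor `2 ^ (m + 1)` cancelling their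
rarity; this again beats `21 * L ^ 2`. -/
lemma allGood_failure_le (hL : m + 64 ≤ 2 ^ κ) :
    ((4 * κ : ℕ) : ℝ) * ((2 ^ (m + 1 + 3 * κ) : ℕ) : ℝ) ^ (4 * κ) *
      (1 - (1 / 2) ^ (m + 1)) ^ (2 ^ (m + 1 + 3 * κ) - 4 * κ) ≤ Real.exp (-2 ^ κ) := by
  obtain ⟨h64, hm, hκ⟩ := scale_bounds hL
  have h1 := rounds_le_exp hL
  have hq : ((1 : ℝ) / 2) ^ (m + 1) ≤ 1 := pow_le_one₀ (by norm_num) (by norm_num)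
  have hq0 : (0 : ℝ) ≤ (1 / 2) ^ (m + 1) := by positivity
  have h2 : ((2 : ℝ) ^ κ) ^ 3 - 4 * 2 ^ κ ≤
      ((2 ^ (m + 1 + 3 * κ) - 4 * κ : ℕ) : ℝ) * (1 / 2) ^ (m + 1) := by
    have h3 : ((2 ^ (m + 1 + 3 * κ) : ℕ) : ℝ) - (4 * κ : ℕ) ≤
        ((2 ^ (m + 1 + 3 * κ) - 4 * κ : ℕ) : ℝ) := by
      rw [sub_le_iff_le_add]
      have : 2 ^ (m + 1 + 3 * κ) ≤ (2 ^ (m + 1 + 3 * κ) - 4 * κ) + 4 * κ := by omega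
      exact_mod_cast this
    have h4 := mul_le_mul_of_nonneg_right h3 hq0
    refine le_trans ?_ h4
    rw [sub_mul]
    have h5 : ((2 ^ (m + 1 + 3 * κ) : ℕ) : ℝ) * (1 / 2) ^ (m + 1) = (2 ^ κ) ^ 3 := by
      push_cast
      rw [pow_add, mul_right_comm, ← mul_pow, ← pow_mul, mul_comm κ 3]
      norm_num
    have h6 : ((4 * κ : ℕ) : ℝ) * (1 / 2) ^ (m + 1) ≤ 4 * 2 ^ κ := by
      push_cast
      nlinarith [mul_le_mul_of_nonneg_left hq (by positivity : (0 : ℝ) ≤ 4 * κ)]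
    linarith
  set L : ℝ := 2 ^ κ
  have h0 : (0 : ℝ) ≤ ((4 * κ : ℕ) : ℝ) * ((2 ^ (m + 1 + 3 * κ) : ℕ) : ℝ) ^ (4 * κ) := by
    positivity
  calc _ ≤ Real.exp (21 * L ^ 2) * Real.exp (-(((2 ^ (m + 1 + 3 * κ) - 4 * κ : ℕ) : ℝ) *
        (1 / 2) ^ (m + 1))) := by
        refine mul_le_mul (by linarith) (one_sub_pow_le_exp hq _)
          (pow_nonneg (by linarith) _) (Real.exp_pos _).le
    _ = Real.exp (21 * L ^ 2 + -(((2 ^ (m + 1 + 3 * κ) - 4 * κ : ℕ) : ℝ) *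
        (1 / 2) ^ (m + 1))) := by rw [Real.exp_add]
    _ ≤ _ := by
      refine Real.exp_le_exp.2 ?_
      have h7 : 64 * L ^ 2 ≤ L ^ 3 := by nlinarith [sq_nonneg L]
      nlinarith

lemma exp_neg_scale_le {L : ℝ} (hL : 0 < L) : Real.exp (-L) ≤ 2 / L ^ 2 := by
  have h := Real.quadratic_le_exp_of_nonneg hL.le
  rw [Real.exp_neg, inv_eq_one_div, div_le_div_iff₀ (Real.exp_pos _) (by positivity)]
  nlinarith

/-- The window `4 * L ^ 18` times the success probability `L ^ (-21)` is `4 / L ^ 3` per round, over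
at most `4 * L` rounds. The cap is about `L ^ 2` mean noise lengths, so its term is about `exp (-L ^
2)` and absorbs the number of models, at most `exp (5 * L)`. -/
lemma instability_le (hL : m + 64 ≤ 2 ^ κ) :
    ((4 * κ : ℕ) : ℝ) * ((2 * (2 * 2 ^ (18 * κ)) : ℕ) * (1 / 2) ^ (21 * κ) +
      ((2 ^ (m + 1 + 3 * κ) : ℕ) : ℝ) *
        (1 - (1 / 2) ^ (21 * κ)) ^ (2 ^ (23 * κ) - 2 * (2 * 2 ^ (18 * κ)))) ≤
      16 / (2 ^ κ) ^ 2 + Real.exp (-2 ^ κ) := by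
  obtain ⟨h64, hm, hκ⟩ := scale_bounds hL
  have hN := numModels_le_exp hL
  have hq : ((1 : ℝ) / 2) ^ (21 * κ) ≤ 1 := pow_le_one₀ (by norm_num) (by norm_num)
  have hq0 : (0 : ℝ) ≤ (1 / 2) ^ (21 * κ) := by positivity
  have hpos : (0 : ℝ) < 2 ^ κ := by positivity
  have e1 : ((1 : ℝ) / 2) ^ (21 * κ) = 1 / (2 ^ κ) ^ 21 := by
    rw [one_div_pow, ← pow_mul, mul_comm]
  have h1 : ((2 * (2 * 2 ^ (18 * κ)) : ℕ) : ℝ) * (1 / 2) ^ (21 * κ) = 4 / (2 ^ κ) ^ 3 := by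
    rw [e1]
    push_cast
    rw [mul_comm 18 κ, pow_mul]
    field_simp
    norm_num
  have h2 : ((2 : ℝ) ^ κ) ^ 2 - 1 ≤
      ((2 ^ (23 * κ) - 2 * (2 * 2 ^ (18 * κ)) : ℕ) : ℝ) * (1 / 2) ^ (21 * κ) := by
    have h3 : ((2 ^ (23 * κ) : ℕ) : ℝ) - (2 * (2 * 2 ^ (18 * κ)) : ℕ) ≤
        ((2 ^ (23 * κ) - 2 * (2 * 2 ^ (18 * κ)) : ℕ) : ℝ) := by
      rw [sub_le_iff_le_add]
      have : 2 ^ (23 * κ) ≤ (2 ^ (23 * κ) - 2 * (2 * 2 ^ (18 * κ))) + 2 * (2 * 2 ^ (18 * κ)) := by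
        omega
      exact_mod_cast this
    refine le_trans ?_ (mul_le_mul_of_nonneg_right h3 hq0)
    rw [sub_mul, h1]
    have h5 : ((2 ^ (23 * κ) : ℕ) : ℝ) * (1 / 2) ^ (21 * κ) = (2 ^ κ) ^ 2 := by
      rw [e1]
      push_cast
      rw [mul_comm 23 κ, pow_mul]
      field_simp
    have h6 : 4 / ((2 : ℝ) ^ κ) ^ 3 ≤ 1 := by
      rw [div_le_one (by positivity)]
      have : (64 : ℝ) ^ 3 ≤ (2 ^ κ) ^ 3 := by gcongr
      linarith
    linarith
  rw [h1, mul_add]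
  have hpow := one_sub_pow_le_exp hq (2 ^ (23 * κ) - 2 * (2 * 2 ^ (18 * κ)))
  set L : ℝ := 2 ^ κ
  refine add_le_add ?_ ?_
  · rw [mul_div_assoc', div_le_div_iff₀ (by positivity) (by positivity)]
    push_cast
    nlinarith [pow_pos hpos 2, mul_le_mul_of_nonneg_right hκ (pow_pos hpos 2).le]
  · have h7 : ((4 * κ : ℕ) : ℝ) ≤ Real.exp (4 * L) := by
      have := Real.add_one_le_exp (4 * L)
      push_cast
      linarith
    calc _ ≤ Real.exp (4 * L) * (Real.exp (5 * L) * Real.exp (-(L ^ 2 - 1))) := by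
          refine mul_le_mul h7 ?_ ?_ (Real.exp_pos _).le
          · refine mul_le_mul hN (hpow.trans (Real.exp_le_exp.2 (by linarith)))
              (pow_nonneg (by linarith) _) (Real.exp_pos _).le
          · exact mul_nonneg (Nat.cast_nonneg _) (pow_nonneg (by linarith) _)
      _ = Real.exp (4 * L + (5 * L + -(L ^ 2 - 1))) := by rw [Real.exp_add, Real.exp_add]
      _ ≤ _ := Real.exp_le_exp.2 (by nlinarith)

lemma slack_le (hL : m + 64 ≤ 2 ^ κ) :
    2 * ((2 ^ (18 * κ) : ℕ) : ℝ) + ((2 ^ (23 * κ) : ℕ) : ℝ) ≤ ((2 ^ (24 * κ) : ℕ) : ℝ) / 16 := by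
  obtain ⟨h64, hm, hκ⟩ := scale_bounds hL
  push_cast
  rw [mul_comm 18, mul_comm 23, mul_comm 24, pow_mul, pow_mul, pow_mul]
  set L : ℝ := 2 ^ κ
  have h1 : L ^ 18 ≤ L ^ 23 := pow_le_pow_right₀ (by linarith) (by norm_num)
  have h2 : 64 * L ^ 23 ≤ L ^ 24 := by
    rw [pow_succ L 23, mul_comm]
    gcongr
  linarith [pow_pos (by linarith : 0 < L) 23]

end Numerics

/-! ## Replicability and accuracy of the learning program -/

section Guarantees

variable {X R H : Type*} [MeasurableSpace X] [MeasurableSpace R] [MeasurableSpace H]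

lemma prod_le_of_forall_fst {α β : Type*} [MeasurableSpace α] [MeasurableSpace β]
    (μ : Measure α) (ν : Measure β) [IsProbabilityMeasure μ] [IsProbabilityMeasure ν]
    {E : Set (α × β)} (hE : MeasurableSet E) {δ : ENNReal} (h : ∀ a, ν {b | (a, b) ∈ E} ≤ δ) :
    (μ.prod ν) E ≤ δ := by
  rw [Measure.prod_apply hE]
  calc _ ≤ ∫⁻ _, δ ∂μ := lintegral_mono h
    _ = δ := by simp

lemma prod_le_of_forall_snd {α β : Type*} [MeasurableSpace α] [MeasurableSpace β]
    (μ : Measure α) (ν : Measure β) [IsProbabilityMeasure μ] [IsProbabilityMeasure ν]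
    {E : Set (α × β)} (hE : MeasurableSet E) {δ : ENNReal} (h : ∀ b, μ {a | (a, b) ∈ E} ≤ δ) :
    (μ.prod ν) E ≤ δ := by
  rw [Measure.prod_apply_symm hE]
  calc _ ≤ ∫⁻ _, δ ∂ν := lintegral_mono h
    _ = δ := by simp

lemma measurable_apply_countable {α ι β : Type*} [MeasurableSpace α] [MeasurableSpace ι]
    [MeasurableSpace β] [Countable ι] [MeasurableSingletonClass ι] {h : α → ι} (hh : Measurable h)
    {G : ι → α → β} (hG : ∀ i, Measurable (G i)) : Measurable fun a => G (h a) a :=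
  (measurable_from_prod_countable_right (f := fun p : ι × α => G p.1 p.2) hG).comp
    (hh.prodMk measurable_id)

lemma measurable_pick {α : Type*} [MeasurableSpace α] {v : α → ℕ → ℕ}
    (hv : ∀ j, Measurable fun a => v a j) (N : ℕ) : Measurable fun a => pick (v a) N := by
  induction N with
  | zero => simp only [pick]; fun_prop
  | succ k ih =>
    simp only [pick]
    exact Measurable.ite (measurableSet_lt (measurable_apply_countable ih hv) (hv k))
      measurable_const ih

lemma measurableSet_chosen_eq {α : Type*} [MeasurableSpace α] {N : ℕ} {η : α → ℕ → ℕ → ℕ}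
    {g : α → List ℕ → ℕ → ℕ} (hη : ∀ t j, Measurable fun a => η a t j)
    (hg : ∀ l j, Measurable fun a => g a l j) (t : ℕ) (l : List ℕ) :
    MeasurableSet {a | chosen N (η a) (g a) t = l} := by
  -- Lists of numbers are countable, so the discrete structure may be used.
  let _ : MeasurableSpace (List ℕ) := ⊤
  have key : ∀ t, Measurable fun a => chosen N (η a) (g a) t := by
    intro t
    induction t with
    | zero => simp only [chosen]; fun_prop
    | succ t ih =>
      simp only [chosen]
      refine measurable_apply_countable (G := fun l a => l ++ [pick (fun j => η a t j + g a l j) N])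
        ih fun l => ?_
      exact (measurable_of_countable fun i : ℕ => l ++ [i]).comp
        (measurable_pick (fun j => (hη t j).add (hg l j)) N)
  exact measurableSet_eq_fun (key t) measurable_const

variable {A : Learner X R H}

lemma measurable_roundNoise (κ t j : ℕ) : Measurable fun c => roundNoise A κ c t j :=
  measurable_of_dependsOn
    (dependsOn_gridNoise (N := numModels A κ) (cap := 2 ^ (23 * κ)) (σ := 21 * κ) t j)

lemma measurableSet_learned_eq {α : Type*} [MeasurableSpace α] (x₀ : X) (κ : ℕ)
    {S : α → Fin (2 ^ (24 * κ)) → X × Bool} (hS : Measurable S) {ω : α → Seed R}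
    (hω : Measurable ω) (l : List ℕ) : MeasurableSet {a | learned A x₀ κ (S a) (ω a) = l} := by
  refine measurableSet_chosen_eq (fun t j => ?_) (fun l j => ?_) _ _
  · exact (measurable_roundNoise κ t j).comp (measurable_fst.comp hω)
  · exact (measurable_gain (measurable_rule x₀) l j).comp (hS.prodMk (measurable_snd.comp hω))

instance (ν : Measure R) [IsProbabilityMeasure ν] : IsProbabilityMeasure (seedLaw ν) := by
  unfold seedLaw; infer_instance

variable {ν : Measure R} [IsProbabilityMeasure ν]

lemma measure_not_concentrated_le {κ : ℕ} (hL : dummySize A + 64 ≤ 2 ^ κ) (x₀ : X)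
    (D : Measure (X × Bool)) [IsProbabilityMeasure D] (w : ℕ → R) :
    (Measure.pi fun _ : Fin (2 ^ (24 * κ)) => D)
      {S | ¬ Concentrated D (rule A x₀ w) (numModels A κ) (4 * κ) ((2 ^ (18 * κ) : ℕ) : ℝ) S} ≤
      ENNReal.ofReal (Real.exp (-2 ^ κ)) := by
  rw [← ofReal_measureReal]
  exact ENNReal.ofReal_le_ofReal ((measureReal_not_concentrated_le D (measurable_rule' x₀ w)
    (numModels A κ) (4 * κ) (2 ^ (24 * κ)) (Nat.cast_nonneg _)).trans (concentration_failure_le hL))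

/-- Both runs boost the same models. Either one of the samples is not concentrated, or the gains are
close and the runs can part only in an unstable round. No realizability is involved. -/
theorem isReplicable_learnedModel {κ : ℕ} (hL : dummySize A + 64 ≤ 2 ^ κ) (x₀ : X) {ρ : ℝ}
    (hρ : (1 / 2) ^ κ ≤ ρ) : IsReplicable (seedLaw ν) (learnedModel A x₀ κ) ρ := by
  intro D _
  set n := 2 ^ (24 * κ)
  set π := Measure.pi fun _ : Fin n => D with hπ
  set N := numModels A κ
  let Good : (Fin n → X × Bool) → (ℕ → R) → Prop := fun S w =>
    Concentrated D (rule A x₀ w) N (4 * κ) ((2 ^ (18 * κ) : ℕ) : ℝ) S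
  have hgood : MeasurableSet {s : (Fin n → X × Bool) × (ℕ → R) | Good s.1 s.2} :=
    measurableSet_concentrated (measurable_rule x₀) D N (4 * κ) _ n
  let E₁ : Set (((Fin n → X × Bool) × (Fin n → X × Bool)) × Seed R) :=
    {s | ¬ Good s.1.1 s.2.2}
  let E₂ : Set (((Fin n → X × Bool) × (Fin n → X × Bool)) × Seed R) :=
    {s | ¬ Good s.1.2 s.2.2}
  let E₃ : Set (((Fin n → X × Bool) × (Fin n → X × Bool)) × Seed R) :=
    {s | (Good s.1.1 s.2.2 ∧ Good s.1.2 s.2.2) ∧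
      learned A x₀ κ s.1.1 s.2 ≠ learned A x₀ κ s.1.2 s.2}
  have m₁ : MeasurableSet E₁ := (hgood.preimage (by fun_prop :
    Measurable fun s : ((Fin n → X × Bool) × (Fin n → X × Bool)) × Seed R =>
      (s.1.1, s.2.2))).compl
  have m₂ : MeasurableSet E₂ := (hgood.preimage (by fun_prop :
    Measurable fun s : ((Fin n → X × Bool) × (Fin n → X × Bool)) × Seed R =>
      (s.1.2, s.2.2))).compl
  have m₃ : MeasurableSet E₃ := by
    have h : MeasurableSet {s : ((Fin n → X × Bool) × (Fin n → X × Bool)) × Seed R |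
        learned A x₀ κ s.1.1 s.2 = learned A x₀ κ s.1.2 s.2} := by
      have : {s : ((Fin n → X × Bool) × (Fin n → X × Bool)) × Seed R |
          learned A x₀ κ s.1.1 s.2 = learned A x₀ κ s.1.2 s.2} =
          ⋃ l, ({s | learned A x₀ κ s.1.1 s.2 = l} ∩ {s | learned A x₀ κ s.1.2 s.2 = l}) := by
        ext s; simp [eq_comm]
      rw [this]
      exact MeasurableSet.iUnion fun l =>
        (measurableSet_learned_eq x₀ κ (by fun_prop) (by fun_prop) l).inter
          (measurableSet_learned_eq x₀ κ (by fun_prop) (by fun_prop) l)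
    have h' : E₃ = (E₁ᶜ ∩ E₂ᶜ) ∩ {s | learned A x₀ κ s.1.1 s.2 = learned A x₀ κ s.1.2 s.2}ᶜ := by
      ext s; simp [E₁, E₂, E₃]
    rw [h']
    exact (m₁.compl.inter m₂.compl).inter h.compl
  have hsub : {s : ((Fin n → X × Bool) × (Fin n → X × Bool)) × Seed R |
      learnedModel A x₀ κ s.1.1 s.2 ≠ learnedModel A x₀ κ s.1.2 s.2} ⊆ E₁ ∪ E₂ ∪ E₃ := by
    intro s hs
    by_cases h1 : Good s.1.1 s.2.2
    · by_cases h2 : Good s.1.2 s.2.2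
      · refine Or.inr ⟨⟨h1, h2⟩, fun h => hs ?_⟩
        simp only [learnedModel, h]
      · exact Or.inl (Or.inr h2)
    · exact Or.inl (Or.inl h1)
  have b₁ : ((π.prod π).prod (seedLaw ν)) E₁ ≤ ENNReal.ofReal (Real.exp (-2 ^ κ)) := by
    refine prod_le_of_forall_snd _ _ m₁ fun ω => ?_
    refine prod_le_of_forall_snd _ _ (m₁.preimage (by fun_prop : Measurable fun p :
      (Fin n → X × Bool) × (Fin n → X × Bool) => (p, ω))) fun S' => ?_
    exact measure_not_concentrated_le hL x₀ D ω.2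
  have b₂ : ((π.prod π).prod (seedLaw ν)) E₂ ≤ ENNReal.ofReal (Real.exp (-2 ^ κ)) := by
    refine prod_le_of_forall_snd _ _ m₂ fun ω => ?_
    refine prod_le_of_forall_fst _ _ (m₂.preimage (by fun_prop : Measurable fun p :
      (Fin n → X × Bool) × (Fin n → X × Bool) => (p, ω))) fun S' => ?_
    exact measure_not_concentrated_le hL x₀ D ω.2
  have b₃ : ((π.prod π).prod (seedLaw ν)) E₃ ≤
      ENNReal.ofReal (16 / (2 ^ κ) ^ 2 + Real.exp (-2 ^ κ)) := by
    refine prod_le_of_forall_fst _ _ m₃ fun p => ?_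
    refine prod_le_of_forall_snd coinLaw _ (m₃.preimage (by fun_prop : Measurable fun ω :
      Seed R => (p, ω))) fun w => ?_
    by_cases hp : Good p.1 w ∧ Good p.2 w
    -- Each gain is within `2 ^ (18 * κ)` of the same expectation, hence twice that between the
    -- samples.
    · have hclose : ∀ S S' : Fin n → X × Bool, Good S w → Good S' w → ∀ t < 4 * κ,
          ∀ l ∈ histories N t, ∀ j < N,
          gain (rule A x₀ w) S l j ≤ gain (rule A x₀ w) S' l j + 2 * 2 ^ (18 * κ) := by
        intro S S' hS hS' t ht l hl j hj
        have h1 := abs_le.1 (hS t ht l hl j hj)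
        have h2 := abs_le.1 (hS' t ht l hl j hj)
        have h3 : (gain (rule A x₀ w) S l j : ℝ) ≤
            gain (rule A x₀ w) S' l j + 2 * ((2 ^ (18 * κ) : ℕ) : ℝ) := by
          linarith [h1.2, h2.1]
        exact_mod_cast h3
      have h := measureReal_chosen_ne_le (cap := 2 ^ (23 * κ)) (σ := 21 * κ)
        (numModels_pos (A := A) κ) (hclose p.1 p.2 hp.1 hp.2) (hclose p.2 p.1 hp.2 hp.1)
      have h' := h.trans (instability_le hL)
      refine le_trans (measure_mono fun c hc => ?_)
        ((ofReal_measureReal (μ := coinLaw)).ge.trans (ENNReal.ofReal_le_ofReal h'))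
      exact hc.2
    · refine le_trans (measure_mono (t := ∅) fun c hc => hp hc.1) (by simp)
  have hpos : (0 : ℝ) < 2 ^ κ := by positivity
  calc _ ≤ ((π.prod π).prod (seedLaw ν)) (E₁ ∪ E₂ ∪ E₃) := measure_mono hsub
    _ ≤ ENNReal.ofReal (Real.exp (-2 ^ κ)) + ENNReal.ofReal (Real.exp (-2 ^ κ)) +
        ENNReal.ofReal (16 / (2 ^ κ) ^ 2 + Real.exp (-2 ^ κ)) :=
      (measure_union_le _ _).trans (add_le_add ((measure_union_le _ _).trans
        (add_le_add b₁ b₂)) b₃)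
    _ = ENNReal.ofReal (Real.exp (-2 ^ κ) + Real.exp (-2 ^ κ) +
        (16 / (2 ^ κ) ^ 2 + Real.exp (-2 ^ κ))) := by
      rw [← ENNReal.ofReal_add (by positivity) (by positivity),
        ← ENNReal.ofReal_add (by positivity) (by positivity)]
    _ ≤ ENNReal.ofReal ρ := by
      refine ENNReal.ofReal_le_ofReal (le_trans ?_ hρ)
      have h1 := exp_neg_scale_le hpos
      have h64 := (scale_bounds hL).1
      -- Three terms `exp (-L) ≤ 2 / L ^ 2` and the `16 / L ^ 2` of instability add up to `22 / L ^
      -- 2`, at most `1 / L` as `L ≥ 64`.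
      have h2 : (22 : ℝ) / (2 ^ κ) ^ 2 ≤ (1 / 2) ^ κ := by
        rw [one_div_pow, div_le_div_iff₀ (by positivity) hpos]
        nlinarith
      have h3 : (22 : ℝ) / (2 ^ κ) ^ 2 = 3 * (2 / (2 ^ κ) ^ 2) + 16 / (2 ^ κ) ^ 2 := by ring
      linarith

/-- The noise never exceeds its cap, so the coins play no role: failure needs a sample that is not
concentrated or a list without a good model for some history. -/
theorem isPAC_learnedModel {C : Set (X → Bool)}
    (hdp : IsPureDP ν (A.fit (1 / 16) (1 / 2) (1 / 2)) (1 / 2))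
    (hpac : IsPAC ν C (fun S r => A.predict (A.fit (1 / 16) (1 / 2) (1 / 2) S r)) (1 / 16) (1 / 2))
    {κ : ℕ} (hL : dummySize A + 64 ≤ 2 ^ κ) (x₀ : X) {α β : ℝ} (hα : (1 / 2) ^ κ ≤ α)
    (hβ : 2 * Real.exp (-2 ^ κ) ≤ β) :
    IsPAC (seedLaw ν) C (fun S ω => majorityHyp A (learnedModel A x₀ κ S ω)) α β := by
  intro D _ hD
  set n := 2 ^ (24 * κ)
  set π := Measure.pi fun _ : Fin n => D with hπ
  set N := numModels A κ with hN
  let E₁ : Set ((Fin n → X × Bool) × Seed R) :=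
    {s | ¬ Concentrated D (rule A x₀ s.2.2) N (4 * κ) ((2 ^ (18 * κ) : ℕ) : ℝ) s.1}
  let E₂ : Set ((Fin n → X × Bool) × Seed R) := {s | ¬ AllGood D (rule A x₀ s.2.2) N (4 * κ)}
  have m₁ : MeasurableSet E₁ := ((measurableSet_concentrated (measurable_rule x₀) D N (4 * κ) _
    n).preimage (by fun_prop : Measurable fun s : (Fin n → X × Bool) × Seed R =>
      (s.1, s.2.2))).compl
  have m₂ : MeasurableSet E₂ := ((measurableSet_allGood x₀ D N (4 * κ)).preimage
    (by fun_prop : Measurable fun s : (Fin n → X × Bool) × Seed R => s.2.2)).compl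
  have hsub : {s : (Fin n → X × Bool) × Seed R | ENNReal.ofReal α <
      err D (majorityHyp A (learnedModel A x₀ κ s.1 s.2))} ⊆ E₁ ∪ E₂ := by
    intro s hs
    by_contra hcon
    have h1 : Concentrated D (rule A x₀ s.2.2) N (4 * κ) ((2 ^ (18 * κ) : ℕ) : ℝ) s.1 := by
      by_contra h; exact hcon (Or.inl h)
    have h2 : AllGood D (rule A x₀ s.2.2) N (4 * κ) := by
      by_contra h; exact hcon (Or.inr h)
    have hw := integral_weight_chosen_le (measurable_rule' x₀ s.2.2) (cap := 2 ^ (23 * κ))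
      (numModels_pos κ) h1 h2 (η := roundNoise A κ s.2.1) (fun t j => noise_le _ _ _ _)
      (by positivity) (slack_le hL) (4 * κ) le_rfl
    have herr := err_majority_le (measurable_rule' x₀ s.2.2) (by simp) hw
    refine absurd (herr.trans (ENNReal.ofReal_le_ofReal hα)) (not_le.2 (lt_of_lt_of_eq hs ?_))
    congr 1
    funext x
    exact majorityHyp_learnedModel x₀ κ s.1 s.2 x
  have b₁ : (π.prod (seedLaw ν)) E₁ ≤ ENNReal.ofReal (Real.exp (-2 ^ κ)) :=
    prod_le_of_forall_snd _ _ m₁ fun ω => measure_not_concentrated_le hL x₀ D ω.2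
  have b₂ : (π.prod (seedLaw ν)) E₂ ≤ ENNReal.ofReal (Real.exp (-2 ^ κ)) := by
    refine prod_le_of_forall_fst _ _ m₂ fun S => ?_
    refine prod_le_of_forall_fst coinLaw _ (m₂.preimage (by fun_prop : Measurable fun ω :
      Seed R => (S, ω))) fun c => ?_
    change (Measure.infinitePi fun _ : ℕ => ν) {w | ¬ AllGood D (rule A x₀ w) N (4 * κ)} ≤ _
    rw [← ofReal_measureReal]
    exact ENNReal.ofReal_le_ofReal ((measureReal_not_allGood_le hdp hpac x₀ D hD
      (numModels_pos κ) (4 * κ)).trans (allGood_failure_le hL))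
  calc _ ≤ (π.prod (seedLaw ν)) (E₁ ∪ E₂) := measure_mono hsub
    _ ≤ ENNReal.ofReal (Real.exp (-2 ^ κ)) + ENNReal.ofReal (Real.exp (-2 ^ κ)) :=
      (measure_union_le _ _).trans (add_le_add b₁ b₂)
    _ = ENNReal.ofReal (2 * Real.exp (-2 ^ κ)) := by
      rw [← ENNReal.ofReal_add (by positivity) (by positivity), two_mul]
    _ ≤ _ := ENNReal.ofReal_le_ofReal hβ

end Guarantees

/-! ## Polynomial bounds -/

section Polynomials

lemma aeval_eq_sum {n : ℕ} (p : MvPolynomial (Fin n) ℕ) (x : Fin n → ℝ) :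
    MvPolynomial.aeval x p = ∑ d ∈ p.support, ((p.coeff d : ℕ) : ℝ) * ∏ i, x i ^ d i := by
  rw [MvPolynomial.aeval_def, MvPolynomial.eval₂_eq']
  rfl

lemma aeval_mono {n : ℕ} (p : MvPolynomial (Fin n) ℕ) {x y : Fin n → ℝ} (hx : ∀ i, 0 ≤ x i)
    (hxy : ∀ i, x i ≤ y i) : MvPolynomial.aeval x p ≤ MvPolynomial.aeval y p := by
  rw [aeval_eq_sum, aeval_eq_sum]
  refine Finset.sum_le_sum fun d _ => mul_le_mul_of_nonneg_left ?_ (Nat.cast_nonneg _)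
  exact Finset.prod_le_prod (fun i _ => pow_nonneg (hx i) _)
    fun i _ => pow_le_pow_left₀ (hx i) (hxy i) _

lemma pow_le_one_add_pow {x : ℝ} (hx : 0 ≤ x) {i k : ℕ} (hik : i ≤ k) : x ^ i ≤ 1 + x ^ k := by
  rcases le_total x 1 with h | h
  · linarith [pow_le_one₀ (n := i) hx h, pow_nonneg hx k]
  · linarith [pow_le_pow_right₀ h hik]

/-- Every power of `x` that occurs is at most `1 + x ^ k`, and what remains is the value at `x = 1`.
-/
lemma aeval_le_mul_one_add_pow (p : MvPolynomial (Fin 4) ℕ) (a b c : ℕ) {x : ℝ} (hx : 0 ≤ x) :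
    MvPolynomial.aeval ![(a : ℝ), b, c, x] p ≤
      (MvPolynomial.eval ![a, b, c, 1] p : ℕ) * (1 + x ^ p.degreeOf 3) := by
  rw [aeval_eq_sum, MvPolynomial.eval_eq', Nat.cast_sum, Finset.sum_mul]
  refine Finset.sum_le_sum fun d hd => ?_
  have h := pow_le_one_add_pow hx (MvPolynomial.monomial_le_degreeOf 3 hd)
  simp only [Fin.prod_univ_four, Nat.cast_mul, Nat.cast_pow, Matrix.cons_val, one_pow, mul_one]
  rw [mul_assoc ((p.coeff d : ℕ) : ℝ)]
  gcongr

lemma eval_add_one_le (q : Polynomial ℕ) (m : ℕ) :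
    q.eval m + 1 ≤ (q.eval 1 + 1) * (m + 1) ^ q.natDegree := by
  have h1 : 1 ≤ (m + 1) ^ q.natDegree := Nat.one_le_pow _ _ (by omega)
  have h2 : q.eval m ≤ q.eval 1 * (m + 1) ^ q.natDegree := by
    rw [Polynomial.eval_eq_sum_range, Polynomial.eval_eq_sum_range, Finset.sum_mul]
    refine Finset.sum_le_sum fun i hi => ?_
    rw [one_pow, mul_one]
    have : m ^ i ≤ (m + 1) ^ q.natDegree :=
      (Nat.pow_le_pow_left (by omega) i).trans
        (Nat.pow_le_pow_right (by omega) (by simpa [Nat.lt_succ_iff] using hi))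
    gcongr
  nlinarith

end Polynomials

/-! ## Running times -/

section RunningTime

/-- The exponent is `29 = 1 + 3 + 24 + 1`: rounds, models, examples, and votes per example. The
summand `39 + 4 * κ` is the length of the output. -/
lemma learnTime_le (m κ v : ℕ) : learnTime m κ v v + (39 + 4 * κ) ≤
    2000 * (2 ^ κ) ^ 29 * (2 ^ m * (m + 1) * (v + 1)) := by
  have hκ : κ ≤ 2 ^ κ := Nat.lt_two_pow_self.le
  have hL : 1 ≤ 2 ^ κ := Nat.one_le_two_pow
  have hM : 1 ≤ 2 ^ m := Nat.one_le_two_pow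
  have e3 : 2 ^ (m + 1 + 3 * κ) = 2 * 2 ^ m * (2 ^ κ) ^ 3 := by
    rw [pow_add, pow_succ, mul_comm 3, pow_mul]; ring
  have e23 : 2 ^ (23 * κ) = (2 ^ κ) ^ 23 := by rw [mul_comm, pow_mul]
  have e24 : 2 ^ (24 * κ) = (2 ^ κ) ^ 24 := by rw [mul_comm, pow_mul]
  rw [learnTime, e3, e23, e24]
  generalize 2 ^ κ = L at *
  generalize 2 ^ m = M at *
  have hp : ∀ i, i ≤ 29 → L ^ i ≤ L ^ 29 := fun i hi => Nat.pow_le_pow_right hL hi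
  have hp0 : 1 ≤ L ^ 29 := Nat.one_le_pow _ _ hL
  have hκ' : κ ≤ L ^ 29 := by simpa using hκ.trans (by simpa using hp 1 (by norm_num))
  set W := M * (m + 1) * (v + 1) with hW
  have hm1 : (m + 1) * (v + 1) ≤ W := by rw [hW, mul_assoc]; exact Nat.le_mul_of_pos_left _ hM
  have hmW : m + 1 ≤ W := le_trans (Nat.le_mul_of_pos_right _ (by omega)) hm1
  have hMv : M * (v + 1) ≤ W := by
    rw [hW]; exact Nat.mul_le_mul_right _ (Nat.le_mul_of_pos_right _ (by omega))
  have hW1 : 1 ≤ W := by omega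
  have hLW : L ^ 29 ≤ L ^ 29 * W := Nat.le_mul_of_pos_right _ hW1
  have hWL : W ≤ L ^ 29 * W := Nat.le_mul_of_pos_left _ hp0
  have t1 : 100 + 200 * κ + 3 * m ≤ 303 * (L ^ 29 * W) := by omega
  have t2 : 2 * M * L ^ 3 * (3 + 2 * m + v) ≤ 6 * (L ^ 29 * W) := by
    calc 2 * M * L ^ 3 * (3 + 2 * m + v) ≤ 2 * M * L ^ 29 * (3 * ((m + 1) * (v + 1))) := by
          gcongr
          · norm_num
          · nlinarith [Nat.zero_le (m * v)]
      _ = _ := by rw [hW]; ring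
  have t3 : 4 * κ * (11 + 2 * M * L ^ 3 * (17 + L ^ 23 * (9 + 21 * κ * 4) +
      L ^ 24 * (13 + v + 4 * κ * (10 + v)))) ≤ 1400 * (L ^ 29 * W) := by
    have s1 : 17 + L ^ 23 * (9 + 21 * κ * 4) + L ^ 24 * (13 + v + 4 * κ * (10 + v)) ≤
        163 * (L ^ 25 * (v + 1)) := by
      have u1 : 9 + 21 * κ * 4 ≤ 93 * L := by omega
      have u2 : 13 + v + 4 * κ * (10 + v) ≤ 53 * (L * (v + 1)) := by
        have : κ * (10 + v) ≤ L * (10 * (v + 1)) := Nat.mul_le_mul hκ (by omega)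
        have : v + 1 ≤ L * (v + 1) := Nat.le_mul_of_pos_left _ hL
        linarith
      have u3 : L ^ 24 ≤ L ^ 25 := Nat.pow_le_pow_right hL (by norm_num)
      have u4 : 1 ≤ L ^ 25 * (v + 1) := Nat.mul_pos (Nat.pow_pos hL) (by omega)
      have u5 : L ^ 23 * (9 + 21 * κ * 4) ≤ 93 * (L ^ 25 * (v + 1)) := by
        calc _ ≤ L ^ 23 * (93 * L) := by gcongr
          _ = 93 * (L ^ 24 * 1) := by ring
          _ ≤ _ := by gcongr; omega
      have u6 : L ^ 24 * (13 + v + 4 * κ * (10 + v)) ≤ 53 * (L ^ 25 * (v + 1)) := by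
        calc _ ≤ L ^ 24 * (53 * (L * (v + 1))) := by gcongr
          _ = _ := by ring
      omega
    calc _ ≤ 4 * L * (11 + 2 * M * L ^ 3 * (163 * (L ^ 25 * (v + 1)))) := by gcongr
      _ = 44 * L + 1304 * (L ^ 29 * (M * (v + 1))) := by ring
      _ ≤ 44 * L ^ 29 + 1304 * (L ^ 29 * W) := by
        gcongr
        simpa using hp 1 (by norm_num)
      _ ≤ _ := by omega
  have hgoal : 2000 * L ^ 29 * W = 2000 * (L ^ 29 * W) := by ring
  omega

lemma predictTime_le (m κ v : ℕ) : 7 + 4 * κ * (6 + v) ≤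
    2000 * (2 ^ κ) ^ 29 * (2 ^ m * (m + 1) * (v + 1)) := by
  refine le_trans ?_ (learnTime_le m κ v)
  have h1 : 1 ≤ 2 ^ (m + 1 + 3 * κ) := Nat.one_le_two_pow
  have h2 : 1 ≤ 2 ^ (24 * κ) := Nat.one_le_two_pow
  have h3 : 6 + v ≤ 11 + 2 ^ (m + 1 + 3 * κ) * (17 + 2 ^ (23 * κ) * (9 + 21 * κ * 4) +
      2 ^ (24 * κ) * (13 + v + 4 * κ * (10 + v))) := by
    have h4 : 13 + v + 4 * κ * (10 + v) ≤ 2 ^ (24 * κ) * (13 + v + 4 * κ * (10 + v)) :=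
      Nat.le_mul_of_pos_left _ h2
    have h5 := Nat.le_mul_of_pos_left (17 + 2 ^ (23 * κ) * (9 + 21 * κ * 4) +
      2 ^ (24 * κ) * (13 + v + 4 * κ * (10 + v))) h1
    omega
  have h4 := Nat.mul_le_mul_left (4 * κ) h3
  rw [learnTime]
  omega

/-- A time bound `2000 L ^ 29 · 2 ^ m (m + 1) (q(m) + 1)`, for `L ≤ 2 s (m + 1)`, is polynomial in
`s` and exponential in `m`. -/
lemma time_le_poly_mul_exp (q : Polynomial ℕ) {m L c : ℕ} {s z : ℝ} (hz : 0 ≤ z)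
    (hL : (L : ℝ) ≤ 2 * s * (m + 1)) (hm : (m : ℝ) ≤ c * (1 + z)) :
    ((2000 * L ^ 29 * (2 ^ m * (m + 1) * (q.eval m + 1)) : ℕ) : ℝ) ≤
      2000 * (2 * s) ^ 29 *
        Real.exp ((q.eval 1 + (31 + q.natDegree) * c : ℕ) * (1 + z)) := by
  set d := q.natDegree
  have hq : ((q.eval m : ℕ) : ℝ) + 1 ≤ (((q.eval 1 : ℕ) : ℝ) + 1) * (m + 1) ^ d := by
    exact_mod_cast eval_add_one_le q m
  have hm1 : (m : ℝ) + 1 ≤ Real.exp m := Real.add_one_le_exp _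
  have hs : 0 ≤ 2 * s := by
    by_contra h
    have : (0 : ℝ) ≤ L := Nat.cast_nonneg _
    nlinarith [(Nat.cast_nonneg m : (0 : ℝ) ≤ m)]
  push_cast
  -- There are `29 + 1 + d` factors `m + 1 ≤ exp m`, and one more `exp m` bounds `2 ^ m`.
  calc (2000 : ℝ) * L ^ 29 * (2 ^ m * (m + 1) * ((q.eval m : ℕ) + 1))
      ≤ 2000 * (2 * s * (m + 1)) ^ 29 *
          (2 ^ m * (m + 1) * ((((q.eval 1 : ℕ) : ℝ) + 1) * (m + 1) ^ d)) := by gcongr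
    _ = 2000 * (2 * s) ^ 29 * ((((q.eval 1 : ℕ) : ℝ) + 1) * 2 ^ m * (m + 1) ^ (30 + d)) := by ring
    _ ≤ 2000 * (2 * s) ^ 29 * (Real.exp (q.eval 1 : ℕ) * Real.exp m * Real.exp m ^ (30 + d)) := by
        gcongr
        · exact Real.add_one_le_exp _
        · exact two_pow_le_exp m
    _ = 2000 * (2 * s) ^ 29 * Real.exp ((q.eval 1 : ℕ) + (31 + d) * m) := by
        rw [← Real.exp_nat_mul, ← Real.exp_add, ← Real.exp_add]
        push_cast
        ring_nf
    _ ≤ _ := by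
        gcongr
        have h1 : ((q.eval 1 : ℕ) : ℝ) ≤ (q.eval 1 : ℕ) * (1 + z) :=
          le_mul_of_one_le_right (Nat.cast_nonneg _) (by linarith)
        have h2 : (31 + (d : ℝ)) * m ≤ (31 + d) * (c * (1 + z)) := by gcongr
        linarith

end RunningTime

/-! ## The parameters -/

section Parameters

lemma ceil_logb_le {β : ℝ} (hβ : β ∈ Ioo (0 : ℝ) 1) :
    (⌈Real.logb 2 (1 / β)⌉₊ : ℝ) ≤ 2 * Real.log (1 / β) + 1 := by
  have h1 : 0 ≤ Real.log (1 / β) := Real.log_nonneg (by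
    rw [le_div_iff₀ hβ.1]; linarith [hβ.2])
  have h2 : Real.logb 2 (1 / β) ≤ 2 * Real.log (1 / β) := by
    rw [Real.logb, div_le_iff₀ (Real.log_pos (by norm_num))]
    nlinarith [Real.log_two_gt_d9]
  have h3 : 0 ≤ Real.logb 2 (1 / β) := div_nonneg h1 (Real.log_nonneg (by norm_num))
  linarith [Nat.ceil_lt_add_one h3]

lemma half_pow_le_of_ceil_le {α : ℝ} (hα : α ∈ Ioo (0 : ℝ) 1) {κ : ℕ} (h : ⌈1 / α⌉₊ ≤ 2 ^ κ) :
    (1 / 2) ^ κ ≤ α := by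
  have h1 : 1 / α ≤ 2 ^ κ := by
    calc 1 / α ≤ ⌈1 / α⌉₊ := Nat.le_ceil _
      _ ≤ _ := by exact_mod_cast h
  rw [one_div, inv_pow]
  exact inv_le_of_inv_le₀ hα.1 (by simpa using h1)

lemma two_mul_exp_neg_le {β : ℝ} (hβ : β ∈ Ioo (0 : ℝ) 1) {κ : ℕ}
    (h : ⌈Real.logb 2 (1 / β)⌉₊ + 1 ≤ 2 ^ κ) : 2 * Real.exp (-2 ^ κ) ≤ β := by
  set b := ⌈Real.logb 2 (1 / β)⌉₊
  have h1 : 1 / β ≤ 2 ^ b := by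
    have h2 := Nat.le_ceil (Real.logb 2 (1 / β))
    rw [Real.logb_le_iff_le_rpow (by norm_num) (one_div_pos.2 hβ.1), Real.rpow_natCast] at h2
    exact h2
  have h2 : ((b : ℝ)) + 1 ≤ 2 ^ κ := by exact_mod_cast h
  have h3 : 2 * (1 / β) ≤ Real.exp (2 ^ κ) := by
    calc 2 * (1 / β) ≤ 2 * 2 ^ b := by gcongr
      _ = 2 ^ (b + 1) := by ring
      _ ≤ Real.exp ((b + 1 : ℕ) : ℝ) := two_pow_le_exp _
      _ ≤ _ := Real.exp_le_exp.2 (by push_cast; exact h2)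
  have hβ0 := hβ.1
  rw [Real.exp_neg, ← div_eq_mul_inv, div_le_iff₀ (Real.exp_pos _)]
  calc (2 : ℝ) = β * (2 * (1 / β)) := by field_simp
    _ ≤ _ := by gcongr

lemma two_pow_clog_le {n : ℕ} (hn : 1 < n) : 2 ^ Nat.clog 2 n ≤ 2 * n := by
  have h := Nat.pow_pred_clog_lt_self (b := 2) (by norm_num) hn
  have h0 : 0 < Nat.clog 2 n := Nat.clog_pos (by norm_num) hn
  obtain ⟨k, hk⟩ := Nat.exists_eq_succ_of_ne_zero h0.ne'
  rw [hk, Nat.pred_succ] at h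
  rw [hk, pow_succ]
  omega

end Parameters

end ReplicablePrivacy

/-! ### Assembly of the theorem. -/

open ReplicablePrivacy

theorem theorem5p2 :
    ∃ train pred : Cmd,
    ∀ (p : MvPolynomial (Fin 4) ℕ) (q : Polynomial ℕ),
    ∃ (P : MvPolynomial (Fin 4) ℕ) (Q : MvPolynomial (Fin 3) ℕ) (K : ℕ),
    ∀ (X R H : Type*) [MeasurableSpace X] [MeasurableSpace R] [MeasurableSpace H]
      (ν : Measure R) [IsProbabilityMeasure ν] (C : Set (X → Bool)) (dim : ℝ), 0 ≤ dim →
    ∀ A : Learner X R H, A.IsEfficientPureDP ν C dim p q →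
    ∀ x₀ : X, ∀ α ∈ Set.Ioo (0 : ℝ) 1, ∀ ρ ∈ Set.Ioo (0 : ℝ) 1, ∀ β ∈ Set.Ioo (0 : ℝ) 1,
    ∃ (n : ℕ) (fit : (Fin n → X × Bool) → Seed R → Model H) (hyp : Model H → X → Bool),
      (n : ℝ) ≤ MvPolynomial.aeval ![1 / α, 1 / ρ, Real.log (1 / β), dim] P ∧
      Trains A train x₀ α ρ β fit
        (MvPolynomial.aeval ![1 / α, 1 / ρ, Real.log (1 / β)] Q *
          Real.exp (K * (1 + dim ^ p.degreeOf 3))) ∧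
      (∀ S ω, Predicts A pred (fit S ω) (hyp (fit S ω))
        (MvPolynomial.aeval ![1 / α, 1 / ρ, Real.log (1 / β)] Q *
          Real.exp (K * (1 + dim ^ p.degreeOf 3)))) ∧
      IsReplicable (seedLaw ν) fit ρ ∧
      IsPAC (seedLaw ν) C (fun S ω => hyp (fit S ω)) α β := by
  refine ⟨learn, majority, fun p q => ⟨
    -- A bound for `L ^ 24` with `L ≤ 2 * s`. Here `67` is `64` plus three roundings up, `2 * log
    -- (1/β)` dominates the binary logarithm, and `p` at `16, 2, 1, dim` bounds `m`, with `1` in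
    -- place of `log 2`.
    (2 * (MvPolynomial.X 0 + MvPolynomial.X 1 + 2 * MvPolynomial.X 2 +
      MvPolynomial.bind₁ ![16, 2, 1, MvPolynomial.X 3] p + 67)) ^ 24,
    2000 * (2 * (MvPolynomial.X 0 + MvPolynomial.X 1 + 2 * MvPolynomial.X 2 + 67)) ^ 29,
    q.eval 1 + (31 + q.natDegree) * MvPolynomial.eval ![16, 2, 1, 1] p, ?_⟩⟩
  intro X R H _ _ _ ν _ C dim hdim A hA x₀ α hα ρ hρ β hβ
  have h16 : (1 / 16 : ℝ) ∈ Ioo (0 : ℝ) 1 := by norm_num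
  have h2 : (1 / 2 : ℝ) ∈ Ioo (0 : ℝ) 1 := by norm_num
  set m := dummySize A with hm
  set s := ⌈1 / α⌉₊ + ⌈1 / ρ⌉₊ + ⌈Real.logb 2 (1 / β)⌉₊ + m + 64 with hs
  set κ := Nat.clog 2 s with hκ
  have hsκ : s ≤ 2 ^ κ := Nat.le_pow_clog (by norm_num) s
  have hκs : 2 ^ κ ≤ 2 * s := two_pow_clog_le (by omega)
  have hmp : (m : ℝ) ≤ MvPolynomial.aeval ![((16 : ℕ) : ℝ), (2 : ℕ), (1 : ℕ), dim] p := by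
    refine (hA.size_le _ h16 _ h2 _ h2).trans (aeval_mono p ?_ ?_)
    · intro i
      fin_cases i <;> simp [hdim, Real.log_nonneg]
    · intro i
      have := Real.log_two_lt_d9
      fin_cases i <;> norm_num
      linarith
  have hm2 := hmp.trans (aeval_le_mul_one_add_pow p 16 2 1 hdim)
  have ha : (⌈1 / α⌉₊ : ℝ) ≤ 1 / α + 1 := (Nat.ceil_lt_add_one (one_div_pos.2 hα.1).le).le
  have hr : (⌈1 / ρ⌉₊ : ℝ) ≤ 1 / ρ + 1 := (Nat.ceil_lt_add_one (one_div_pos.2 hρ.1).le).le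
  have hb := ceil_logb_le hβ
  have hsR : (s : ℝ) ≤ 1 / α + 1 / ρ + 2 * Real.log (1 / β) + m + 67 := by
    rw [hs]; push_cast; linarith
  have hκR : ((2 ^ κ : ℕ) : ℝ) ≤ 2 * s := by exact_mod_cast hκs
  have hz : (0 : ℝ) ≤ dim ^ p.degreeOf 3 := pow_nonneg hdim _
  -- Splitting off the factor `m + 1` keeps `dim` out of `Q`; the factor goes into the exponential.
  have hQ : ((2 ^ κ : ℕ) : ℝ) ≤
      2 * (1 / α + 1 / ρ + 2 * Real.log (1 / β) + 67) * (m + 1) := by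
    have h0 : (0 : ℝ) ≤ 1 / α + 1 / ρ + 2 * Real.log (1 / β) := by
      have := Real.log_nonneg (show 1 ≤ 1 / β by rw [le_div_iff₀ hβ.1]; linarith [hβ.2])
      have := one_div_pos.2 hα.1
      have := one_div_pos.2 hρ.1
      linarith
    have h1 : (0 : ℝ) ≤ m := Nat.cast_nonneg m
    have h3 := mul_nonneg h0 h1
    linarith only [h0, h1, h3, hsR, hκR]
  have htime := time_le_poly_mul_exp q hz hQ hm2
  have hQe : MvPolynomial.aeval ![1 / α, 1 / ρ, Real.log (1 / β)]
      (2000 * (2 * (MvPolynomial.X 0 + MvPolynomial.X 1 + 2 * MvPolynomial.X 2 + 67)) ^ 29 :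
        MvPolynomial (Fin 3) ℕ) =
      2000 * (2 * (1 / α + 1 / ρ + 2 * Real.log (1 / β) + 67)) ^ 29 := by
    simp
  rw [hQe]
  refine ⟨2 ^ (24 * κ), learnedModel A x₀ κ, majorityHyp A, ?_, ?_, ?_, ?_, ?_⟩
  · have hvec : (fun i : Fin 4 => MvPolynomial.aeval ![1 / α, 1 / ρ, Real.log (1 / β), dim]
        ((![16, 2, 1, MvPolynomial.X 3] : Fin 4 → MvPolynomial (Fin 4) ℕ) i)) =
        ![((16 : ℕ) : ℝ), (2 : ℕ), (1 : ℕ), dim] := by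
      ext i
      fin_cases i <;> simp
    simp only [map_pow, map_mul, map_add, map_ofNat, MvPolynomial.aeval_X,
      MvPolynomial.aeval_bind₁, hvec]
    rw [mul_comm 24 κ, pow_mul, Nat.cast_pow]
    refine pow_le_pow_left₀ (Nat.cast_nonneg _) ?_ 24
    simp only [Matrix.cons_val]
    generalize MvPolynomial.aeval ![((16 : ℕ) : ℝ), (2 : ℕ), (1 : ℕ), dim] p = y at hmp ⊢
    linarith only [hmp, hsR, hκR]
  · intro S ω
    obtain ⟨t, st, he, ho, ht⟩ := exec_learn (A := A) (θ := q.eval m) (τ := q.eval m)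
      (hA.fitTime_le _ h16 _ h2 _ h2) (hA.predictTime_le _ h16 _ h2 _ h2) x₀ α ρ β hκ S ω
    refine ⟨t, st, he, ho, ?_⟩
    have hlen : (learnedModel A x₀ κ S ω).words.length = 39 + 4 * κ := by
      simp [learnedModel, outWords, learned]
    rw [hlen]
    refine le_trans ?_ htime
    exact_mod_cast (Nat.add_le_add_right ht _).trans (learnTime_le m κ (q.eval m))
  · intro S ω
    refine predicts_majority (hA.predictTime_le _ h16 _ h2 _ h2) x₀ S ω (le_trans ?_ htime)
    exact_mod_cast predictTime_le m κ (q.eval m)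
  · exact isReplicable_learnedModel (by omega) x₀ (half_pow_le_of_ceil_le hρ (by omega))
  · exact isPAC_learnedModel (hA.dp _ h16 _ h2 _ h2) (hA.pac _ h16 _ h2 _ h2) (by omega) x₀
      (half_pow_le_of_ceil_le hα (by omega)) (two_mul_exp_neg_le hβ (by omega))
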